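/- **Quantum group.** Let $U_q$ be the associative algebra over the field $\mathbb C(q)$ of rational functions with generators $E,F,K,K^{-1}$ and relations $KK^{-1}=K^{-1}K=1$, $KE=q^2EK$, $KF=q^{-2}FK$, $EF-FE=\frac{K-K^{-1}}{q-q^{-1}}$. It acts on tensor products through $\Delta E=E\otimes 1+K\otimes E$, $\Delta F=F\otimes K^{-1}+1\otimes F$, $\Delta K^{\pm1}=K^{\pm1}\otimes K^{\pm1}$. With $[n]=\frac{q^n-q^{-n}}{q-q^{-1}}$, let $V_\mu$ be the module with basis $v_\mu,v_{\mu-2},\dots,v_{-\mu}$ and $K^{\pm1}v_m=q^{\pm m}v_m$, $Ev_m=[\frac{\mu+m}2+1]v_{m+2}$, $Fv_m=[\frac{\mu-m}2+1]v_{m-2}$. **Crossingless matches.** Let $\mathbf d\in(\mathbb Z_{\ge0})^k$ and $d=\sum_i\mathbf d_i$. Place boxes with $\mathbf d_1,\dots,\mathbf d_k$ vertices on a line, from left to right. A lower crossingless match $b$ is a set of pairwise disjoint, non-crossing curves, each joining two vertices of different boxes, such that no unmatched vertex lies below a curve. We write $b\in CM(\mu)$ if $b$ has $\mu$ unmatched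 vertices; let $r$ be its number of curves (so $\mu=d-2r$), and $\mathbf n^b_i=\mathbf d_i-\#\{\text{right endpoints of curves in box } i\}$. An oriented lower crossingless match $\mathbf a$ is a lower crossingless match, denoted $\bar{\mathbf a}$, with an up or down arrow at each vertex, such that left endpoints of curves are down, right endpoints are up, and every unmatched down vertex is to the right of every unmatched up vertex. Let $|\mathbf a|$ be its number of down arrows. **Varieties.** Let $\mathbb F$ be a finite field and $D$ a $d$-dimensional $\mathbb F$-vector space. Let $M(d)$ be the variety of pairs $(W,t)$, $t\in\operatorname{End}D$, $\operatorname{im}t\subset W\subset\ker t$; let $M^r(w,d)$ be its part with $\dim W=w$, $\operatorname{rank}t=r$, and $\mathcal M^r(d)=\bigoplus_w\mathbb C(q)\mathbf 1_{M^r(w,d)}$. Let $\mathfrak T(\mathbf d)$ be the variety of triples $(\mathbf D,W,t)$ with $(W,t)\in M(d)$ and a flag $0=\mathbf D_0\subset\dots\subset\mathbf D_k=D$ with $\dim\mathbf D_i/\mathbf D_{i-1}=\mathbf d_i$ and $t(\mathbf D_i)\subset\mathbf D_{i-1}$. Put $\alpha(U,\mathbf D)_i=\dim(U\cap\mathbf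 D_i)/(U\cap\mathbf D_{i-1})$. Functions on the $\mathbb F$-points take values in $\mathbb C(q)$ and are constant on strata; the strata of $M(d)$ are the $M^r(w,d)$, those of $\mathfrak T(\mathbf d)$ are given by fixing $\alpha(W,\mathbf D)$, $\alpha(\operatorname{im}t,\mathbf D)$ and $\alpha(\ker t,\mathbf D)$. Points are counted as functions of $q$, with $q^2$ standing for the size of the field: if $Y$ has $P(|L|)$ points over every finite extension $L$ of $\mathbb F$, with $P\in\mathbb Z[x]$, then $\chi_q(Y)=P(q^2)$. A "sum" of $f$ over a variety $Z$ means $\sum_S f(S)\,\chi_q(Z\cap S)$, over the strata $S$. On functions on $M(d)$, and on $\mathfrak T(\mathbf d)$ with $\mathbf D$ fixed throughout, put $$Ef(W,t)=q^{-(\dim\ker t-\dim W-1)}\sum_{W\subset U\subset\ker t,\ \dim U=\dim W+1}f(U,t),$$ $$Ff(W,t)=q^{-(\dim W-\operatorname{rank}t-1)}\sum_{\operatorname{im}t\subset U\subset W,\ \dim U=\dim W-1}f(U,t),\qquad K^{\pm1}f(W,t)=q^{\pm(d-2\dim W)}f(W,t).$$ Let $\mathcal T_s(\mathbf d)$ be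 the space of functions on $\mathfrak T(\mathbf d)$ whose value at $(\mathbf D,W,t)$ depends only on $\dim W$ and $\alpha(\ker t,\mathbf D)$. Let $Y_b=\{\alpha(\ker t,\mathbf D)=\mathbf n^b\}$ and $Y_{\mathbf a}=\{\alpha(\ker t,\mathbf D)=\mathbf n^{\bar{\mathbf a}},\ \dim W=|\mathbf a|\}$. For a lower crossingless match $b$ let $(T_{Y_b}f)(W,t)$ be the sum of $\mathbf 1_{Y_b}f$ over the fibre of $\mathfrak T(\mathbf d)\to M(d)$, $(\mathbf D,W,t)\mapsto(W,t)$, and let $\mathcal B_I=\{T_{Y_b}\}_b$. **Theorem.** There are nonzero constants $c_b\in\mathbb C(q)$, depending only on $\mathbf d$ and $b$, such that the following holds for all $\mathbb F$ and $D$. 1. The functions $\mathbf 1_{Y_{\mathbf a}}$ form a basis of $\mathcal T_s(\mathbf d)$. The operators $E,F,K^{\pm1}$ make $\mathcal T_s(\mathbf d)$ a $U_q$-module isomorphic to $V_{\mathbf d_1}\otimes\dots\otimes V_{\mathbf d_k}$, and, for $b\in CM(\mu)$ with $r$ curves, they make $\mathcal M^r(d)$ a $U_q$-module isomorphic to $V_\mu=V_{d-2r}$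 by $\mathbf 1_{M^r(w,d)}\mapsto v_{d-2w}$. 2. The set $\mathcal B_I$, acting on $\mathcal T_s(\mathbf d)$, spans the space of intertwiners: under the identification $\mathcal M^r(d)\cong V_\mu$ above and any $U_q$-isomorphism $\mathcal T_s(\mathbf d)\cong V_{\mathbf d_1}\otimes\dots\otimes V_{\mathbf d_k}$, each $T_{Y_b}$ with $b\in CM(\mu)$ is an element of $\operatorname{Hom}_{U_q}(V_{\mathbf d_1}\otimes\dots\otimes V_{\mathbf d_k},V_\mu)$, and all of them together span $\bigoplus_\mu\operatorname{Hom}_{U_q}(V_{\mathbf d_1}\otimes\dots\otimes V_{\mathbf d_k},V_\mu)$. 3. For every oriented lower crossingless match $\mathbf a$ and every $b\in CM(\mu)$ with $r$ curves, $$T_{Y_b}\mathbf 1_{Y_{\mathbf a}}=\begin{cases}c_b\,\mathbf 1_{M^r(|\mathbf a|,d)}&\text{if }\bar{\mathbf a}=b,\\0&\text{if }\bar{\mathbf a}\neq b.\end{cases}$$ -/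

import Mathlib

open scoped TensorProduct

noncomputable section

/-! ### The quantum group over the field of rational functions `ℂ(q)` -/

/-- The field `ℂ(q)` of rational functions in an indeterminate `q`. -/
abbrev Cq : Type := RatFunc ℂ

/-- The indeterminate `q`. -/
def qq : Cq := RatFunc.X

/-- The quantum integer `[n] = (q^n - q^{-n}) / (q - q^{-1})`. -/
def qint (n : ℤ) : Cq := (qq ^ n - qq ^ (-n)) / (qq - qq⁻¹)

/-- The generators `E`, `F`, `K`, `K⁻¹`. -/
inductive UqGen : Type
  | E | F | K | Ki

/-- The defining relations of `U_q(sl_2)`. -/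
inductive UqRel : FreeAlgebra Cq UqGen → FreeAlgebra Cq UqGen → Prop
  | K_Ki : UqRel (FreeAlgebra.ι Cq UqGen.K * FreeAlgebra.ι Cq UqGen.Ki) 1
  | Ki_K : UqRel (FreeAlgebra.ι Cq UqGen.Ki * FreeAlgebra.ι Cq UqGen.K) 1
  | K_E : UqRel (FreeAlgebra.ι Cq UqGen.K * FreeAlgebra.ι Cq UqGen.E)
      (qq ^ 2 • (FreeAlgebra.ι Cq UqGen.E * FreeAlgebra.ι Cq UqGen.K))
  | K_F : UqRel (FreeAlgebra.ι Cq UqGen.K * FreeAlgebra.ι Cq UqGen.F)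
      ((qq ^ 2)⁻¹ • (FreeAlgebra.ι Cq UqGen.F * FreeAlgebra.ι Cq UqGen.K))
  | E_F : UqRel (FreeAlgebra.ι Cq UqGen.E * FreeAlgebra.ι Cq UqGen.F
        - FreeAlgebra.ι Cq UqGen.F * FreeAlgebra.ι Cq UqGen.E)
      ((qq - qq⁻¹)⁻¹ • (FreeAlgebra.ι Cq UqGen.K - FreeAlgebra.ι Cq UqGen.Ki))

/-- The quantum group `U_q(sl_2)`, as an associative algebra over `ℂ(q)`. -/
abbrev Uq : Type := RingQuot UqRel

namespace Uq

/-- The image of a generator in `U_q`. -/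
def gen (g : UqGen) : Uq := RingQuot.mkAlgHom Cq UqRel (FreeAlgebra.ι Cq g)

/-- Four elements of an algebra that satisfy the relations of `U_q` define an algebra map. -/
def lift {A : Type*} [Ring A] [Algebra Cq A] (x : UqGen → A)
    (h1 : x .K * x .Ki = 1) (h2 : x .Ki * x .K = 1)
    (h3 : x .K * x .E = qq ^ 2 • (x .E * x .K))
    (h4 : x .K * x .F = (qq ^ 2)⁻¹ • (x .F * x .K))
    (h5 : x .E * x .F - x .F * x .E = (qq - qq⁻¹)⁻¹ • (x .K - x .Ki)) : Uq →ₐ[Cq] A :=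
  RingQuot.liftAlgHom Cq ⟨FreeAlgebra.lift Cq x, by
    intro a b h
    cases h <;> simp only [map_mul, map_sub, map_smul, map_one, FreeAlgebra.lift_ι_apply] <;>
      assumption⟩

@[simp] theorem lift_gen {A : Type*} [Ring A] [Algebra Cq A] (x : UqGen → A)
    (h1 : x .K * x .Ki = 1) (h2 : x .Ki * x .K = 1)
    (h3 : x .K * x .E = qq ^ 2 • (x .E * x .K))
    (h4 : x .K * x .F = (qq ^ 2)⁻¹ • (x .F * x .K))
    (h5 : x .E * x .F - x .F * x .E = (qq - qq⁻¹)⁻¹ • (x .K - x .Ki)) (g : UqGen) :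
    lift x h1 h2 h3 h4 h5 (gen g) = x g := by
  simp [lift, gen]

theorem K_mul_Ki : gen .K * gen .Ki = 1 := by
  simpa only [gen, map_mul, map_one] using RingQuot.mkAlgHom_rel Cq UqRel.K_Ki

theorem Ki_mul_K : gen .Ki * gen .K = 1 := by
  simpa only [gen, map_mul, map_one] using RingQuot.mkAlgHom_rel Cq UqRel.Ki_K

theorem K_mul_E : gen .K * gen .E = qq ^ 2 • (gen .E * gen .K) := by
  simpa only [gen, map_mul, map_smul] using RingQuot.mkAlgHom_rel Cq UqRel.K_E

theorem K_mul_F : gen .K * gen .F = (qq ^ 2)⁻¹ • (gen .F * gen .K) := by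
  simpa only [gen, map_mul, map_smul] using RingQuot.mkAlgHom_rel Cq UqRel.K_F

theorem E_mul_F_sub : gen .E * gen .F - gen .F * gen .E
    = (qq - qq⁻¹)⁻¹ • (gen .K - gen .Ki) := by
  simpa only [gen, map_mul, map_smul, map_sub] using RingQuot.mkAlgHom_rel Cq UqRel.E_F

end Uq

theorem qq_ne_zero : qq ≠ 0 := RatFunc.X_ne_zero

namespace Uq

theorem Ki_mul_E : gen .Ki * gen .E = (qq ^ 2)⁻¹ • (gen .E * gen .Ki) := by
  have h : gen .Ki * (gen .K * gen .E) * gen .Ki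
      = gen .Ki * (qq ^ 2 • (gen .E * gen .K)) * gen .Ki := by rw [K_mul_E]
  have h' : gen .E * gen .Ki = qq ^ 2 • (gen .Ki * gen .E) := by
    calc gen .E * gen .Ki = gen .Ki * (gen .K * gen .E) * gen .Ki := by
          rw [← mul_assoc (gen .Ki), Ki_mul_K, one_mul]
      _ = gen .Ki * (qq ^ 2 • (gen .E * gen .K)) * gen .Ki := h
      _ = qq ^ 2 • (gen .Ki * gen .E * (gen .K * gen .Ki)) := by
          simp only [mul_smul_comm, smul_mul_assoc, mul_assoc]
      _ = _ := by rw [K_mul_Ki, mul_one]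
  rw [h', smul_smul, inv_mul_cancel₀ (pow_ne_zero 2 qq_ne_zero), one_smul]

/-- The values of the comultiplication on the generators. -/
def comulGen : UqGen → Uq ⊗[Cq] Uq
  | .E => gen .E ⊗ₜ 1 + gen .K ⊗ₜ gen .E
  | .F => gen .F ⊗ₜ gen .Ki + 1 ⊗ₜ gen .F
  | .K => gen .K ⊗ₜ gen .K
  | .Ki => gen .Ki ⊗ₜ gen .Ki

/-- The comultiplication `Δ` of `U_q`. -/
def comul : Uq →ₐ[Cq] Uq ⊗[Cq] Uq :=
  lift comulGen
    (by simp [comulGen, K_mul_Ki, Algebra.TensorProduct.one_def])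
    (by simp [comulGen, Ki_mul_K, Algebra.TensorProduct.one_def])
    (by
      simp only [comulGen, mul_add, add_mul, Algebra.TensorProduct.tmul_mul_tmul, mul_one, one_mul,
        K_mul_E, smul_add, TensorProduct.smul_tmul', TensorProduct.tmul_smul])
    (by
      simp only [comulGen, mul_add, add_mul, Algebra.TensorProduct.tmul_mul_tmul, mul_one, one_mul,
        K_mul_F, smul_add, TensorProduct.smul_tmul', TensorProduct.tmul_smul, K_mul_Ki, Ki_mul_K])
    (by
      have hE : gen .E * gen .F = gen .F * gen .E + (qq - qq⁻¹)⁻¹ • (gen .K - gen .Ki) := by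
        rw [← E_mul_F_sub]; abel
      simp only [comulGen, mul_add, add_mul, Algebra.TensorProduct.tmul_mul_tmul, mul_one, one_mul,
        hE, K_mul_F, Ki_mul_E, TensorProduct.tmul_smul, TensorProduct.tmul_add,
        TensorProduct.add_tmul, ← TensorProduct.smul_tmul', TensorProduct.tmul_sub,
        TensorProduct.sub_tmul, smul_sub]
      abel)

/-- The counit `η` of `U_q`. -/
def counit : Uq →ₐ[Cq] Cq :=
  lift (fun g => match g with | .E => 0 | .F => 0 | .K => 1 | .Ki => 1)
    (by simp) (by simp) (by simp) (by simp) (by simp)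

end Uq

/-- A `U_q`-module, given by its underlying `ℂ(q)`-vector space and the action. -/
structure URep where
  V : Type
  [addCommGroup : AddCommGroup V]
  [module : Module Cq V]
  ρ : Uq →ₐ[Cq] Module.End Cq V

attribute [instance] URep.addCommGroup URep.module

namespace URep

/-- The tensor product of two `U_q`-modules, on which `u` acts through `Δ u`. -/
def tensor (M N : URep) : URep where
  V := M.V ⊗[Cq] N.V
  ρ := (Module.endTensorEndAlgHom (R := Cq) (S := Cq) (A := Cq)).comp
    ((Algebra.TensorProduct.map M.ρ N.ρ).comp Uq.comul)

/-- The trivial module. -/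
def trivial : URep where
  V := Cq
  ρ := (Algebra.lmul Cq Cq).comp Uq.counit

/-- The space `Hom_{U_q}(M, N)` of intertwiners. -/
def Hom (M N : URep) : Submodule Cq (M.V →ₗ[Cq] N.V) where
  carrier := {φ | ∀ (u : Uq) (x : M.V), φ (M.ρ u x) = N.ρ u (φ x)}
  add_mem' := fun hf hg u x => by simp [hf u x, hg u x]
  zero_mem' := fun u x => by simp
  smul_mem' := fun c f hf u x => by simp [hf u x]

end URep

/-- The vector `v_m` of weight `m` in `V_μ`; the vectors `v_μ, v_{μ-2}, …, v_{-μ}` form the standard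
basis (`v_{μ-2j}` is the `j`-th one), and `v_m = 0` for all other `m`. -/
def vvec (μ : ℕ) (m : ℤ) : Fin (μ + 1) → Cq := fun j => if (μ : ℤ) - 2 * (j : ℕ) = m then 1 else 0

/-- The action of the generators on `V_μ`: `K^{±1} v_m = q^{±m} v_m`,
`E v_m = [(μ+m)/2 + 1] v_{m+2}`, `F v_m = [(μ-m)/2 + 1] v_{m-2}`, where `m = μ - 2j`. -/
def irrGen (μ : ℕ) : UqGen → Module.End Cq (Fin (μ + 1) → Cq)
  | .E => (Pi.basisFun Cq (Fin (μ + 1))).constr Cq fun j =>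
      qint (μ - (j : ℕ) + 1) • vvec μ (μ - 2 * (j : ℕ) + 2)
  | .F => (Pi.basisFun Cq (Fin (μ + 1))).constr Cq fun j =>
      qint ((j : ℕ) + 1) • vvec μ (μ - 2 * (j : ℕ) - 2)
  | .K => (Pi.basisFun Cq (Fin (μ + 1))).constr Cq fun j =>
      qq ^ ((μ : ℤ) - 2 * (j : ℕ)) • vvec μ (μ - 2 * (j : ℕ))
  | .Ki => (Pi.basisFun Cq (Fin (μ + 1))).constr Cq fun j =>
      qq ^ (-((μ : ℤ) - 2 * (j : ℕ))) • vvec μ (μ - 2 * (j : ℕ))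

theorem basisFun_eq_vvec (μ : ℕ) (j : Fin (μ + 1)) :
    Pi.basisFun Cq (Fin (μ + 1)) j = vvec μ (μ - 2 * (j : ℕ)) := by
  ext i
  have : ((μ : ℤ) - 2 * (i : ℕ) = μ - 2 * (j : ℕ)) ↔ i = j := by rw [Fin.ext_iff]; omega
  simp [vvec, Pi.single_apply, this]

theorem vvec_eq_zero {μ : ℕ} {m : ℤ} (h : ∀ j : ℕ, j ≤ μ → (μ : ℤ) - 2 * j ≠ m) :
    vvec μ m = 0 := by
  ext j
  simp [vvec, h j (by omega)]

theorem irrGen_E_vvec {μ j : ℕ} (hj : j ≤ μ) : irrGen μ .E (vvec μ (μ - 2 * j)) =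
    qint (μ - j + 1) • vvec μ (μ - 2 * j + 2) := by
  have := (Pi.basisFun Cq (Fin (μ + 1))).constr_basis Cq (fun j : Fin (μ + 1) =>
      qint (μ - (j : ℕ) + 1) • vvec μ (μ - 2 * (j : ℕ) + 2)) ⟨j, by omega⟩
  rw [basisFun_eq_vvec] at this
  exact this

theorem irrGen_F_vvec {μ j : ℕ} (hj : j ≤ μ) : irrGen μ .F (vvec μ (μ - 2 * j)) =
    qint (j + 1) • vvec μ (μ - 2 * j - 2) := by
  have := (Pi.basisFun Cq (Fin (μ + 1))).constr_basis Cq (fun j : Fin (μ + 1) =>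
      qint ((j : ℕ) + 1) • vvec μ (μ - 2 * (j : ℕ) - 2)) ⟨j, by omega⟩
  rw [basisFun_eq_vvec] at this
  exact this

theorem irrGen_K_vvec (μ : ℕ) (m : ℤ) : irrGen μ .K (vvec μ m) = qq ^ m • vvec μ m := by
  by_cases h : ∃ j : ℕ, j ≤ μ ∧ (μ : ℤ) - 2 * j = m
  · obtain ⟨j, hj, rfl⟩ := h
    have := (Pi.basisFun Cq (Fin (μ + 1))).constr_basis Cq (fun j : Fin (μ + 1) =>
      qq ^ ((μ : ℤ) - 2 * (j : ℕ)) • vvec μ (μ - 2 * (j : ℕ))) ⟨j, by omega⟩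
    rw [basisFun_eq_vvec] at this
    exact this
  · push Not at h
    rw [vvec_eq_zero h, map_zero, smul_zero]

theorem irrGen_Ki_vvec (μ : ℕ) (m : ℤ) : irrGen μ .Ki (vvec μ m) = qq ^ (-m) • vvec μ m := by
  by_cases h : ∃ j : ℕ, j ≤ μ ∧ (μ : ℤ) - 2 * j = m
  · obtain ⟨j, hj, rfl⟩ := h
    have := (Pi.basisFun Cq (Fin (μ + 1))).constr_basis Cq (fun j : Fin (μ + 1) =>
      qq ^ (-((μ : ℤ) - 2 * (j : ℕ))) • vvec μ (μ - 2 * (j : ℕ))) ⟨j, by omega⟩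
    rw [basisFun_eq_vvec] at this
    exact this
  · push Not at h
    rw [vvec_eq_zero h, map_zero, smul_zero]

theorem qq_sub_inv_ne_zero : qq - qq⁻¹ ≠ 0 := by
  intro h
  have h1 : qq * qq = 1 := by
    have := congrArg (· * qq) h
    simpa [sub_mul, qq_ne_zero, sub_eq_zero] using this
  have h2 : algebraMap (Polynomial ℂ) Cq (Polynomial.X * Polynomial.X) =
      algebraMap (Polynomial ℂ) Cq 1 := by
    simpa [qq, RatFunc.algebraMap_X] using h1
  have h3 := RatFunc.algebraMap_injective ℂ h2
  have := congrArg (Polynomial.eval 0) h3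
  simp at this

theorem qint_identity (a b : ℤ) :
    qint (b + 1) * qint a - qint (a + 1) * qint b
      = (qq - qq⁻¹)⁻¹ * (qq ^ (a - b) - qq ^ (-(a - b))) := by
  have hq := qq_ne_zero
  have h := qq_sub_inv_ne_zero
  have key : (qq ^ (b + 1) - qq ^ (-(b + 1))) * (qq ^ a - qq ^ (-a))
      - (qq ^ (a + 1) - qq ^ (-(a + 1))) * (qq ^ b - qq ^ (-b))
      = (qq - qq⁻¹) * (qq ^ (a - b) - qq ^ (-(a - b))) := by
    simp only [zpow_sub₀ hq, zpow_add₀ hq, zpow_neg, zpow_one]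
    have ha := zpow_ne_zero a hq
    have hb := zpow_ne_zero b hq
    field_simp
    ring
  unfold qint
  generalize hs : qq - qq⁻¹ = s at *
  rw [div_mul_div_comm, div_mul_div_comm, ← sub_div, key]
  field_simp

/-- The irreducible `U_q`-module `V_μ`. -/
def irr (μ : ℕ) : URep where
  V := Fin (μ + 1) → Cq
  ρ := Uq.lift (irrGen μ)
    (by
      refine (Pi.basisFun Cq (Fin (μ + 1))).ext fun j => ?_
      rw [basisFun_eq_vvec, Module.End.mul_apply, irrGen_Ki_vvec, map_smul, irrGen_K_vvec,
        smul_smul, ← zpow_add₀ qq_ne_zero]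
      simp)
    (by
      refine (Pi.basisFun Cq (Fin (μ + 1))).ext fun j => ?_
      rw [basisFun_eq_vvec, Module.End.mul_apply, irrGen_K_vvec, map_smul, irrGen_Ki_vvec,
        smul_smul, ← zpow_add₀ qq_ne_zero]
      simp)
    (by
      refine (Pi.basisFun Cq (Fin (μ + 1))).ext fun j => ?_
      have hj : (j : ℕ) ≤ μ := by omega
      rw [basisFun_eq_vvec, LinearMap.smul_apply, Module.End.mul_apply, Module.End.mul_apply,
        irrGen_K_vvec, map_smul, irrGen_E_vvec hj, map_smul, irrGen_K_vvec, smul_smul, smul_smul,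
        smul_smul, zpow_add₀ qq_ne_zero, zpow_ofNat]
      congr 1
      ring)
    (by
      refine (Pi.basisFun Cq (Fin (μ + 1))).ext fun j => ?_
      have hj : (j : ℕ) ≤ μ := by omega
      rw [basisFun_eq_vvec, LinearMap.smul_apply, Module.End.mul_apply, Module.End.mul_apply,
        irrGen_K_vvec, map_smul, irrGen_F_vvec hj, map_smul, irrGen_K_vvec, smul_smul, smul_smul,
        smul_smul, zpow_sub₀ qq_ne_zero, zpow_ofNat]
      congr 1
      field_simp)
    (by
      refine (Pi.basisFun Cq (Fin (μ + 1))).ext fun j => ?_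
      have hj : (j : ℕ) ≤ μ := by omega
      have hEF : irrGen μ .E (irrGen μ .F (vvec μ (μ - 2 * (j : ℕ))))
          = (qint ((j : ℕ) + 1) * qint (μ - (j : ℕ))) • vvec μ (μ - 2 * (j : ℕ)) := by
        rw [irrGen_F_vvec hj, map_smul, mul_smul]
        congr 1
        by_cases h : (j : ℕ) = μ
        · rw [vvec_eq_zero (m := (μ : ℤ) - 2 * (j : ℕ) - 2) (fun i hi => by omega), h]
          simp [qint]
        · have := irrGen_E_vvec (μ := μ) (j := (j : ℕ) + 1) (by omega)
          push_cast at this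
          convert this using 2 <;> (congr 1; ring)
      have hFE : irrGen μ .F (irrGen μ .E (vvec μ (μ - 2 * (j : ℕ))))
          = (qint (μ - (j : ℕ) + 1) * qint (j : ℕ)) • vvec μ (μ - 2 * (j : ℕ)) := by
        rw [irrGen_E_vvec hj, map_smul, mul_smul]
        congr 1
        by_cases h : (j : ℕ) = 0
        · rw [vvec_eq_zero (m := (μ : ℤ) - 2 * (j : ℕ) + 2) (fun i hi => by omega), h]
          simp [qint]
        · obtain ⟨i, hi⟩ := Nat.exists_eq_succ_of_ne_zero h
          have := irrGen_F_vvec (μ := μ) (j := i) (by omega)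
          rw [hi]
          push_cast
          convert this using 2 <;> (congr 1; ring)
      rw [basisFun_eq_vvec, LinearMap.sub_apply, Module.End.mul_apply, Module.End.mul_apply, hEF,
        hFE, LinearMap.smul_apply, LinearMap.sub_apply, irrGen_K_vvec, irrGen_Ki_vvec, ← sub_smul,
        ← sub_smul, smul_smul, qint_identity]
      congr 3 <;> ring_nf)

/-- `V_{d_1} ⊗ (V_{d_2} ⊗ (⋯ ⊗ V_{d_k}))`, the trivial module for the empty list. -/
def tens : List ℕ → URep
  | [] => URep.trivial
  | [m] => irr m
  | m :: n :: l => (irr m).tensor (tens (n :: l))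

/-! ### Lower crossingless matches -/

/-- The vertices: a row of boxes, where the `i`-th one has `d i` vertices, ordered from left to
right. -/
abbrev Vtx {k : ℕ} (d : Fin k → ℕ) : Type := Σₗ i : Fin k, Fin (d i)

/-- The box that contains a vertex. -/
def Vtx.box {k : ℕ} {d : Fin k → ℕ} (v : Vtx d) : Fin k := (ofLex v).1

/-- A lower crossingless match: a set of lower curves, each given by its left and its right
endpoint.  Each vertex lies on at most one lower curve, no curve joins a box to itself, curves do
not cross, and no unmatched vertex lies below a curve (so that the unmatched vertices can be joined
by middle curves to an upper box). -/
@[ext] structure LCM {k : ℕ} (d : Fin k → ℕ) where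
  arcs : Finset (Vtx d × Vtx d)
  box_lt : ∀ p ∈ arcs, p.1.box < p.2.box
  disjoint : ∀ p ∈ arcs, ∀ p' ∈ arcs,
    (p.1 = p'.1 ∨ p.1 = p'.2 ∨ p.2 = p'.1 ∨ p.2 = p'.2) → p = p'
  noncrossing : ∀ p ∈ arcs, ∀ p' ∈ arcs, ¬ (p.1 < p'.1 ∧ p'.1 < p.2 ∧ p.2 < p'.2)
  covered : ∀ p ∈ arcs, ∀ v, p.1 < v → v < p.2 → ∃ p' ∈ arcs, v = p'.1 ∨ v = p'.2

namespace LCM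

variable {k : ℕ} {d : Fin k → ℕ}

/-- A vertex that lies on no lower curve. -/
def Unmatched (b : LCM d) (v : Vtx d) : Prop := ∀ p ∈ b.arcs, v ≠ p.1 ∧ v ≠ p.2

/-- The number of unmatched vertices, that is, of middle curves to the upper box: `b ∈ CM(μ)`. -/
def mu (b : LCM d) : ℕ := Nat.card {v : Vtx d // b.Unmatched v}

/-- The number of lower curves. -/
def r (b : LCM d) : ℕ := b.arcs.card

/-- `n^b_i` is `d_i` minus the number of right endpoints of lower curves in the `i`-th box. -/
def n (b : LCM d) (i : Fin k) : ℕ :=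
  Nat.card {j : Fin (d i) // ∀ p ∈ b.arcs, p.2 ≠ toLex ⟨i, j⟩}

end LCM

/-- An oriented lower crossingless match, given by the set of the vertices with a down arrow.  Lower
curves are oriented to the left (down at the left, up at the right endpoint), and among the
unmatched vertices those oriented down are to the right of those oriented up. -/
@[ext] structure OLCM {k : ℕ} (d : Fin k → ℕ) extends LCM d where
  down : Finset (Vtx d)
  left_down : ∀ p ∈ arcs, p.1 ∈ down
  right_up : ∀ p ∈ arcs, p.2 ∉ down
  unmatched_order : ∀ u v, toLCM.Unmatched u → toLCM.Unmatched v → u ∈ down → v ∉ down → v < u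

/-! ### Point counts -/

/-- A finite extension of the finite field `F`. -/
structure FinExt (F : Type) [Field F] where
  carrier : Type
  [field : Field carrier]
  [finite : Finite carrier]
  [algebra : Algebra F carrier]

attribute [instance] FinExt.field FinExt.finite FinExt.algebra

/-- `χ_q` of a variety over `F` with `N L` points over each finite extension `L` of `F`: the number
of points as a function of `q`, where `q ^ 2` stands for the number of elements of the field.  That
is, if `N L = P(|L|)` for all `L`, with an integer polynomial `P` (which is then unique), `χ_q` is
`P(q ^ 2)`. -/
def chi (F : Type) [Field F] (N : FinExt F → ℕ) : Cq :=
  open Classical in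
  if h : ∃ P : Polynomial ℤ, ∀ L : FinExt F, (N L : ℤ) = P.eval (Nat.card L.carrier : ℤ) then
    Polynomial.aeval (qq ^ 2) h.choose
  else 0

/-- The value on the stratum `s` of a function that is constant on strata (`0` if `s` is empty). -/
def stratVal {X S : Type} (lab : X → S) (f : X → Cq) (s : S) : Cq :=
  open Classical in
  if h : ∃ x, lab x = s then f h.choose else 0

/-- The sum of the values of `f` over the points of a variety `Z`, where `f` is constant on strata
and `N s` counts the points of `Z` in the stratum `s`: `∑_s f(s) χ_q(Z ∩ s)`. -/
def stratSum {F : Type} [Field F] {X S : Type} (lab : X → S) (f : X → Cq)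
    (N : S → FinExt F → ℕ) : Cq :=
  ∑ᶠ s : S, stratVal lab f s * chi F (N s)

/-! ### The varieties `M(d)` and `T(𝐝)` -/

open Module

/-- The points `(W, t)` with `im t ⊆ W ⊆ ker t` of the union over `w` of the quiver varieties
`M(w, d)`, over the field `L` and for the vector space `V`. -/
structure QPt (L V : Type) [Field L] [AddCommGroup V] [Module L V] where
  W : Submodule L V
  t : V →ₗ[L] V
  range_le : LinearMap.range t ≤ W
  le_ker : W ≤ LinearMap.ker t

/-- The points `(𝐃, W, t)` of the tensor product variety `T(𝐝)`. -/
structure TPt (L V : Type) [Field L] [AddCommGroup V] [Module L V] {k : ℕ} (d : Fin k → ℕ)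
    extends QPt L V where
  flag : Fin (k + 1) → Submodule L V
  flag_zero : flag 0 = ⊥
  flag_last : flag (Fin.last k) = ⊤
  flag_le : ∀ i : Fin k, flag i.castSucc ≤ flag i.succ
  flag_dim : ∀ i : Fin k, finrank L (flag i.succ) = finrank L (flag i.castSucc) + d i
  stable : ∀ i : Fin k, (flag i.succ).map t ≤ flag i.castSucc

/-- `α(U, 𝐃)_i = dim (U ∩ 𝐃_i) / (U ∩ 𝐃_{i-1})`. -/
def alpha {L V : Type} [Field L] [AddCommGroup V] [Module L V] {k : ℕ}
    (flag : Fin (k + 1) → Submodule L V) (U : Submodule L V) (i : Fin k) : ℕ :=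
  finrank L (U ⊓ flag i.succ : Submodule L V) - finrank L (U ⊓ flag i.castSucc : Submodule L V)

/-- The stratum of a point of `M(d)`: the dimension of `W` and the rank of `t`. -/
def QPt.lab {L V : Type} [Field L] [AddCommGroup V] [Module L V] (x : QPt L V) : ℕ × ℕ :=
  (finrank L x.W, finrank L (LinearMap.range x.t))

/-- The stratum `A_{w,r,n}` of a point of `T(𝐝)`. -/
def TPt.lab {L V : Type} [Field L] [AddCommGroup V] [Module L V] {k : ℕ} {d : Fin k → ℕ}
    (x : TPt L V d) : (Fin k → ℕ) × (Fin k → ℕ) × (Fin k → ℕ) :=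
  (alpha x.flag x.W, alpha x.flag (LinearMap.range x.t), alpha x.flag (LinearMap.ker x.t))

section Functions

variable {F D : Type} [Field F] [AddCommGroup D] [Module F D] {k : ℕ} {d : Fin k → ℕ}

/-- The indicator function of `M^r(w, d)`. -/
def indM (F D : Type) [Field F] [AddCommGroup D] [Module F D] (r w : ℕ) : QPt F D → Cq :=
  Set.indicator {x | finrank F x.W = w ∧ finrank F (LinearMap.range x.t) = r} 1

/-- The space `𝓜^r(d) = ⨁_w ℂ(q) 1_{M^r(w,d)}`. -/
def Mr (F D : Type) [Field F] [AddCommGroup D] [Module F D] (r : ℕ) :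
    Submodule Cq (QPt F D → Cq) :=
  Submodule.span Cq (Set.range (indM F D r))

/-- The action of the generators of `U_q` on functions on `M(d)`.  For `x = (W, t)`,
`E f (x) = q ^ (- dim π₁⁻¹(x)) ∑ f(U, t)` over all `U ⊇ W` of dimension `dim W + 1` in `ker t`
(these form a projective space of dimension `dim ker t - dim W - 1`),
`F f (x) = q ^ (- dim π₂⁻¹(x)) ∑ f(U, t)` over all `U ⊆ W` of dimension `dim W - 1` that contain
`im t` (a projective space of dimension `dim W - rank t - 1`), and
`K^{±1} f (x) = q ^ (± (d - 2 dim W)) f(x)`. -/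
def actM : UqGen → (QPt F D → Cq) → QPt F D → Cq
  | .E, f, x => qq ^ (-((finrank F (LinearMap.ker x.t) : ℤ) - finrank F x.W - 1)) *
      stratSum QPt.lab f fun s (L : FinExt F) =>
        Nat.card {y : QPt L.carrier (L.carrier ⊗[F] D) // y.t = x.t.baseChange L.carrier ∧
          x.W.baseChange L.carrier ≤ y.W ∧ finrank L.carrier y.W = finrank F x.W + 1 ∧ y.lab = s}
  | .F, f, x => qq ^ (-((finrank F x.W : ℤ) - finrank F (LinearMap.range x.t) - 1)) *
      stratSum QPt.lab f fun s (L : FinExt F) =>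
        Nat.card {y : QPt L.carrier (L.carrier ⊗[F] D) // y.t = x.t.baseChange L.carrier ∧
          y.W ≤ x.W.baseChange L.carrier ∧ finrank L.carrier y.W + 1 = finrank F x.W ∧ y.lab = s}
  | .K, f, x => qq ^ ((finrank F D : ℤ) - 2 * finrank F x.W) * f x
  | .Ki, f, x => qq ^ (-((finrank F D : ℤ) - 2 * finrank F x.W)) * f x

/-- The action of the generators of `U_q` on functions on `T(𝐝)`, given by the same formulas, with
the flag kept fixed. -/
def actT : UqGen → (TPt F D d → Cq) → TPt F D d → Cq
  | .E, f, x => qq ^ (-((finrank F (LinearMap.ker x.t) : ℤ) - finrank F x.W - 1)) *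
      stratSum TPt.lab f fun s (L : FinExt F) =>
        Nat.card {y : TPt L.carrier (L.carrier ⊗[F] D) d // y.t = x.t.baseChange L.carrier ∧
          (∀ i, y.flag i = (x.flag i).baseChange L.carrier) ∧
          x.W.baseChange L.carrier ≤ y.W ∧ finrank L.carrier y.W = finrank F x.W + 1 ∧ y.lab = s}
  | .F, f, x => qq ^ (-((finrank F x.W : ℤ) - finrank F (LinearMap.range x.t) - 1)) *
      stratSum TPt.lab f fun s (L : FinExt F) =>
        Nat.card {y : TPt L.carrier (L.carrier ⊗[F] D) d // y.t = x.t.baseChange L.carrier ∧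
          (∀ i, y.flag i = (x.flag i).baseChange L.carrier) ∧
          y.W ≤ x.W.baseChange L.carrier ∧ finrank L.carrier y.W + 1 = finrank F x.W ∧ y.lab = s}
  | .K, f, x => qq ^ ((finrank F D : ℤ) - 2 * finrank F x.W) * f x
  | .Ki, f, x => qq ^ (-((finrank F D : ℤ) - 2 * finrank F x.W)) * f x

/-- The space `𝓣(𝐝)` of functions on `T(𝐝)` that are constant on the strata `A_{w,r,n}`. -/
def Tfun (F D : Type) [Field F] [AddCommGroup D] [Module F D] {k : ℕ} (d : Fin k → ℕ) :
    Submodule Cq (TPt F D d → Cq) where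
  carrier := {f | ∀ x y : TPt F D d, x.lab = y.lab → f x = f y}
  add_mem' := fun hf hg x y h => by simp [hf x y h, hg x y h]
  zero_mem' := fun x y h => rfl
  smul_mem' := fun c f hf x y h => by simp [hf x y h]

/-- The space `𝓣_s(𝐝)` of those functions in `𝓣(𝐝)` whose value at `(𝐃, W, t)` depends only on
`dim W` and `α(t, 𝐃) = α(ker t, 𝐃)`. -/
def Ts (F D : Type) [Field F] [AddCommGroup D] [Module F D] {k : ℕ} (d : Fin k → ℕ) :
    Submodule Cq (TPt F D d → Cq) where
  carrier := {f | f ∈ Tfun F D d ∧ ∀ x y : TPt F D d, finrank F x.W = finrank F y.W →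
    alpha x.flag (LinearMap.ker x.t) = alpha y.flag (LinearMap.ker y.t) → f x = f y}
  add_mem' := fun hf hg => ⟨add_mem hf.1 hg.1, fun x y h h' => by
    simp [hf.2 x y h h', hg.2 x y h h']⟩
  zero_mem' := ⟨zero_mem _, fun x y h h' => rfl⟩
  smul_mem' := fun c f hf => ⟨Submodule.smul_mem _ c hf.1, fun x y h h' => by
    simp [hf.2 x y h h']⟩

/-- The set `Y_b` of the points with `α(t, 𝐃) = n^b`. -/
def Yb (F D : Type) [Field F] [AddCommGroup D] [Module F D] {k : ℕ} {d : Fin k → ℕ} (b : LCM d) :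
    Set (TPt F D d) :=
  {x | alpha x.flag (LinearMap.ker x.t) = b.n}

/-- The set `Y_a` of the points with `α(t, 𝐃) = n^a` and `dim W = |a|`, the number of down arrows
of `a`. -/
def Ya (F D : Type) [Field F] [AddCommGroup D] [Module F D] {k : ℕ} {d : Fin k → ℕ} (a : OLCM d) :
    Set (TPt F D d) :=
  {x | alpha x.flag (LinearMap.ker x.t) = a.n ∧ finrank F x.W = a.down.card}

/-- The operator `T_Y = p_! R_Y`, for a union `Y` of strata: `R_Y` is the multiplication by the
indicator function of `Y`, and `p(𝐃, W, t) = (W, t)`. -/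
def TY (Y : Set (TPt F D d)) (f : TPt F D d → Cq) (x : QPt F D) : Cq :=
  stratSum TPt.lab (Y.indicator f) fun s (L : FinExt F) =>
    Nat.card {y : TPt L.carrier (L.carrier ⊗[F] D) d //
      y.W = x.W.baseChange L.carrier ∧ y.t = x.t.baseChange L.carrier ∧ y.lab = s}

/-- The map `V_μ → 𝓜^r(d)`, where `μ = d - 2r`, that sends `v_{μ-2j}` to `1_{M^r(r+j,d)}`, in other
words `v_{d-2w}` to `1_{M^r(w,d)}`. -/
def irrToM (F D : Type) [Field F] [AddCommGroup D] [Module F D] (μ r : ℕ) :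
    (irr μ).V →ₗ[Cq] (QPt F D → Cq) :=
  (Pi.basisFun Cq (Fin (μ + 1))).constr Cq fun j => indM F D r (r + j)

end Functions

end

/-! ### Arithmetic of `ℂ(q)` and of counting polynomials. -/

noncomputable section

/-! Let (𝐃, W, t) be a point of T(𝐝). As t maps 𝐃_i into ker t ∩ 𝐃_{i-1}, rank-nullity shows that n
= α(ker t, 𝐃) satisfies a ballot condition (`TPt.ballot`), besides n ≤ 𝐝. The sequences of this kind
are exactly the 𝐧^b, and 𝐧^b determines b (`LCM.exists_n_eq`, `LCM.n_injective`): the right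
endpoints in a box come before all its other vertices, so 𝐧^b tells which vertices are right
endpoints, and the non-crossing and covering conditions then force the curves. Hence T(𝐝) is the
disjoint union of the Y_b. On Y_b the rank of t is r, the kernel has dimension μ + r, and dim W
takes exactly the values r, …, r + μ (`exists_TPt`). A function in 𝓣_s(𝐝) is therefore a family of
vectors, one in each V_{μ(b)} (`Coord`, `equivTs`), and the 1_{Y_a} are the coordinate vectors.

The operators E and F move only W, so they preserve b. With j = dim W - r, they shift j and multiply
by the normalised point counts of projective spaces, [dim ker t - dim W] = [μ - j] and [dim W - rank
t] = [j]. These are the structure constants of V_μ, so 𝓣_s(𝐝) is the direct sum of the V_{μ(b)}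
(`actT_liftT`). In the same coordinates T_{Y_b} is the projection to the factor b, times the number
c_b of compatible flags (`TY_liftT`). This gives the action on the 1_{Y_a} and, by Schur's lemma,
the spanning statement (`Coord.span_hom`).

It remains to identify the sum of the V_{μ(b)} with the tensor product (`exists_equiv_tens`).
Iterating Clebsch-Gordan along ballot sequences shows that the characters agree (`sum_ch_mu`). In
the tensor product, the kernel of E from weight m to weight m + 2 is at least as large as the
difference of the two dimensions, which is the number of b with μ(b) = m. The highest weight vectors
found in this way generate independent copies of the V_{μ(b)}, which fill the module by dimension;
complete reducibility is not needed.

For χ_q to be computable, all counts must be polynomials in the size of the field that depend only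
on dimensions (`exists_interval_count`, `exists_flag_count`). Their coefficients are natural
numbers, which rules out cancellation; `stratSum_eq` turns this into a formula for the sums over
strata. -/

open Polynomial in
-- The element `qq ^ 2` is transcendental: the substitution is `expand` by 2 in `ℂ[X]` followed by
-- the inclusion into the fraction field. Nonzero counting polynomials thus have nonzero `χ_q`.
theorem aeval_qq_sq_injective : Function.Injective (aeval (qq ^ 2) : ℤ[X] →ₐ[ℤ] Cq) := by
  intro P Q h
  have h1 : ∀ P : ℤ[X], aeval (qq ^ 2) P = algebraMap ℂ[X] Cq (expand ℂ 2 (P.map (Int.castRingHom ℂ))) := by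
    intro P
    induction P using Polynomial.induction_on' with
    | add p q hp hq => simp [hp, hq]
    | monomial n a => simp [← C_mul_X_pow_eq_monomial, qq, RatFunc.algebraMap_X]
  rw [h1, h1] at h
  have h2 := expand_injective (R := ℂ) (n := 2) (by norm_num) (RatFunc.algebraMap_injective ℂ h)
  exact Polynomial.map_injective _ (Int.cast_injective) h2

theorem qq_zpow_eq_one {n : ℤ} (h : qq ^ n = 1) : n = 0 := by
  have key : ∀ m : ℕ, qq ^ m = 1 → m = 0 := by
    intro m hm
    have h2 : algebraMap (Polynomial ℂ) Cq (Polynomial.X ^ m) =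
        algebraMap (Polynomial ℂ) Cq 1 := by
      simpa [qq, RatFunc.algebraMap_X] using hm
    have h3 := RatFunc.algebraMap_injective ℂ h2
    have := congrArg Polynomial.natDegree h3
    simpa using this
  obtain ⟨m, rfl | rfl⟩ := n.eq_nat_or_neg
  · simpa using key m (by simpa using h)
  · simpa using key m (by simpa using h)

/-- Since `qq` is not a root of unity, different weights give different eigenvalues of `K`, and the
only vanishing quantum integer is `[0]`. -/
theorem qq_zpow_injective : Function.Injective (fun n : ℤ => qq ^ n) := by
  intro a b h
  have : qq ^ (a - b) = 1 := by
    rw [zpow_sub₀ qq_ne_zero]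
    exact div_eq_one_iff_eq (zpow_ne_zero _ qq_ne_zero) |>.2 h
  have := qq_zpow_eq_one this
  omega

theorem qint_ne_zero {n : ℤ} (h : n ≠ 0) : qint n ≠ 0 := by
  unfold qint
  refine div_ne_zero (sub_ne_zero.2 fun h' => h ?_) qq_sub_inv_ne_zero
  have := qq_zpow_injective h'
  omega

@[simp] theorem qint_zero : qint 0 = 0 := by simp [qint]

/-- The polynomial `1 + X + ⋯ + X^{m-1}`, which counts the points of a projective space. -/
def projPoly (m : ℕ) : Polynomial ℕ := ∑ i ∈ Finset.range m, Polynomial.X ^ i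

/-- The value at `q ^ 2` of a polynomial with natural coefficients. -/
def evq (P : Polynomial ℕ) : Cq := Polynomial.eval₂ (Nat.castRingHom Cq) (qq ^ 2) P

/-- A geometric sum with ratio `q ^ 2`. This is the source of the quantum integers: the factor in
front is the normalisation in `actM` and `actT` for a projective space of dimension `m - 1`, and `m
= 0` is the empty one. -/
theorem evq_projPoly (m : ℕ) : qq ^ (-((m : ℤ) - 1)) * evq (projPoly m) = qint m := by
  have hq := qq_ne_zero
  have h := qq_sub_inv_ne_zero
  have h1 : evq (projPoly m) = ∑ i ∈ Finset.range m, (qq ^ 2) ^ i := by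
    simp [evq, projPoly, Polynomial.eval₂_finsetSum]
  have h2 := geom_sum_mul (qq ^ 2) m
  rw [h1]
  generalize (∑ i ∈ Finset.range m, (qq ^ 2) ^ i) = s at *
  rw [qint, eq_div_iff h, neg_sub, zpow_sub₀ hq, zpow_neg, zpow_one]
  simp only [zpow_natCast]
  have hm := pow_ne_zero m hq
  field_simp
  rw [h2]
  ring

theorem evq_eq_aeval (P : Polynomial ℕ) :
    evq P = Polynomial.aeval (qq ^ 2) (P.map (Nat.castRingHom ℤ)) := by
  rw [Polynomial.aeval_def, Polynomial.eval₂_map, evq]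
  congr 1
  exact Subsingleton.elim _ _

/-! ### Point counts of finite extensions -/

section

variable (F : Type) [Field F]

/-- Adjoining any `n + 1` algebraic elements gives such an extension. Infinitely many field sizes
make the polynomial in `chi` unique. -/
theorem exists_finExt_card_gt [Finite F] (n : ℕ) : ∃ L : FinExt F, n < Nat.card L.carrier := by
  obtain ⟨S, hS⟩ := Infinite.exists_subset_card_eq (AlgebraicClosure F) (n + 1)
  let K := IntermediateField.adjoin F (S : Set (AlgebraicClosure F))
  have : FiniteDimensional F K := by
    apply IntermediateField.finiteDimensional_adjoin
    intro x _
    exact Algebra.IsIntegral.isIntegral x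
  have : Finite K := Module.finite_of_finite F
  refine ⟨⟨K⟩, ?_⟩
  have : S.card ≤ Nat.card K := by
    have hi : Function.Injective (fun x : S => (⟨x, IntermediateField.subset_adjoin F _ x.2⟩ : K)) := by
      intro x y h
      exact Subtype.ext (congrArg (fun z : K => (z : AlgebraicClosure F)) h)
    have := Nat.card_le_card_of_injective _ hi
    simpa using this
  show n < Nat.card K
  omega

theorem int_poly_eq_of_finExt [Finite F] {P Q : Polynomial ℤ}
    (h : ∀ L : FinExt F, P.eval (Nat.card L.carrier : ℤ) = Q.eval (Nat.card L.carrier : ℤ)) :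
    P = Q := by
  refine Polynomial.eq_of_infinite_eval_eq P Q ?_
  refine Set.infinite_of_not_bddAbove ?_
  rintro ⟨B, hB⟩
  obtain ⟨L, hL⟩ := exists_finExt_card_gt F B.toNat
  have := hB (h L)
  omega

theorem nat_poly_eq_of_finExt [Finite F] {P Q : Polynomial ℕ}
    (h : ∀ L : FinExt F, P.eval (Nat.card L.carrier) = Q.eval (Nat.card L.carrier)) : P = Q := by
  have hinj : Function.Injective (Polynomial.map (Nat.castRingHom ℤ)) :=
    Polynomial.map_injective _ Nat.cast_injective
  refine hinj (int_poly_eq_of_finExt F fun L => ?_)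
  have := h L
  simp only [Polynomial.eval_map, Polynomial.eval₂_at_natCast]
  exact congrArg _ this

theorem chi_eq_evq [Finite F] {N : FinExt F → ℕ} {P : Polynomial ℕ}
    (h : ∀ L : FinExt F, N L = P.eval (Nat.card L.carrier)) : chi F N = evq P := by
  have hP : ∀ L : FinExt F, (N L : ℤ) =
      (P.map (Nat.castRingHom ℤ)).eval (Nat.card L.carrier : ℤ) := by
    intro L
    rw [h L, Polynomial.eval_map, Polynomial.eval₂_at_natCast]
    simp
  have hex : ∃ P : Polynomial ℤ, ∀ L : FinExt F, (N L : ℤ) = P.eval (Nat.card L.carrier : ℤ) :=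
    ⟨_, hP⟩
  rw [chi, dif_pos hex]
  have := int_poly_eq_of_finExt F (P := hex.choose) (Q := P.map (Nat.castRingHom ℤ))
    fun L => by rw [← hex.choose_spec L, hP L]
  rw [this, ← evq_eq_aeval]

end

theorem evq_ne_zero {P : Polynomial ℕ} (h : P ≠ 0) : evq P ≠ 0 := by
  rw [evq_eq_aeval, ← map_zero (Polynomial.aeval (qq ^ 2) : Polynomial ℤ →ₐ[ℤ] Cq)]
  refine aeval_qq_sq_injective.ne ?_
  rwa [Ne, Polynomial.map_eq_zero_iff (Nat.cast_injective)]

theorem evq_sum {ι : Type*} (s : Finset ι) (P : ι → Polynomial ℕ) :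
    evq (∑ i ∈ s, P i) = ∑ i ∈ s, evq (P i) := by
  simp [evq, Polynomial.eval₂_finsetSum]

@[simp] theorem evq_zero : evq 0 = 0 := by simp [evq]

/-- Natural coefficients cannot cancel. As a consequence, a stratum without points over the base
field has none over any extension. -/
theorem nat_poly_eq_zero_of_eval {P : Polynomial ℕ} {n : ℕ} (hn : 0 < n) (h : P.eval n = 0) :
    P = 0 := by
  ext i
  rw [Polynomial.eval_eq_sum, Polynomial.sum_def, Finset.sum_eq_zero_iff] at h
  by_contra hi
  have := h i (Polynomial.mem_support_iff.2 hi)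
  simp [hn.ne'] at this
  exact hi this

end

noncomputable section

open Module

/-! ### Counting submodules over finite fields -/

theorem card_eq_sum_card_fiber {α β : Type*} [Finite α] (p : α → Prop) (f : α → β) (T : Finset β)
    (hf : ∀ a, p a → f a ∈ T) :
    Nat.card {a // p a} = ∑ b ∈ T, Nat.card {a // p a ∧ f a = b} := by
  classical
  have := Fintype.ofFinite α
  simp only [Nat.card_eq_fintype_card, Fintype.card_subtype]
  rw [Finset.card_eq_sum_card_fiberwise (f := f) (t := T)]
  · simp only [Finset.filter_filter]
  · intro a ha
    exact hf a (by simpa using ha)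

theorem card_eq_mul_of_fiber {α β : Type*} [Finite α] [Finite β] {p : α → Prop} {q : β → Prop}
    (f : α → β) (hf : ∀ a, p a → q (f a)) {c : ℕ}
    (h : ∀ b, q b → Nat.card {a // p a ∧ f a = b} = c) :
    Nat.card {a // p a} = Nat.card {b // q b} * c := by
  classical
  have := Fintype.ofFinite β
  rw [card_eq_sum_card_fiber p f (Finset.univ.filter q) (by simpa using hf),
    Finset.sum_congr rfl (fun b hb => h b (by simpa using hb)), Finset.sum_const,
    Nat.card_eq_fintype_card, Fintype.card_subtype, smul_eq_mul]

theorem card_eq_of_iff {α : Type*} {p q : α → Prop} (h : ∀ a, p a ↔ q a) :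
    Nat.card {a // p a} = Nat.card {a // q a} :=
  Nat.card_congr (Equiv.subtypeEquivRight h)

theorem card_eq_one_of_iff {α : Type*} {p : α → Prop} (a₀ : α) (h : ∀ a, p a ↔ a = a₀) :
    Nat.card {a // p a} = 1 := by
  rw [card_eq_of_iff h]
  simp

theorem card_eq_zero_of_forall {α : Type*} {p : α → Prop} (h : ∀ a, ¬ p a) :
    Nat.card {a // p a} = 0 := by
  have : IsEmpty {a // p a} := ⟨fun a => h a.1 a.2⟩
  exact Nat.card_of_isEmpty

/-- `relPoly c a b u` counts the subspaces `U` of dimension `u` of a space of dimension `a + c`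
whose intersection with a given subspace `A` of dimension `a` is a given `B ≤ A` of
dimension `b`. -/
def relPoly : ℕ → ℕ → ℕ → ℕ → Polynomial ℕ
  | 0, _, b, u => if u = b then 1 else 0
  | c + 1, a, b, u =>
    relPoly c (a + 1) b u + Polynomial.X ^ (a - b) * relPoly c (a + 1) (b + 1) u

theorem relPoly_of_lt : ∀ (c a b u : ℕ), u < b → relPoly c a b u = 0
  | 0, _, _, _, h => by simp [relPoly, h.ne]
  | c + 1, a, b, u, h => by
    simp [relPoly, relPoly_of_lt c _ b u h, relPoly_of_lt c _ (b + 1) u (by omega)]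

theorem relPoly_of_gt : ∀ (c a b u : ℕ), b + c < u → relPoly c a b u = 0
  | 0, _, _, _, h => by rw [relPoly, if_neg (by omega)]
  | c + 1, a, b, u, h => by
    simp [relPoly, relPoly_of_gt c _ b u (by omega), relPoly_of_gt c _ (b + 1) u (by omega)]

theorem relPoly_self : ∀ c a b : ℕ, relPoly c a b b = 1
  | 0, _, _ => by simp [relPoly]
  | c + 1, a, b => by simp [relPoly, relPoly_self c, relPoly_of_lt c _ (b + 1) b]

theorem relPoly_succ : ∀ c a b : ℕ, b ≤ a →
    relPoly c a b (b + 1) = Polynomial.X ^ (a - b) * projPoly c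
  | 0, _, _, _ => by simp [relPoly, projPoly]
  | c + 1, a, b, h => by
    rw [relPoly, relPoly_succ c (a + 1) b (by omega), relPoly_self, mul_one, projPoly, projPoly,
      geom_sum_succ, show a + 1 - b = (a - b) + 1 by omega]
    ring

theorem relPoly_diag_top_aux : ∀ c a b : ℕ, b ≤ a →
    relPoly c a b (b + c) = Polynomial.X ^ ((a - b) * c)
  | 0, _, _, _ => by simp [relPoly]
  | c + 1, a, b, h => by
    have := relPoly_diag_top_aux c (a + 1) (b + 1) (by omega)
    rw [relPoly, relPoly_of_gt c _ b _ (by omega), show b + (c + 1) = b + 1 + c by ring, this,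
      zero_add, ← pow_add, show a + 1 - (b + 1) = a - b by omega]
    ring_nf

theorem relPoly_pred (c a u : ℕ) (h : u + 1 = a + c) : relPoly c a a u = projPoly c := by
  induction c generalizing a u with
  | zero => simp [projPoly, relPoly_of_lt 0 a a u (by omega)]
  | succ c ih =>
    rw [relPoly, show u = a + c by omega, relPoly_diag_top_aux c (a + 1) a (by omega),
      ih (a + 1) (a + c) (by omega), projPoly, projPoly, Finset.sum_range_succ]
    simp [add_comm]

section

variable {L V : Type} [Field L] [AddCommGroup V] [Module L V]

theorem finrank_sup_span_singleton [FiniteDimensional L V] {A : Submodule L V} {v : V} (hv : v ∉ A) :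
    finrank L (A ⊔ L ∙ v : Submodule L V) = finrank L A + 1 := by
  have h := Submodule.finrank_sup_add_finrank_inf_eq A (L ∙ v)
  have hv0 : v ≠ 0 := fun h => hv (h ▸ A.zero_mem)
  have h2 : A ⊓ L ∙ v = ⊥ := by
    rw [Submodule.eq_bot_iff]
    rintro x ⟨hx, hx'⟩
    obtain ⟨c, rfl⟩ := Submodule.mem_span_singleton.1 hx'
    by_cases hc : c = 0
    · simp [hc]
    · exact absurd ((Submodule.smul_mem_iff A hc).1 hx) hv
  rw [h2, finrank_bot, finrank_span_singleton hv0] at h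
  simpa using h

theorem sup_span_inf_eq {A B : Submodule L V} {v x : V} (hBA : B ≤ A) (hv : v ∉ A) (hx : x ∈ A) :
    (B ⊔ L ∙ (v + x)) ⊓ A = B := by
  refine le_antisymm ?_ (le_inf le_sup_left hBA)
  rintro y ⟨hy, hyA⟩
  obtain ⟨b, hb, z, hz, rfl⟩ := Submodule.mem_sup.1 hy
  obtain ⟨c, rfl⟩ := Submodule.mem_span_singleton.1 hz
  by_cases hc : c = 0
  · simpa [hc] using hb
  · have h1 : c • (v + x) ∈ A := (Submodule.add_mem_iff_right A (hBA hb)).1 hyA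
    have h2 : v + x ∈ A := (Submodule.smul_mem_iff A hc).1 h1
    exact absurd ((Submodule.add_mem_iff_left A hx).1 h2) hv

theorem exists_eq_sup_span {A B B' : Submodule L V} {v : V} (hB' : B' ≤ A ⊔ L ∙ v)
    (h : B' ⊓ A = B) (hne : B' ≠ B) : ∃ x ∈ A, B' = B ⊔ L ∙ (v + x) := by
  obtain ⟨z, hz, hzA⟩ : ∃ z ∈ B', z ∉ A := by
    by_contra! hcon
    exact hne (by rw [← h, eq_comm, inf_eq_left]; exact hcon)
  obtain ⟨a, ha, y, hy, hay⟩ := Submodule.mem_sup.1 (hB' hz)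
  obtain ⟨c, rfl⟩ := Submodule.mem_span_singleton.1 hy
  have hc : c ≠ 0 := by
    rintro rfl
    exact hzA (by rw [← hay]; simpa using ha)
  have hmem : v + c⁻¹ • a ∈ B' := by
    have : v + c⁻¹ • a = c⁻¹ • z := by
      rw [← hay, smul_add, smul_smul, inv_mul_cancel₀ hc, one_smul, add_comm]
    rw [this]
    exact B'.smul_mem _ hz
  refine ⟨c⁻¹ • a, A.smul_mem _ ha, le_antisymm ?_ ?_⟩
  · intro w hw
    obtain ⟨a', ha', y', hy', hay'⟩ := Submodule.mem_sup.1 (hB' hw)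
    obtain ⟨c', rfl⟩ := Submodule.mem_span_singleton.1 hy'
    refine Submodule.mem_sup.2 ⟨w - c' • (v + c⁻¹ • a), ?_, c' • (v + c⁻¹ • a),
      Submodule.smul_mem _ _ (Submodule.mem_span_singleton_self _), by abel⟩
    rw [← h]
    refine ⟨B'.sub_mem hw (B'.smul_mem _ hmem), ?_⟩
    have : w - c' • (v + c⁻¹ • a) = a' - c' • (c⁻¹ • a) := by rw [← hay', smul_add]; abel
    rw [this]
    exact A.sub_mem ha' (A.smul_mem _ (A.smul_mem _ ha))
  · refine sup_le (h ▸ inf_le_left) ?_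
    rw [Submodule.span_singleton_le_iff_mem]
    exact hmem

variable [Finite L] [FiniteDimensional L V]

theorem finite_submodule (L V : Type) [Field L] [AddCommGroup V] [Module L V] [Finite L]
    [FiniteDimensional L V] : Finite (Submodule L V) := by
  have : Finite V := Module.finite_of_finite L
  exact Finite.of_injective (fun U : Submodule L V => (U : Set V)) SetLike.coe_injective

/-- Each such `B'` is `B + L (v + x)` with `x ∈ A`, and `x` is determined up to `B`. The map from
`A` to the set of these `B'` is therefore onto with fibres the cosets of `B`, and the number is `|A|
/ |B|`. -/
theorem card_extensions {A B : Submodule L V} {v : V} (hBA : B ≤ A) (hv : v ∉ A) :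
    Nat.card {B' : Submodule L V // B' ≤ A ⊔ L ∙ v ∧ B' ⊓ A = B ∧ B' ≠ B} =
      Nat.card L ^ (finrank L A - finrank L B) := by
  have : Finite V := Module.finite_of_finite L
  have := finite_submodule L V
  have key : Nat.card A =
      Nat.card {B' : Submodule L V // B' ≤ A ⊔ L ∙ v ∧ B' ⊓ A = B ∧ B' ≠ B} * Nat.card B := by
    have h := card_eq_mul_of_fiber (p := fun x : V => x ∈ A)
      (q := fun B' : Submodule L V => B' ≤ A ⊔ L ∙ v ∧ B' ⊓ A = B ∧ B' ≠ B)
      (fun x => B ⊔ L ∙ (v + x)) (c := Nat.card B) ?_ ?_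
    · exact h
    · intro x hx
      refine ⟨sup_le (hBA.trans le_sup_left) ?_, sup_span_inf_eq hBA hv hx, fun h => ?_⟩
      · rw [Submodule.span_singleton_le_iff_mem]
        exact add_mem (Submodule.mem_sup_right (Submodule.mem_span_singleton_self v))
          (Submodule.mem_sup_left hx)
      · have : v + x ∈ B := by
          rw [← h]
          exact Submodule.mem_sup_right (Submodule.mem_span_singleton_self _)
        exact hv ((Submodule.add_mem_iff_left A hx).1 (hBA this))
    · rintro B' ⟨hB', h, hne⟩
      obtain ⟨x, hx, rfl⟩ := exists_eq_sup_span hB' h hne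
      refine Nat.card_congr ⟨fun y => ⟨y.1 - x, ?_⟩, fun y => ⟨y.1 + x, ?_, ?_⟩, ?_, ?_⟩
      · have h1 : v + y.1 ∈ B ⊔ L ∙ (v + x) :=
          y.2.2.le (Submodule.mem_sup_right (Submodule.mem_span_singleton_self _))
        have h2 : v + x ∈ B ⊔ L ∙ (v + x) :=
          Submodule.mem_sup_right (Submodule.mem_span_singleton_self _)
        have h3 := sub_mem h1 h2
        rw [add_sub_add_left_eq_sub] at h3
        have h4 : y.1 - x ∈ (B ⊔ L ∙ (v + x)) ⊓ A := ⟨h3, A.sub_mem y.2.1 hx⟩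
        rwa [h] at h4
      · exact A.add_mem (hBA y.2) hx
      · have hy := y.2
        apply le_antisymm
        · refine sup_le le_sup_left ?_
          rw [Submodule.span_singleton_le_iff_mem, show v + (y.1 + x) = y.1 + (v + x) by abel]
          exact add_mem (Submodule.mem_sup_left hy)
            (Submodule.mem_sup_right (Submodule.mem_span_singleton_self _))
        · refine sup_le le_sup_left ?_
          rw [Submodule.span_singleton_le_iff_mem, show v + x = (v + (y.1 + x)) - y.1 by abel]
          exact sub_mem (Submodule.mem_sup_right (Submodule.mem_span_singleton_self _))
            (Submodule.mem_sup_left hy)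
      · intro y; simp
      · intro y; simp
  rw [Module.natCard_eq_pow_finrank (K := L) (V := A),
    Module.natCard_eq_pow_finrank (K := L) (V := B)] at key
  have hle : finrank L B ≤ finrank L A := Submodule.finrank_mono hBA
  have hpos : 0 < Nat.card L ^ finrank L B := pow_pos Nat.card_pos _
  apply Nat.eq_of_mul_eq_mul_right hpos
  rw [← key, ← pow_add, Nat.sub_add_cancel hle]

/-- Induction on the codimension `c`, enlarging `A` by a vector `v`: the intersection of `U` with `A
+ L v` is either still `B` or one of the extensions counted in `card_extensions`. This is the
recursion that defines `relPoly`. -/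
theorem card_subspaces_inf_eq (c : ℕ) (A B X : Submodule L V) (hBA : B ≤ A)
    (hAX : A ≤ X) (hX : finrank L X = finrank L A + c) (u : ℕ) :
    Nat.card {U : Submodule L V // U ≤ X ∧ U ⊓ A = B ∧ finrank L U = u} =
      (relPoly c (finrank L A) (finrank L B) u).eval (Nat.card L) := by
  have := finite_submodule L V
  induction c generalizing A B with
  | zero =>
    have hAX' : A = X := Submodule.eq_of_le_of_finrank_eq hAX (by omega)
    subst hAX'
    rw [relPoly]
    split_ifs with hu
    · rw [card_eq_one_of_iff B, Polynomial.eval_one]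
      intro U
      refine ⟨fun h => ?_, fun h => ?_⟩
      · rw [← h.2.1, inf_eq_left.2 h.1]
      · subst h
        exact ⟨hBA, inf_eq_left.2 hBA, hu.symm⟩
    · rw [card_eq_zero_of_forall, Polynomial.eval_zero]
      rintro U ⟨h1, h2, h3⟩
      rw [inf_eq_left.2 h1] at h2
      subst h2
      exact hu h3.symm
  | succ c ih =>
    obtain ⟨v, hvX, hv⟩ : ∃ v ∈ X, v ∉ A := by
      by_contra! h
      have : finrank L X ≤ finrank L A := Submodule.finrank_mono h
      omega
    have hA' := finrank_sup_span_singleton hv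
    have hA'X : A ⊔ L ∙ v ≤ X := sup_le hAX (by rwa [Submodule.span_singleton_le_iff_mem])
    rw [relPoly, Polynomial.eval_add, Polynomial.eval_mul, Polynomial.eval_pow, Polynomial.eval_X]
    have hsplit : Nat.card {U : Submodule L V // U ≤ X ∧ U ⊓ A = B ∧ finrank L U = u} =
        Nat.card {U : Submodule L V // U ≤ X ∧ U ⊓ (A ⊔ L ∙ v) = B ∧ finrank L U = u} +
        Nat.card {U : Submodule L V // (U ≤ X ∧ U ⊓ A = B ∧ finrank L U = u) ∧
          U ⊓ (A ⊔ L ∙ v) ≠ B} := by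
      classical
      have := Fintype.ofFinite (Submodule L V)
      simp only [Nat.card_eq_fintype_card, Fintype.card_subtype]
      rw [← Finset.card_filter_add_card_filter_not (fun U => U ⊓ (A ⊔ L ∙ v) = B),
        Finset.filter_filter, Finset.filter_filter]
      congr 2
      refine Finset.filter_congr fun U _ => ⟨fun h => ⟨h.1.1, h.2, h.1.2.2⟩, fun h => ?_⟩
      refine ⟨⟨h.1, ?_, h.2.2⟩, h.2.1⟩
      apply le_antisymm
      · rw [← h.2.1]; exact inf_le_inf_left _ le_sup_left
      · exact le_inf (h.2.1 ▸ inf_le_left) hBA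
    rw [hsplit]
    congr 1
    · rw [ih (A ⊔ L ∙ v) B (hBA.trans le_sup_left) hA'X (by omega), hA']
    · rw [← card_extensions hBA hv]
      refine card_eq_mul_of_fiber (fun U => U ⊓ (A ⊔ L ∙ v)) ?_ ?_
      · rintro U ⟨⟨h1, h2, h3⟩, h4⟩
        refine ⟨inf_le_right, ?_, h4⟩
        rw [inf_assoc, inf_eq_right.2 (le_sup_left : A ≤ A ⊔ L ∙ v), h2]
      · rintro B' ⟨h1, h2, h3⟩
        have hB' : finrank L B' = finrank L B + 1 := by
          obtain ⟨x, hx, rfl⟩ := exists_eq_sup_span h1 h2 h3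
          refine finrank_sup_span_singleton fun h => hv ?_
          exact (Submodule.add_mem_iff_left A hx).1 (hBA h)
        rw [← hA', ← hB', ← ih (A ⊔ L ∙ v) B' h1 hA'X (by omega)]
        refine card_eq_of_iff fun U => ⟨fun h => ⟨h.1.1.1, h.2, h.1.1.2.2⟩, fun h => ?_⟩
        refine ⟨⟨⟨h.1, ?_, h.2.2⟩, h.2.1.trans_ne h3⟩, h.2.1⟩
        rw [← h2, ← h.2.1, inf_assoc, inf_eq_right.2 (le_sup_left : A ≤ A ⊔ L ∙ v)]

/-- The case `A = B = I` of `card_subspaces_inf_eq`: the condition `U ⊓ I = I` says that `U`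
contains `I`. -/
theorem card_interval_succ {I N : Submodule L V} (h : I ≤ N) :
    Nat.card {U : Submodule L V // I ≤ U ∧ U ≤ N ∧ finrank L U = finrank L I + 1} =
      (projPoly (finrank L N - finrank L I)).eval (Nat.card L) := by
  have hle := Submodule.finrank_mono h
  have := card_subspaces_inf_eq (finrank L N - finrank L I) I I N le_rfl h (by omega)
    (finrank L I + 1)
  rw [relPoly_succ _ _ _ le_rfl, Nat.sub_self, pow_zero, one_mul] at this
  rw [← this]
  exact card_eq_of_iff fun U => by rw [inf_eq_right]; tauto

theorem card_interval_pred {I N : Submodule L V} (h : I ≤ N) :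
    Nat.card {U : Submodule L V // I ≤ U ∧ U ≤ N ∧ finrank L U + 1 = finrank L N} =
      (projPoly (finrank L N - finrank L I)).eval (Nat.card L) := by
  have hle := Submodule.finrank_mono h
  have := card_subspaces_inf_eq (finrank L N - finrank L I) I I N le_rfl h (by omega)
    (finrank L N - 1)
  -- For `N = 0` no `U` exists, but the truncated `finrank L N - 1` would ask for dimension 0.
  by_cases h0 : finrank L N = 0
  · rw [card_eq_zero_of_forall fun U hU => by omega]
    simp [h0, projPoly]
  rw [relPoly_pred _ _ _ (by omega)] at this
  rw [← this]
  exact card_eq_of_iff fun U => by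
    rw [inf_eq_right, show finrank L U + 1 = finrank L N ↔ finrank L U = finrank L N - 1 by omega]
    tauto

end

open Polynomial in
-- Induction on the chain: `U` is found by choosing its intersection with the largest member `C
-- (Fin.last m)` and then extending it inside `X`, in a number of ways given by `relPoly`. The order
-- of the quantifiers matters: one polynomial serves all fields and all configurations with the
-- given dimensions.
theorem exists_chain_count (m : ℕ) (j x u : ℕ) (α c : Fin m → ℕ) :
    ∃ P : ℕ[X], ∀ (L V : Type) [Field L] [AddCommGroup V] [Module L V] [Finite L]
      [FiniteDimensional L V] (J X : Submodule L V) (C : Fin m → Submodule L V), Monotone C →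
      J ≤ X → (∀ i, J ≤ C i) → finrank L J = j → finrank L X = x →
      (∀ i, finrank L (C i ⊓ X : Submodule L V) = α i) →
      Nat.card {U : Submodule L V // J ≤ U ∧ U ≤ X ∧ finrank L U = u ∧
        ∀ i, finrank L (C i ⊓ U : Submodule L V) = c i} = P.eval (Nat.card L) := by
  induction m generalizing x u with
  | zero =>
    refine ⟨relPoly (x - j) j j u, fun L V _ _ _ _ _ J X C hC hJX hJC hJ hX hα => ?_⟩
    have hle := Submodule.finrank_mono hJX
    rw [← hJ, ← hX, ← card_subspaces_inf_eq _ J J X le_rfl hJX (by omega)]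
    exact card_eq_of_iff fun U => by
      rw [inf_eq_right]
      simp only [IsEmpty.forall_iff, and_true]
      tauto
  | succ m ih =>
    obtain ⟨P, hP⟩ := ih (α (Fin.last m)) (c (Fin.last m)) (fun i => α i.castSucc)
      (fun i => c i.castSucc)
    refine ⟨P * relPoly (x - α (Fin.last m)) (α (Fin.last m)) (c (Fin.last m)) u,
      fun L V _ _ _ _ _ J X C hC hJX hJC hJ hX hα => ?_⟩
    have := finite_submodule L V
    have hCX : finrank L (C (Fin.last m) ⊓ X : Submodule L V) ≤ finrank L X :=
      Submodule.finrank_mono inf_le_right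
    have hlast : ∀ i : Fin m, C i.castSucc ≤ C (Fin.last m) := fun i => hC (Fin.le_last _)
    rw [Polynomial.eval_mul, ← hP L V J (C (Fin.last m) ⊓ X) (fun i => C i.castSucc)
      (fun a b h => hC (by simpa using h)) (le_inf (hJC _) hJX) (fun i => hJC _) hJ (hα _)
      (fun i => by rw [← inf_assoc, inf_eq_left.2 (hlast i), hα])]
    refine card_eq_mul_of_fiber (fun U => C (Fin.last m) ⊓ U) ?_ ?_
    · rintro U ⟨h1, h2, h3, h4⟩
      refine ⟨le_inf (hJC _) h1, inf_le_inf_left _ h2, h4 _, fun i => ?_⟩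
      rw [← inf_assoc, inf_eq_left.2 (hlast i), h4]
    · rintro B ⟨h1, h2, h3, h4⟩
      rw [← hα (Fin.last m), ← h3, ← card_subspaces_inf_eq _ _ B X h2 inf_le_right (by
        have := hα (Fin.last m); omega)]
      refine card_eq_of_iff fun U => ⟨?_, ?_⟩
      · rintro ⟨⟨g1, g2, g3, g4⟩, g5⟩
        refine ⟨g2, ?_, g3⟩
        rw [inf_left_comm, inf_eq_left.2 g2, g5]
      · rintro ⟨g1, g2, g3⟩
        have g5 : C (Fin.last m) ⊓ U = B := by rw [← g2, inf_left_comm, inf_eq_left.2 g1]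
        refine ⟨⟨h1.trans (g5 ▸ inf_le_right), g1, g3, fun i => ?_⟩, g5⟩
        induction i using Fin.lastCases with
        | last => rw [g5, h3]
        | cast i => rw [← h4 i, ← g5, ← inf_assoc, inf_eq_left.2 (hlast i)]

open Polynomial in
-- The `D i` need not contain `I`, so they are replaced by `I + N ∩ D i`. By the modular law this
-- meets `U` in `I + U ∩ D i`, of dimension `a + dim (U ∩ D i) - α i`, and `exists_chain_count`
-- applies. The subtraction is harmless because `α i ≤ a`.
theorem exists_interval_count {k : ℕ} (a b u : ℕ) (α β c : Fin k → ℕ) :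
    ∃ P : ℕ[X], ∀ (L V : Type) [Field L] [AddCommGroup V] [Module L V] [Finite L]
      [FiniteDimensional L V] (I N : Submodule L V) (D : Fin k → Submodule L V), Monotone D →
      I ≤ N → finrank L I = a → finrank L N = b →
      (∀ i, finrank L (I ⊓ D i : Submodule L V) = α i) →
      (∀ i, finrank L (N ⊓ D i : Submodule L V) = β i) →
      Nat.card {U : Submodule L V // I ≤ U ∧ U ≤ N ∧ finrank L U = u ∧
        ∀ i, finrank L (U ⊓ D i : Submodule L V) = c i} = P.eval (Nat.card L) := by
  obtain ⟨P, hP⟩ := exists_chain_count k a b u (fun i => a + β i - α i) (fun i => a + c i - α i)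
  refine ⟨P, fun L V _ _ _ _ _ I N D hD hIN hI hN hα hβ => ?_⟩
  have key : ∀ U : Submodule L V, I ≤ U → U ≤ N → ∀ i,
      finrank L ((I ⊔ N ⊓ D i) ⊓ U : Submodule L V) + α i =
        a + finrank L (U ⊓ D i : Submodule L V) := by
    intro U h1 h2 i
    have h3 : (I ⊔ N ⊓ D i) ⊓ U = I ⊔ U ⊓ D i := by
      rw [sup_inf_assoc_of_le _ h1, inf_right_comm, inf_eq_right.2 h2]
    have h4 := Submodule.finrank_sup_add_finrank_inf_eq I (U ⊓ D i)
    rw [← inf_assoc, inf_eq_left.2 h1, hα, hI] at h4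
    rw [h3, h4]
  have hαa : ∀ i, α i ≤ a := fun i => by
    rw [← hα, ← hI]; exact Submodule.finrank_mono inf_le_left
  rw [← hP L V I N (fun i => I ⊔ N ⊓ D i)
    (fun i j h => sup_le_sup_left (inf_le_inf_left _ (hD h)) _) hIN (fun i => le_sup_left) hI hN
    (fun i => by have := key N hIN le_rfl i; rw [hβ] at this; omega)]
  refine card_eq_of_iff fun U => and_congr_right fun h1 => and_congr_right fun h2 =>
    and_congr_right fun h3 => forall_congr' fun i => ?_
  have := key U h1 h2 i
  have := hαa i
  omega

end

noncomputable section

open Module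

/-! ### Counting flags -/

section

variable {L V : Type} [Field L] [AddCommGroup V] [Module L V]

theorem finrank_map_add [FiniteDimensional L V] (t : V →ₗ[L] V) (X : Submodule L V) :
    finrank L (X.map t) + finrank L (LinearMap.ker t ⊓ X : Submodule L V) = finrank L X := by
  have h1 := LinearMap.finrank_range_add_finrank_ker (t.domRestrict X)
  have h2 : finrank L (LinearMap.ker (t.domRestrict X)) =
      finrank L (LinearMap.ker t ⊓ X : Submodule L V) := by
    rw [LinearMap.ker_domRestrict, inf_comm, ← Submodule.map_comap_subtype]
    exact LinearEquiv.finrank_eq (Submodule.equivMapOfInjective X.subtype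
      X.injective_subtype _)
  rwa [LinearMap.range_domRestrict, h2] at h1

/-- Flags of subspaces of `X` that are compatible with `t` and have prescribed dimensions, as well
as prescribed dimensions of the intersections with the subspaces `C j`. -/
def FlagCond {k m : ℕ} (t : V →ₗ[L] V) (C : Fin m → Submodule L V) (X : Submodule L V)
    (δ : Fin (k + 1) → ℕ) (c : Fin (k + 1) → Fin m → ℕ) (φ : Fin (k + 1) → Submodule L V) : Prop :=
  φ 0 = ⊥ ∧ φ (Fin.last k) = X ∧ (∀ i : Fin k, φ i.castSucc ≤ φ i.succ) ∧
    (∀ i : Fin k, (φ i.succ).map t ≤ φ i.castSucc) ∧ (∀ i, finrank L (φ i) = δ i) ∧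
    ∀ i j, finrank L (C j ⊓ φ i : Submodule L V) = c i j

theorem flagCond_snoc_iff {k m : ℕ} {t : V →ₗ[L] V} {C : Fin m → Submodule L V}
    {X : Submodule L V} {δ : Fin (k + 2) → ℕ} {c : Fin (k + 2) → Fin m → ℕ}
    (hX : finrank L X = δ (Fin.last (k + 1)))
    (hc : ∀ j, finrank L (C j ⊓ X : Submodule L V) = c (Fin.last (k + 1)) j)
    (φ : Fin (k + 2) → Submodule L V) :
    FlagCond t C X δ c φ ↔ φ (Fin.last (k + 1)) = X ∧
      X.map t ≤ φ (Fin.last k).castSucc ∧ φ (Fin.last k).castSucc ≤ X ∧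
      FlagCond t C (φ (Fin.last k).castSucc) (fun i => δ i.castSucc) (fun i => c i.castSucc)
        (fun i => φ i.castSucc) := by
  constructor
  · rintro ⟨h1, h2, h3, h4, h5, h6⟩
    refine ⟨h2, ?_, ?_, h1, rfl, fun i => h3 i.castSucc, fun i => h4 i.castSucc,
      fun i => h5 _, fun i => h6 _⟩
    · have := h4 (Fin.last k)
      rwa [Fin.succ_last, h2] at this
    · have := h3 (Fin.last k)
      rwa [Fin.succ_last, h2] at this
  · rintro ⟨h2, h7, h8, h1, -, h3, h4, h5, h6⟩
    refine ⟨h1, h2, ?_, ?_, ?_, ?_⟩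
    · intro i
      induction i using Fin.lastCases with
      | last => rwa [Fin.succ_last, h2]
      | cast i => exact h3 i
    · intro i
      induction i using Fin.lastCases with
      | last => rwa [Fin.succ_last, h2]
      | cast i => exact h4 i
    · intro i
      induction i using Fin.lastCases with
      | last => rw [h2, hX]
      | cast i => exact h5 i
    · intro i j
      induction i using Fin.lastCases with
      | last => rw [h2, hc]
      | cast i => exact h6 i j

end

open Polynomial in
-- Induction on the length, removing the top of the flag. The next subspace `X'` lies between `t X`
-- and `X` with prescribed intersections with the `C j`, and `t X` lies in all of these because `C
-- 0` contains the range of `t`; so `exists_chain_count` counts the possible `X'`. Since `t X ≤ X' ≤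
-- X`, the space `X'` is again stable under `t`, and the number of flags below it depends only on
-- dimensions.
theorem exists_flag_count {k m : ℕ} (δ : Fin (k + 1) → ℕ) (c : Fin (k + 1) → Fin (m + 1) → ℕ) :
    ∃ P : ℕ[X], ∀ (L V : Type) [Field L] [AddCommGroup V] [Module L V] [Finite L]
      [FiniteDimensional L V] (t : V →ₗ[L] V) (C : Fin (m + 1) → Submodule L V)
      (X : Submodule L V), Monotone C → LinearMap.range t ≤ C 0 →
      C (Fin.last m) = LinearMap.ker t → X.map t ≤ X → finrank L X = δ (Fin.last k) →
      (∀ j, finrank L (C j ⊓ X : Submodule L V) = c (Fin.last k) j) →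
      Nat.card {φ : Fin (k + 1) → Submodule L V // FlagCond t C X δ c φ} =
        P.eval (Nat.card L) := by
  induction k with
  | zero =>
    by_cases hδ : δ 0 = 0
    · refine ⟨1, fun L V _ _ _ _ _ t C X hC hC0 hCm htX hX hc => ?_⟩
      have hX0 : X = ⊥ := by
        rw [← Submodule.finrank_eq_zero (R := L), hX]
        exact hδ
      rw [Polynomial.eval_one]
      refine card_eq_one_of_iff (fun _ => X) fun φ => ⟨fun h => ?_, ?_⟩
      · funext i
        rw [Fin.fin_one_eq_zero i, h.1, hX0]
      · rintro rfl
        refine ⟨hX0, rfl, fun i => i.elim0, fun i => i.elim0, fun i => ?_, fun i j => ?_⟩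
        · rw [Fin.fin_one_eq_zero i]; exact hX
        · rw [Fin.fin_one_eq_zero i]; exact hc j
    · refine ⟨0, fun L V _ _ _ _ _ t C X hC hC0 hCm htX hX hc => ?_⟩
      rw [Polynomial.eval_zero]
      refine card_eq_zero_of_forall fun φ h => hδ ?_
      rw [← h.2.2.2.2.1 0, h.1, finrank_bot]
  | succ k ih =>
    obtain ⟨P, hP⟩ := ih (fun i => δ i.castSucc) (fun i => c i.castSucc)
    -- The first dimension is that of `t X`, by rank-nullity on `X`, as the last `C j` is the kernel
    -- of `t`.
    obtain ⟨Q, hQ⟩ := exists_chain_count (m + 1) (δ (Fin.last (k + 1)) - c (Fin.last (k + 1))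
      (Fin.last m)) (δ (Fin.last (k + 1))) (δ (Fin.last k).castSucc) (c (Fin.last (k + 1)))
      (c (Fin.last k).castSucc)
    refine ⟨Q * P, fun L V _ _ _ _ _ t C X hC hC0 hCm htX hX hc => ?_⟩
    have := finite_submodule L V
    have hrk : finrank L (X.map t) =
        δ (Fin.last (k + 1)) - c (Fin.last (k + 1)) (Fin.last m) := by
      rw [← hX, ← hc, hCm, ← finrank_map_add t X, Nat.add_sub_cancel]
    have htC : ∀ Y : Submodule L V, ∀ i, Y.map t ≤ C i := fun Y i =>
      (LinearMap.map_le_range).trans (hC0.trans (hC (Fin.zero_le i)))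
    rw [Polynomial.eval_mul, ← hQ L V (X.map t) X C hC htX (htC X) hrk hX hc]
    refine card_eq_mul_of_fiber (fun φ => φ (Fin.last k).castSucc) ?_ ?_
    · intro φ h
      obtain ⟨-, h1, h2, -, -, -, -, h3, h4⟩ := (flagCond_snoc_iff hX hc φ).1 h
      exact ⟨h1, h2, h3 _, h4 _⟩
    · rintro X' ⟨h1, h2, h3, h4⟩
      rw [← hP L V t C X' hC hC0 hCm
        ((Submodule.map_mono h2).trans h1) h3 h4]
      refine Nat.card_congr ⟨fun φ => ⟨fun i => φ.1 i.castSucc, ?_⟩,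
        fun ψ => ⟨Fin.snoc ψ.1 X, ?_, ?_⟩, ?_, ?_⟩
      · have := ((flagCond_snoc_iff hX hc φ.1).1 φ.2.1).2.2.2
        rwa [φ.2.2] at this
      · rw [flagCond_snoc_iff hX hc]
        simp only [Fin.snoc_last, Fin.snoc_castSucc, ψ.2.2.1]
        exact ⟨trivial, h1, h2, ψ.2⟩
      · simp only [Fin.snoc_castSucc]
        exact ψ.2.2.1
      · rintro ⟨φ, hφ, hφ'⟩
        ext1
        funext i
        dsimp only
        induction i using Fin.lastCases with
        | last => rw [Fin.snoc_last, hφ.2.1]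
        | cast i => rw [Fin.snoc_castSucc]
      · rintro ⟨ψ, hψ⟩
        ext1
        funext i
        simp

/-! ### Base change of subspaces -/

section

variable {F D : Type} [Field F] [AddCommGroup D] [Module F D] (L : Type) [Field L] [Algebra F L]

theorem finrank_baseChange_submodule (p : Submodule F D) :
    finrank L (p.baseChange L) = finrank F p := by
  rw [← Module.finrank_baseChange (R := L) (S := F) (M' := p)]
  have hinj : Function.Injective (p.subtype.baseChange L) :=
    Module.Flat.lTensor_preserves_injective_linearMap (M := L) p.subtype p.injective_subtype
  exact LinearMap.finrank_range_of_inj hinj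

theorem baseChange_sup (p q : Submodule F D) :
    (p ⊔ q).baseChange L = p.baseChange L ⊔ q.baseChange L := by
  conv_lhs => rw [← Submodule.span_eq p, ← Submodule.span_eq q, ← Submodule.span_union,
    Submodule.baseChange_span, Set.image_union, Submodule.span_union,
    ← Submodule.baseChange_span, ← Submodule.baseChange_span, Submodule.span_eq,
    Submodule.span_eq]

/-- Base change preserves dimensions and sums, and the dimension formula then takes care of
intersections. -/
theorem finrank_baseChange_inf [FiniteDimensional F D] (p q : Submodule F D) :
    finrank L (p.baseChange L ⊓ q.baseChange L : Submodule L (L ⊗[F] D)) =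
      finrank F (p ⊓ q : Submodule F D) := by
  have h1 := Submodule.finrank_sup_add_finrank_inf_eq p q
  have h2 := Submodule.finrank_sup_add_finrank_inf_eq (p.baseChange L) (q.baseChange L)
  rw [← baseChange_sup, finrank_baseChange_submodule, finrank_baseChange_submodule,
    finrank_baseChange_submodule] at h2
  omega

theorem map_baseChange (t : D →ₗ[F] D) (p : Submodule F D) :
    (p.baseChange L).map (t.baseChange L) = (p.map t).baseChange L := by
  conv_lhs => rw [← Submodule.span_eq p, Submodule.baseChange_span, Submodule.map_span,
    Set.image_image]
  conv_rhs => rw [← Submodule.span_eq p, Submodule.map_span, Submodule.baseChange_span,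
    Set.image_image]
  simp

theorem range_baseChange' (t : D →ₗ[F] D) :
    LinearMap.range (t.baseChange L) = (LinearMap.range t).baseChange L := by
  rw [LinearMap.range_eq_map, LinearMap.range_eq_map, ← map_baseChange, Submodule.baseChange_top]

theorem ker_baseChange' [FiniteDimensional F D] (t : D →ₗ[F] D) :
    LinearMap.ker (t.baseChange L) = (LinearMap.ker t).baseChange L := by
  symm
  apply Submodule.eq_of_le_of_finrank_eq
  · rw [Submodule.baseChange_eq_span, Submodule.span_le]
    rintro _ ⟨x, hx, rfl⟩
    have : t x = 0 := hx
    simp [this]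
  · have h1 := LinearMap.finrank_range_add_finrank_ker (t.baseChange L)
    have h2 := LinearMap.finrank_range_add_finrank_ker t
    rw [range_baseChange', finrank_baseChange_submodule, Module.finrank_baseChange] at h1
    rw [finrank_baseChange_submodule]
    omega

theorem finrank_range_baseChange (t : D →ₗ[F] D) :
    finrank L (LinearMap.range (t.baseChange L)) = finrank F (LinearMap.range t) := by
  rw [range_baseChange', finrank_baseChange_submodule]

theorem finrank_ker_baseChange [FiniteDimensional F D] (t : D →ₗ[F] D) :
    finrank L (LinearMap.ker (t.baseChange L)) = finrank F (LinearMap.ker t) := by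
  rw [ker_baseChange', finrank_baseChange_submodule]

end

end

noncomputable section

open Module

/-! ### Points of the varieties -/

section

variable {L V : Type} [Field L] [AddCommGroup V] [Module L V] {k : ℕ} {d : Fin k → ℕ}

theorem QPt.eq_of {x y : QPt L V} (hW : x.W = y.W) (ht : x.t = y.t) : x = y := by
  cases x; cases y; cases hW; cases ht; rfl

theorem TPt.eq_of {x y : TPt L V d} (hW : x.W = y.W) (ht : x.t = y.t) (hf : x.flag = y.flag) :
    x = y := by
  obtain ⟨x, xf, _, _, _, _, _⟩ := x
  obtain ⟨y, yf, _, _, _, _, _⟩ := y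
  obtain rfl : x = y := QPt.eq_of hW ht
  cases hf
  rfl

theorem finite_QPt (L V : Type) [Field L] [AddCommGroup V] [Module L V] [Finite L]
    [FiniteDimensional L V] : Finite (QPt L V) := by
  have := finite_submodule L V
  have : Finite V := Module.finite_of_finite L
  have : Finite (V →ₗ[L] V) := Module.finite_of_finite L
  refine Finite.of_injective (fun x : QPt L V => (x.W, x.t)) fun x y h => ?_
  rw [Prod.mk.injEq] at h
  exact QPt.eq_of h.1 h.2

theorem finite_TPt (L V : Type) [Field L] [AddCommGroup V] [Module L V] [Finite L]
    [FiniteDimensional L V] (d : Fin k → ℕ) : Finite (TPt L V d) := by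
  have := finite_submodule L V
  have := finite_QPt L V
  refine Finite.of_injective (fun x : TPt L V d => (x.toQPt, x.flag)) fun x y h => ?_
  rw [Prod.mk.injEq] at h
  exact TPt.eq_of (congrArg QPt.W h.1) (congrArg QPt.t h.1) h.2

theorem TPt.flag_monotone (x : TPt L V d) : Monotone x.flag :=
  Fin.monotone_iff_le_succ.2 x.flag_le

/-- The point with the same `t` and the same flag as `x`, and with `W = U`. -/
def TPt.setW (x : TPt L V d) (U : Submodule L V) (h1 : LinearMap.range x.t ≤ U)
    (h2 : U ≤ LinearMap.ker x.t) : TPt L V d where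
  W := U
  t := x.t
  range_le := h1
  le_ker := h2
  flag := x.flag
  flag_zero := x.flag_zero
  flag_last := x.flag_last
  flag_le := x.flag_le
  flag_dim := x.flag_dim
  stable := x.stable

/-- The sum of the first `i` entries. -/
def psum {k : ℕ} (n : Fin k → ℕ) (i : Fin (k + 1)) : ℕ :=
  ∑ j : Fin k with j.castSucc < i, n j

@[simp] theorem psum_zero {k : ℕ} (n : Fin k → ℕ) : psum n 0 = 0 := by
  simp [psum]

theorem psum_succ {k : ℕ} (n : Fin k → ℕ) (i : Fin k) :
    psum n i.succ = psum n i.castSucc + n i := by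
  classical
  have : (Finset.univ.filter fun j : Fin k => j.castSucc < i.succ) =
      insert i (Finset.univ.filter fun j : Fin k => j.castSucc < i.castSucc) := by
    ext j
    simp only [Finset.mem_filter, Finset.mem_univ, true_and, Finset.mem_insert, Fin.lt_def,
      Fin.val_castSucc, Fin.val_succ, Fin.ext_iff]
    omega
  rw [psum, this, Finset.sum_insert (by simp), psum, add_comm]

theorem psum_last {k : ℕ} (n : Fin k → ℕ) : psum n (Fin.last k) = ∑ i, n i := by
  rw [psum, Finset.filter_true_of_mem fun j _ => Fin.castSucc_lt_last j]

/-- This translates strata into the dimensions of intersections that the counting lemmas use. The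
flag increases, so the truncated subtraction in `alpha` loses nothing. -/
theorem alpha_eq_iff [FiniteDimensional L V] {flag : Fin (k + 1) → Submodule L V}
    (h0 : flag 0 = ⊥) (hle : ∀ i : Fin k, flag i.castSucc ≤ flag i.succ) (U : Submodule L V)
    (n : Fin k → ℕ) :
    alpha flag U = n ↔ ∀ i, finrank L (U ⊓ flag i : Submodule L V) = psum n i := by
  have hmono : ∀ i : Fin k, finrank L (U ⊓ flag i.castSucc : Submodule L V) ≤
      finrank L (U ⊓ flag i.succ : Submodule L V) := fun i =>
    Submodule.finrank_mono (inf_le_inf_left _ (hle i))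
  constructor
  · rintro rfl i
    induction i using Fin.induction with
    | zero => rw [h0, inf_bot_eq, finrank_bot, psum_zero]
    | succ i ih =>
      rw [psum_succ, ← ih, alpha]
      have := hmono i
      omega
  · intro h
    funext i
    rw [alpha, h, h, psum_succ]
    omega

theorem finrank_inf_flag [FiniteDimensional L V] (x : TPt L V d) (U : Submodule L V)
    (i : Fin (k + 1)) :
    finrank L (U ⊓ x.flag i : Submodule L V) = psum (alpha x.flag U) i :=
  (alpha_eq_iff x.flag_zero x.flag_le U _).1 rfl i

theorem sum_alpha [FiniteDimensional L V] (x : TPt L V d) (U : Submodule L V) :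
    ∑ i, alpha x.flag U i = finrank L U := by
  rw [← psum_last, ← finrank_inf_flag, x.flag_last, inf_top_eq]

theorem finrank_flag [FiniteDimensional L V] (x : TPt L V d) (i : Fin (k + 1)) :
    finrank L (x.flag i) = psum d i := by
  induction i using Fin.induction with
  | zero => rw [x.flag_zero, finrank_bot, psum_zero]
  | succ i ih => rw [x.flag_dim, ih, psum_succ]

theorem finrank_eq_sum [FiniteDimensional L V] (x : TPt L V d) : finrank L V = ∑ i, d i := by
  rw [← psum_last, ← finrank_flag x, x.flag_last, finrank_top]

end

section

variable {F D : Type} [Field F] [AddCommGroup D] [Module F D] [FiniteDimensional F D]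
  {k : ℕ} {d : Fin k → ℕ}

/-- Base change of points of `T(𝐝)`. -/
def TPt.baseChange (L : Type) [Field L] [Algebra F L] (x : TPt F D d) :
    TPt L (L ⊗[F] D) d where
  W := x.W.baseChange L
  t := x.t.baseChange L
  range_le := by
    rw [range_baseChange']
    exact Submodule.baseChange_mono L x.range_le
  le_ker := by
    rw [ker_baseChange']
    exact Submodule.baseChange_mono L x.le_ker
  flag i := (x.flag i).baseChange L
  flag_zero := by rw [x.flag_zero, Submodule.baseChange_bot]
  flag_last := by rw [x.flag_last, Submodule.baseChange_top]
  flag_le i := Submodule.baseChange_mono L (x.flag_le i)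
  flag_dim i := by
    rw [finrank_baseChange_submodule, finrank_baseChange_submodule, x.flag_dim]
  stable i := by
    rw [map_baseChange]
    exact Submodule.baseChange_mono L (x.stable i)

theorem alpha_baseChange (L : Type) [Field L] [Algebra F L] (flag : Fin (k + 1) → Submodule F D)
    (U : Submodule F D) :
    alpha (fun i => (flag i).baseChange L) (U.baseChange L) = alpha flag U := by
  funext i
  simp only [alpha, finrank_baseChange_inf]

end

/-! ### Sums over strata -/

/-- Here `f` is `v` on the relevant strata in `T` and `0` on the other relevant ones, so the sum
should be `v` times the count of all points in `T`. The danger lies in strata that are empty over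
`F`, where `stratVal` is a default value. The same `P s` counts the points over `F`, so there it
vanishes at `|F|` and is zero by `nat_poly_eq_zero_of_eval`. The remaining strata form the finite
set `A`, and the polynomials add up to `Q`. -/
theorem stratSum_eq {F : Type} [Field F] [Finite F] {X S : Type} {lab : X → S} {f : X → Cq}
    (hf : ∀ x y, lab x = lab y → f x = f y) [Finite X] (X₀ : X → Prop) (T : S → Prop) (v : Cq)
    (hv : ∀ x, X₀ x → T (lab x) → f x = v) (hv₀ : ∀ x, X₀ x → ¬ T (lab x) → f x = 0)
    {Y : FinExt F → Type} [∀ L, Finite (Y L)] (labY : ∀ L, Y L → S) (Y₀ : ∀ L, Y L → Prop)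
    {N : S → FinExt F → ℕ} (hN : ∀ s L, N s L = Nat.card {y : Y L // Y₀ L y ∧ labY L y = s})
    (P : S → Polynomial ℕ)
    (hP : ∀ s (L : FinExt F), Nat.card {y : Y L // Y₀ L y ∧ labY L y = s} =
      (P s).eval (Nat.card L.carrier))
    (hP₀ : ∀ s, Nat.card {x : X // X₀ x ∧ lab x = s} = (P s).eval (Nat.card F))
    (Q : Polynomial ℕ)
    (hQ : ∀ L : FinExt F, Nat.card {y : Y L // Y₀ L y ∧ T (labY L y)} =
      Q.eval (Nat.card L.carrier)) :
    stratSum lab f N = v * evq Q := by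
  classical
  have := Fintype.ofFinite X
  let A : Finset S := (Finset.univ.filter X₀).image lab
  have hA : ∀ s, s ∉ A → P s = 0 := by
    intro s hs
    refine nat_poly_eq_zero_of_eval (n := Nat.card F) Nat.card_pos ?_
    rw [← hP₀, card_eq_zero_of_forall]
    rintro x ⟨hx, rfl⟩
    exact hs (Finset.mem_image_of_mem _ (by simpa using hx))
  have hchi : ∀ s, chi F (N s) = evq (P s) := fun s =>
    chi_eq_evq F fun L => by rw [hN, hP]
  have hval : ∀ s ∈ A, stratVal lab f s = if T s then v else 0 := by
    intro s hs
    obtain ⟨x, hx, rfl⟩ := Finset.mem_image.1 hs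
    have hx : X₀ x := by simpa using hx
    have hex : ∃ y, lab y = lab x := ⟨x, rfl⟩
    rw [stratVal, dif_pos hex, hf _ x hex.choose_spec]
    split_ifs with h
    · exact hv x hx h
    · exact hv₀ x hx h
  -- Both sides agree at every field size: a point over `L` outside the strata in `A` would
  -- contradict `P s = 0`.
  have hsum : ∑ s ∈ A.filter T, P s = Q := by
    refine nat_poly_eq_of_finExt F fun L => ?_
    rw [Polynomial.eval_finsetSum, ← hQ,
      card_eq_sum_card_fiber _ (labY L) (A.filter T)]
    · refine Finset.sum_congr rfl fun s hs => ?_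
      rw [← hP]
      refine card_eq_of_iff fun y => ⟨fun h => ⟨⟨h.1, ?_⟩, h.2⟩, fun h => ⟨h.1.1, h.2⟩⟩
      rw [h.2]
      exact (Finset.mem_filter.1 hs).2
    · rintro y ⟨h1, h2⟩
      refine Finset.mem_filter.2 ⟨?_, h2⟩
      by_contra h
      have h3 := hP (labY L y) L
      rw [hA _ h, Polynomial.eval_zero, Nat.card_eq_zero] at h3
      rcases h3 with h3 | h3
      · exact h3.false ⟨y, h1, rfl⟩
      · exact (not_finite_iff_infinite.2 h3) inferInstance
  rw [stratSum, finsum_eq_sum_of_support_subset (s := A)]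
  · rw [← hsum, evq_sum, Finset.mul_sum, Finset.sum_filter]
    refine Finset.sum_congr rfl fun s hs => ?_
    rw [hval s hs, hchi]
    split_ifs <;> simp
  · intro s hs
    by_contra h
    refine hs ?_
    simp only [hchi, hA s h, evq_zero, mul_zero]

/-! ### The action of `E` and `F` -/

section

variable {k : ℕ} {d : Fin k → ℕ}

theorem TPt.card_fixed_flag {L V : Type} [Field L] [AddCommGroup V] [Module L V]
    (x : TPt L V d) (I N : Submodule L V) (hI : LinearMap.range x.t ≤ I)
    (hN : N ≤ LinearMap.ker x.t) (p : Submodule L V → Prop) :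
    Nat.card {y : TPt L V d // (y.t = x.t ∧ ∀ i, y.flag i = x.flag i) ∧ I ≤ y.W ∧ y.W ≤ N ∧
      p y.W} = Nat.card {U : Submodule L V // I ≤ U ∧ U ≤ N ∧ p U} := by
  refine Nat.card_congr ⟨fun y => ⟨y.1.W, y.2.2⟩,
    fun U => ⟨x.setW U.1 (hI.trans U.2.1) (U.2.2.1.trans hN), ⟨rfl, fun _ => rfl⟩, U.2⟩, ?_, ?_⟩
  · rintro ⟨y, ⟨h1, h2⟩, h3⟩
    ext1
    exact TPt.eq_of rfl h1.symm (funext fun i => (h2 i).symm)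
  · rintro ⟨U, h⟩
    rfl

/-- With `t` and the flag fixed, two of the three labels of a stratum are fixed. Either they
disagree with `s` and nothing is counted, or only the condition on `α(W, 𝐃)` remains, which is an
interval count. -/
theorem exists_stratum_count (s : (Fin k → ℕ) × (Fin k → ℕ) × (Fin k → ℕ)) (a b u : ℕ)
    (α β m n : Fin k → ℕ) :
    ∃ P : Polynomial ℕ, ∀ (L V : Type) [Field L] [AddCommGroup V] [Module L V] [Finite L]
      [FiniteDimensional L V] (x : TPt L V d) (I N : Submodule L V),
      LinearMap.range x.t ≤ I → I ≤ N → N ≤ LinearMap.ker x.t →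
      alpha x.flag I = α → alpha x.flag N = β → finrank L I = a → finrank L N = b →
      alpha x.flag (LinearMap.range x.t) = m → alpha x.flag (LinearMap.ker x.t) = n →
      Nat.card {y : TPt L V d // ((y.t = x.t ∧ ∀ i, y.flag i = x.flag i) ∧ I ≤ y.W ∧ y.W ≤ N ∧
        finrank L y.W = u) ∧ y.lab = s} = P.eval (Nat.card L) := by
  by_cases h : s.2.1 = m ∧ s.2.2 = n
  · obtain ⟨P, hP⟩ := exists_interval_count a b u (psum α) (psum β) (psum s.1)
    refine ⟨P, fun L V _ _ _ _ _ x I N h1 h2 h3 hα hβ ha hb hm hn => ?_⟩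
    rw [← hP L V I N x.flag x.flag_monotone h2 ha hb
      (fun i => by rw [finrank_inf_flag, hα]) (fun i => by rw [finrank_inf_flag, hβ]),
      ← x.card_fixed_flag I N h1 h3
        (fun U => finrank L U = u ∧ ∀ i, finrank L (U ⊓ x.flag i : Submodule L V) = psum s.1 i)]
    refine card_eq_of_iff fun y => ?_
    have key : y.t = x.t → y.flag = x.flag →
        (y.lab = s ↔ ∀ i, finrank L (y.W ⊓ x.flag i : Submodule L V) = psum s.1 i) := by
      intro e1 e2
      rw [← alpha_eq_iff x.flag_zero x.flag_le, TPt.lab, Prod.ext_iff, Prod.ext_iff]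
      simp only [e1, e2]
      rw [hm, hn]
      tauto
    constructor
    · rintro ⟨⟨⟨e1, e2⟩, e3, e4, e5⟩, e6⟩
      exact ⟨⟨e1, e2⟩, e3, e4, e5, (key e1 (funext e2)).1 e6⟩
    · rintro ⟨⟨e1, e2⟩, e3, e4, e5, e6⟩
      exact ⟨⟨⟨e1, e2⟩, e3, e4, e5⟩, (key e1 (funext e2)).2 e6⟩
  · refine ⟨0, fun L V _ _ _ _ _ x I N h1 h2 h3 hα hβ ha hb hm hn => ?_⟩
    rw [Polynomial.eval_zero]
    refine card_eq_zero_of_forall ?_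
    rintro y ⟨⟨⟨e1, e2⟩, -⟩, rfl⟩
    have e2 := funext e2
    exact h ⟨by simp [TPt.lab, e1, e2, hm], by simp [TPt.lab, e1, e2, hn]⟩

variable {F D : Type} [Field F] [Finite F] [AddCommGroup D] [Module F D] [FiniteDimensional F D]

/-- The common core of `E` and `F`: a sum over the subspaces of dimension `u` between `I` and `N`,
on which `f` is constant. Every stratum is admitted, so the predicate in `stratSum_eq` is `True`. -/
theorem stratSum_fixed_flag {f : TPt F D d → Cq} (hf : ∀ x y, x.lab = y.lab → f x = f y)
    (x : TPt F D d) (I N : Submodule F D)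
    (hI : LinearMap.range x.t ≤ I) (hIN : I ≤ N) (hN : N ≤ LinearMap.ker x.t) (u : ℕ) (v : Cq)
    (hv : ∀ y : TPt F D d, y.t = x.t → (∀ i, y.flag i = x.flag i) → finrank F y.W = u → f y = v)
    (Q : Polynomial ℕ)
    (hQ : ∀ L : FinExt F, Nat.card {U : Submodule L.carrier (L.carrier ⊗[F] D) //
      I.baseChange L.carrier ≤ U ∧ U ≤ N.baseChange L.carrier ∧ finrank L.carrier U = u} =
        Q.eval (Nat.card L.carrier)) :
    stratSum TPt.lab f (fun s (L : FinExt F) =>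
        Nat.card {y : TPt L.carrier (L.carrier ⊗[F] D) d //
          ((y.t = x.t.baseChange L.carrier ∧ ∀ i, y.flag i = (x.flag i).baseChange L.carrier) ∧
          I.baseChange L.carrier ≤ y.W ∧ y.W ≤ N.baseChange L.carrier ∧
          finrank L.carrier y.W = u) ∧ y.lab = s}) = v * evq Q := by
  have := finite_TPt F D d
  have (L : FinExt F) := finite_TPt L.carrier (L.carrier ⊗[F] D) d
  choose P hP using fun s => exists_stratum_count (d := d) s (finrank F I) (finrank F N) u
    (alpha x.flag I) (alpha x.flag N) (alpha x.flag (LinearMap.range x.t))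
    (alpha x.flag (LinearMap.ker x.t))
  refine stratSum_eq hf (fun y => (y.t = x.t ∧ ∀ i, y.flag i = x.flag i) ∧ I ≤ y.W ∧ y.W ≤ N ∧
      finrank F y.W = u) (fun _ => True) v (fun y hy _ => hv y hy.1.1 hy.1.2 hy.2.2.2)
    (fun y _ h => absurd trivial h)
    (Y := fun L => TPt L.carrier (L.carrier ⊗[F] D) d) (fun L y => y.lab)
    (fun L y => (y.t = x.t.baseChange L.carrier ∧
      ∀ i, y.flag i = (x.flag i).baseChange L.carrier) ∧
      I.baseChange L.carrier ≤ y.W ∧ y.W ≤ N.baseChange L.carrier ∧ finrank L.carrier y.W = u)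
    (fun s L => rfl) P (fun s L => ?_) (fun s => ?_) Q (fun L => ?_)
  · refine hP s L.carrier _ (x.baseChange L.carrier) _ _ ?_ ?_ ?_ ?_ ?_ ?_ ?_ ?_ ?_
    · exact (range_baseChange' L.carrier x.t).le.trans (Submodule.baseChange_mono _ hI)
    · exact Submodule.baseChange_mono _ hIN
    · exact (Submodule.baseChange_mono _ hN).trans (ker_baseChange' L.carrier x.t).ge
    · exact alpha_baseChange _ _ _
    · exact alpha_baseChange _ _ _
    · exact finrank_baseChange_submodule _ _
    · exact finrank_baseChange_submodule _ _
    · exact (congrArg (alpha (x.baseChange L.carrier).flag) (range_baseChange' L.carrier x.t)).trans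
        (alpha_baseChange _ _ _)
    · exact (congrArg (alpha (x.baseChange L.carrier).flag) (ker_baseChange' L.carrier x.t)).trans
        (alpha_baseChange _ _ _)
  · exact hP s F D x I N hI hIN hN rfl rfl rfl rfl rfl rfl
  · rw [← hQ L]
    rw [← (x.baseChange L.carrier).card_fixed_flag _ _ ?_ ?_ (fun U => finrank L.carrier U = u)]
    · exact card_eq_of_iff fun y => and_iff_left trivial
    · exact (range_baseChange' L.carrier x.t).le.trans (Submodule.baseChange_mono _ hI)
    · exact (Submodule.baseChange_mono _ hN).trans (ker_baseChange' L.carrier x.t).ge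

/-- The sum runs over the lines in `ker t / W`, and the normalised size of this projective space is
the quantum integer. -/
theorem actT_E_apply {f : TPt F D d → Cq} (hf : ∀ x y, x.lab = y.lab → f x = f y)
    (x : TPt F D d) (v : Cq)
    (hv : ∀ y : TPt F D d, y.t = x.t → (∀ i, y.flag i = x.flag i) →
      finrank F y.W = finrank F x.W + 1 → f y = v) :
    actT .E f x = qint ((finrank F (LinearMap.ker x.t) : ℤ) - finrank F x.W) * v := by
  have hle := Submodule.finrank_mono x.le_ker
  have h := stratSum_fixed_flag hf x x.W (LinearMap.ker x.t) x.range_le x.le_ker le_rfl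
    (finrank F x.W + 1) v hv (projPoly (finrank F (LinearMap.ker x.t) - finrank F x.W))
    (fun L => by
      have := card_interval_succ (Submodule.baseChange_mono L.carrier x.le_ker)
      simpa only [finrank_baseChange_submodule] using this)
  have h2 := evq_projPoly (finrank F (LinearMap.ker x.t) - finrank F x.W)
  rw [Nat.cast_sub hle] at h2
  rw [← h2, mul_assoc, mul_comm (evq _), ← h, actT]
  congr 2
  funext s L
  refine card_eq_of_iff fun y => ⟨?_, ?_⟩
  · rintro ⟨h1, h2, h3, h4, h5⟩
    refine ⟨⟨⟨h1, h2⟩, h3, ?_, h4⟩, h5⟩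
    rw [← ker_baseChange', ← h1]
    exact y.le_ker
  · rintro ⟨⟨⟨h1, h2⟩, h3, h3', h4⟩, h5⟩
    exact ⟨h1, h2, h3, h4, h5⟩

theorem actT_F_apply {f : TPt F D d → Cq} (hf : ∀ x y, x.lab = y.lab → f x = f y)
    (x : TPt F D d) (v : Cq)
    (hv : ∀ y : TPt F D d, y.t = x.t → (∀ i, y.flag i = x.flag i) →
      finrank F y.W + 1 = finrank F x.W → f y = v) :
    actT .F f x = qint ((finrank F x.W : ℤ) - finrank F (LinearMap.range x.t)) * v := by
  have hle := Submodule.finrank_mono x.range_le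
  -- `W = 0` is treated apart: it has no subspace of dimension `-1`, while the truncated `finrank F
  -- x.W - 1` used below would be 0.
  rcases Nat.eq_zero_or_pos (finrank F x.W) with h0 | h0
  · have h1 : finrank F (LinearMap.range x.t) = 0 := by omega
    rw [h1, h0, sub_self, qint_zero, zero_mul, actT]
    have : stratSum TPt.lab f (fun s (L : FinExt F) =>
        Nat.card {y : TPt L.carrier (L.carrier ⊗[F] D) d // y.t = x.t.baseChange L.carrier ∧
          (∀ i, y.flag i = (x.flag i).baseChange L.carrier) ∧
          y.W ≤ x.W.baseChange L.carrier ∧ finrank L.carrier y.W + 1 = finrank F x.W ∧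
          y.lab = s}) = 0 := by
      rw [stratSum]
      refine finsum_eq_zero_of_forall_eq_zero fun s => ?_
      rw [chi_eq_evq F (P := 0), evq_zero, mul_zero]
      intro L
      rw [Polynomial.eval_zero]
      refine card_eq_zero_of_forall fun y hy => ?_
      have := hy.2.2.2.1
      omega
    rw [this, mul_zero]
  have h := stratSum_fixed_flag hf x (LinearMap.range x.t) x.W le_rfl x.range_le x.le_ker
    (finrank F x.W - 1) v (fun y h1 h2 h3 => hv y h1 h2 (by omega))
    (projPoly (finrank F x.W - finrank F (LinearMap.range x.t)))
    (fun L => by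
      have := card_interval_pred (Submodule.baseChange_mono L.carrier x.range_le)
      simp only [finrank_baseChange_submodule] at this
      rw [← this]
      exact card_eq_of_iff fun U => by
        rw [show finrank L.carrier U = finrank F x.W - 1 ↔ finrank L.carrier U + 1 =
          finrank F x.W by omega])
  have h2 := evq_projPoly (finrank F x.W - finrank F (LinearMap.range x.t))
  rw [Nat.cast_sub hle] at h2
  rw [← h2, mul_assoc, mul_comm (evq _), ← h, actT]
  congr 2
  funext s L
  refine card_eq_of_iff fun y => ⟨?_, ?_⟩
  · rintro ⟨h1, h2, h3, h4, h5⟩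
    refine ⟨⟨⟨h1, h2⟩, ?_, h3, by omega⟩, h5⟩
    rw [← range_baseChange', ← h1]
    exact y.range_le
  · rintro ⟨⟨⟨h1, h2⟩, h3, h3', h4⟩, h5⟩
    exact ⟨h1, h2, h3', by omega, h5⟩

/-! The same for functions on `M(d)`. -/

theorem QPt.card_fixed_t {L V : Type} [Field L] [AddCommGroup V] [Module L V] (t : V →ₗ[L] V)
    (I N : Submodule L V) (hI : LinearMap.range t ≤ I) (hN : N ≤ LinearMap.ker t)
    (p : Submodule L V → Prop) :
    Nat.card {y : QPt L V // y.t = t ∧ I ≤ y.W ∧ y.W ≤ N ∧ p y.W} =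
      Nat.card {U : Submodule L V // I ≤ U ∧ U ≤ N ∧ p U} := by
  refine Nat.card_congr ⟨fun y => ⟨y.1.W, y.2.2⟩,
    fun U => ⟨⟨U.1, t, hI.trans U.2.1, U.2.2.1.trans hN⟩, rfl, U.2⟩, ?_, ?_⟩
  · rintro ⟨y, h1, h3⟩
    ext1
    exact QPt.eq_of rfl h1.symm
  · rintro ⟨U, h⟩
    rfl

/-- Only the stratum `(u, rank t)` is met, so its polynomial is `Q` and all the others are 0. -/
theorem stratSum_fixed_t {f : QPt F D → Cq} (hf : ∀ x y, x.lab = y.lab → f x = f y)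
    (x : QPt F D) (I N : Submodule F D)
    (hI : LinearMap.range x.t ≤ I) (hN : N ≤ LinearMap.ker x.t) (u : ℕ) (v : Cq)
    (hv : ∀ y : QPt F D, y.t = x.t → finrank F y.W = u → f y = v)
    (Q : Polynomial ℕ)
    (hQ : ∀ (L : Type) [Field L] [Finite L] [Algebra F L],
      Nat.card {U : Submodule L (L ⊗[F] D) //
        I.baseChange L ≤ U ∧ U ≤ N.baseChange L ∧ finrank L U = u} = Q.eval (Nat.card L))
    (hQ₀ : Nat.card {U : Submodule F D // I ≤ U ∧ U ≤ N ∧ finrank F U = u} =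
      Q.eval (Nat.card F)) :
    stratSum QPt.lab f (fun s (L : FinExt F) =>
        Nat.card {y : QPt L.carrier (L.carrier ⊗[F] D) //
          (y.t = x.t.baseChange L.carrier ∧
          I.baseChange L.carrier ≤ y.W ∧ y.W ≤ N.baseChange L.carrier ∧
          finrank L.carrier y.W = u) ∧ y.lab = s}) = v * evq Q := by
  classical
  have := finite_QPt F D
  have (L : FinExt F) := finite_QPt L.carrier (L.carrier ⊗[F] D)
  have hL : ∀ L : FinExt F, Nat.card {y : QPt L.carrier (L.carrier ⊗[F] D) //
          y.t = x.t.baseChange L.carrier ∧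
          I.baseChange L.carrier ≤ y.W ∧ y.W ≤ N.baseChange L.carrier ∧
          finrank L.carrier y.W = u} = Q.eval (Nat.card L.carrier) := fun L => by
    rw [← hQ L.carrier]
    refine QPt.card_fixed_t _ _ _ ?_ ?_ (fun U => finrank L.carrier U = u)
    · exact (range_baseChange' L.carrier x.t).le.trans (Submodule.baseChange_mono _ hI)
    · exact (Submodule.baseChange_mono _ hN).trans (ker_baseChange' L.carrier x.t).ge
  refine stratSum_eq hf (fun y => y.t = x.t ∧ I ≤ y.W ∧ y.W ≤ N ∧
      finrank F y.W = u) (fun _ => True) v (fun y hy _ => hv y hy.1 hy.2.2.2)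
    (fun y _ h => absurd trivial h)
    (Y := fun L => QPt L.carrier (L.carrier ⊗[F] D)) (fun L y => y.lab)
    (fun L y => y.t = x.t.baseChange L.carrier ∧
      I.baseChange L.carrier ≤ y.W ∧ y.W ≤ N.baseChange L.carrier ∧ finrank L.carrier y.W = u)
    (fun s L => rfl) (fun s => if s = (u, finrank F (LinearMap.range x.t)) then Q else 0)
    (fun s L => ?_) (fun s => ?_) Q (fun L => ?_)
  · have hlab : ∀ y : QPt L.carrier (L.carrier ⊗[F] D), y.t = x.t.baseChange L.carrier →
        finrank L.carrier y.W = u → y.lab = (u, finrank F (LinearMap.range x.t)) := by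
      intro y h1 h2
      rw [QPt.lab, h2, h1, range_baseChange', finrank_baseChange_submodule]
    split_ifs with hs
    · rw [← hL]
      refine card_eq_of_iff fun y => and_iff_left_of_imp fun h => ?_
      rw [hs, hlab y h.1 h.2.2.2]
    · rw [Polynomial.eval_zero]
      refine card_eq_zero_of_forall fun y h => hs ?_
      rw [← h.2, hlab y h.1.1 h.1.2.2.2]
  · have hlab : ∀ y : QPt F D, y.t = x.t →
        finrank F y.W = u → y.lab = (u, finrank F (LinearMap.range x.t)) := by
      intro y h1 h2
      rw [QPt.lab, h2, h1]
    split_ifs with hs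
    · rw [← hQ₀, ← QPt.card_fixed_t x.t I N hI hN (fun U => finrank F U = u)]
      refine card_eq_of_iff fun y => and_iff_left_of_imp fun h => ?_
      rw [hs, hlab y h.1 h.2.2.2]
    · rw [Polynomial.eval_zero]
      refine card_eq_zero_of_forall fun y h => hs ?_
      rw [← h.2, hlab y h.1.1 h.1.2.2.2]
  · rw [← hL]
    exact card_eq_of_iff fun y => and_iff_left trivial

theorem actM_E_apply {f : QPt F D → Cq} (hf : ∀ x y, x.lab = y.lab → f x = f y)
    (x : QPt F D) (v : Cq)
    (hv : ∀ y : QPt F D, y.t = x.t → finrank F y.W = finrank F x.W + 1 → f y = v) :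
    actM .E f x = qint ((finrank F (LinearMap.ker x.t) : ℤ) - finrank F x.W) * v := by
  have hle := Submodule.finrank_mono x.le_ker
  have h := stratSum_fixed_t hf x x.W (LinearMap.ker x.t) x.range_le le_rfl
    (finrank F x.W + 1) v hv (projPoly (finrank F (LinearMap.ker x.t) - finrank F x.W))
    (fun L _ _ _ => by
      have := card_interval_succ (Submodule.baseChange_mono L x.le_ker)
      simpa only [finrank_baseChange_submodule] using this) (card_interval_succ x.le_ker)
  have h2 := evq_projPoly (finrank F (LinearMap.ker x.t) - finrank F x.W)
  rw [Nat.cast_sub hle] at h2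
  rw [← h2, mul_assoc, mul_comm (evq _), ← h, actM]
  congr 2
  funext s L
  refine card_eq_of_iff fun y => ⟨?_, ?_⟩
  · rintro ⟨h1, h3, h4, h5⟩
    refine ⟨⟨h1, h3, ?_, h4⟩, h5⟩
    rw [← ker_baseChange', ← h1]
    exact y.le_ker
  · rintro ⟨⟨h1, h3, h3', h4⟩, h5⟩
    exact ⟨h1, h3, h4, h5⟩

theorem actM_F_apply {f : QPt F D → Cq} (hf : ∀ x y, x.lab = y.lab → f x = f y)
    (x : QPt F D) (v : Cq)
    (hv : ∀ y : QPt F D, y.t = x.t → finrank F y.W + 1 = finrank F x.W → f y = v) :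
    actM .F f x = qint ((finrank F x.W : ℤ) - finrank F (LinearMap.range x.t)) * v := by
  have hle := Submodule.finrank_mono x.range_le
  rcases Nat.eq_zero_or_pos (finrank F x.W) with h0 | h0
  · have h1 : finrank F (LinearMap.range x.t) = 0 := by omega
    rw [h1, h0, sub_self, qint_zero, zero_mul, actM]
    have : stratSum QPt.lab f (fun s (L : FinExt F) =>
        Nat.card {y : QPt L.carrier (L.carrier ⊗[F] D) // y.t = x.t.baseChange L.carrier ∧
          y.W ≤ x.W.baseChange L.carrier ∧ finrank L.carrier y.W + 1 = finrank F x.W ∧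
          y.lab = s}) = 0 := by
      rw [stratSum]
      refine finsum_eq_zero_of_forall_eq_zero fun s => ?_
      rw [chi_eq_evq F (P := 0), evq_zero, mul_zero]
      intro L
      rw [Polynomial.eval_zero]
      refine card_eq_zero_of_forall fun y hy => ?_
      have := hy.2.2.1
      omega
    rw [this, mul_zero]
  have h := stratSum_fixed_t hf x (LinearMap.range x.t) x.W le_rfl x.le_ker
    (finrank F x.W - 1) v (fun y h1 h3 => hv y h1 (by omega))
    (projPoly (finrank F x.W - finrank F (LinearMap.range x.t)))
    (fun L _ _ _ => by
      have := card_interval_pred (Submodule.baseChange_mono L x.range_le)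
      simp only [finrank_baseChange_submodule] at this
      rw [← this]
      exact card_eq_of_iff fun U => by
        rw [show finrank L U = finrank F x.W - 1 ↔ finrank L U + 1 = finrank F x.W by omega])
    (by
      rw [← card_interval_pred x.range_le]
      exact card_eq_of_iff fun U => by
        rw [show finrank F U = finrank F x.W - 1 ↔ finrank F U + 1 = finrank F x.W by omega])
  have h2 := evq_projPoly (finrank F x.W - finrank F (LinearMap.range x.t))
  rw [Nat.cast_sub hle] at h2
  rw [← h2, mul_assoc, mul_comm (evq _), ← h, actM]
  congr 2
  funext s L
  refine card_eq_of_iff fun y => ⟨?_, ?_⟩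
  · rintro ⟨h1, h3, h4, h5⟩
    refine ⟨⟨h1, ?_, h3, by omega⟩, h5⟩
    rw [← range_baseChange', ← h1]
    exact y.range_le
  · rintro ⟨⟨h1, h3, h3', h4⟩, h5⟩
    exact ⟨h1, h3', by omega, h5⟩

end

end

noncomputable section

open Module

/-! ### The fibres of `T(𝐝) → M(d)` -/

section

variable {k : ℕ} {d : Fin k → ℕ}

theorem card_fibre_eq_card_flags {L V : Type} [Field L] [AddCommGroup V] [Module L V]
    [FiniteDimensional L V] (x : QPt L V) {m : ℕ} (C : Fin m → Submodule L V)
    (n : Fin m → Fin k → ℕ) :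
    Nat.card {y : TPt L V d // (y.W = x.W ∧ y.t = x.t) ∧ ∀ j, alpha y.flag (C j) = n j} =
      Nat.card {φ : Fin (k + 1) → Submodule L V //
        FlagCond x.t C ⊤ (psum d) (fun i j => psum (n j) i) φ} := by
  refine Nat.card_congr ⟨fun y => ⟨y.1.flag, y.1.flag_zero, y.1.flag_last, y.1.flag_le, ?_,
    finrank_flag y.1, ?_⟩, fun φ => ⟨⟨x, φ.1, φ.2.1, φ.2.2.1, φ.2.2.2.1, ?_, φ.2.2.2.2.1⟩,
    ⟨rfl, rfl⟩, ?_⟩, ?_, ?_⟩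
  · exact fun i => (congrArg (Submodule.map · _) y.2.1.2).ge.trans (y.1.stable i)
  · intro i j
    exact (alpha_eq_iff y.1.flag_zero y.1.flag_le _ _).1 (y.2.2 j) i
  · intro i
    rw [φ.2.2.2.2.2.1, φ.2.2.2.2.2.1, psum_succ]
  · intro j
    exact (alpha_eq_iff φ.2.1 φ.2.2.2.1 _ _).2 fun i => φ.2.2.2.2.2.2 i j
  · rintro ⟨y, ⟨h1, h2⟩, h3⟩
    ext1
    exact TPt.eq_of h1.symm h2.symm rfl
  · rintro ⟨φ, h⟩
    rfl

theorem exists_fibre_count (d : Fin k → ℕ) {m : ℕ} (n : Fin (m + 1) → Fin k → ℕ)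
    (a : Fin (m + 1) → ℕ) :
    ∃ P : Polynomial ℕ, ∀ (L V : Type) [Field L] [AddCommGroup V] [Module L V] [Finite L]
      [FiniteDimensional L V] (x : QPt L V) (C : Fin (m + 1) → Submodule L V), Monotone C →
      LinearMap.range x.t ≤ C 0 → C (Fin.last m) = LinearMap.ker x.t → finrank L V = ∑ i, d i →
      (∀ j, finrank L (C j) = a j) →
      Nat.card {y : TPt L V d // (y.W = x.W ∧ y.t = x.t) ∧ ∀ j, alpha y.flag (C j) = n j} =
        P.eval (Nat.card L) := by
  by_cases h : ∀ j, a j = ∑ i, n j i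
  · obtain ⟨P, hP⟩ := exists_flag_count (psum d) (fun i j => psum (n j) i)
    refine ⟨P, fun L V _ _ _ _ _ x C hC hC0 hCm hV hCa => ?_⟩
    rw [card_fibre_eq_card_flags]
    refine hP L V x.t C ⊤ hC hC0 hCm le_top ?_ ?_
    · rw [finrank_top, hV, psum_last]
    · intro j
      rw [inf_top_eq, hCa, h, psum_last]
  · refine ⟨0, fun L V _ _ _ _ _ x C hC hC0 hCm hV hCa => ?_⟩
    rw [Polynomial.eval_zero]
    refine card_eq_zero_of_forall fun y hy => h fun j => ?_
    rw [← hCa, ← hy.2 j, sum_alpha]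

theorem exists_stratum_fibre_count (d : Fin k → ℕ) (s : (Fin k → ℕ) × (Fin k → ℕ) × (Fin k → ℕ))
    (r w n : ℕ) :
    ∃ P : Polynomial ℕ, ∀ (L V : Type) [Field L] [AddCommGroup V] [Module L V] [Finite L]
      [FiniteDimensional L V] (x : QPt L V), finrank L V = ∑ i, d i →
      finrank L (LinearMap.range x.t) = r → finrank L x.W = w →
      finrank L (LinearMap.ker x.t) = n →
      Nat.card {y : TPt L V d // (y.W = x.W ∧ y.t = x.t) ∧ y.lab = s} = P.eval (Nat.card L) := by
  -- The three labels are the positions of the flag relative to the chain `im t ≤ W ≤ ker t`.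
  obtain ⟨P, hP⟩ := exists_fibre_count d ![s.2.1, s.1, s.2.2] ![r, w, n]
  refine ⟨P, fun L V _ _ _ _ _ x hV hr hw hn => ?_⟩
  rw [← hP L V x ![LinearMap.range x.t, x.W, LinearMap.ker x.t] ?_ le_rfl rfl hV ?_]
  · refine card_eq_of_iff fun y => and_congr_right fun hy => ?_
    simp only [Fin.forall_fin_succ, Matrix.cons_val_zero, Matrix.cons_val_succ, TPt.lab,
      Prod.ext_iff, ← hy.1, ← hy.2, IsEmpty.forall_iff, and_true]
    tauto
  · rw [Fin.monotone_iff_le_succ]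
    intro i
    fin_cases i
    · exact x.range_le
    · exact x.le_ker
  · intro j
    fin_cases j
    · exact hr
    · exact hw
    · exact hn

/-- The number of flags of type `d` that are compatible with `t` and such that
`α(ker t, 𝐃) = n` is a polynomial in the number of elements of the field. -/
theorem exists_flagPoly (d n : Fin k → ℕ) :
    ∃ P : Polynomial ℕ, ∀ (L V : Type) [Field L] [AddCommGroup V] [Module L V] [Finite L]
      [FiniteDimensional L V] (x : QPt L V), finrank L V = ∑ i, d i →
      finrank L (LinearMap.ker x.t) = ∑ i, n i →
      Nat.card {y : TPt L V d // (y.W = x.W ∧ y.t = x.t) ∧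
        alpha y.flag (LinearMap.ker y.t) = n} = P.eval (Nat.card L) := by
  obtain ⟨P, hP⟩ := exists_fibre_count d (m := 0) (fun _ => n) (fun _ => ∑ i, n i)
  refine ⟨P, fun L V _ _ _ _ _ x hV hn => ?_⟩
  rw [← hP L V x (fun _ => LinearMap.ker x.t) monotone_const (x.range_le.trans x.le_ker) rfl hV
    (fun _ => hn)]
  refine card_eq_of_iff fun y => and_congr_right fun hy => ?_
  rw [← hy.2]
  exact ⟨fun h _ => h, fun h => h 0⟩

/-- The polynomial of `exists_flagPoly`. -/
def flagPoly (d n : Fin k → ℕ) : Polynomial ℕ := (exists_flagPoly d n).choose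

theorem card_flagPoly (n : Fin k → ℕ) {L V : Type} [Field L] [AddCommGroup V] [Module L V]
    [Finite L] [FiniteDimensional L V] (x : QPt L V) (hV : finrank L V = ∑ i, d i)
    (hn : finrank L (LinearMap.ker x.t) = ∑ i, n i) :
    Nat.card {y : TPt L V d // (y.W = x.W ∧ y.t = x.t) ∧
      alpha y.flag (LinearMap.ker y.t) = n} = (flagPoly d n).eval (Nat.card L) :=
  (exists_flagPoly d n).choose_spec L V x hV hn

/-- One point over one finite field suffices, as the polynomial does not depend on the field. -/
theorem flagPoly_ne_zero {L V : Type} [Field L] [AddCommGroup V] [Module L V]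
    [Finite L] [FiniteDimensional L V] (y : TPt L V d) :
    flagPoly d (alpha y.flag (LinearMap.ker y.t)) ≠ 0 := by
  intro h
  have := finite_TPt L V d
  have h1 := card_flagPoly (d := d) (alpha y.flag (LinearMap.ker y.t)) y.toQPt (finrank_eq_sum y)
    (sum_alpha y _).symm
  rw [h, Polynomial.eval_zero, Nat.card_eq_zero] at h1
  rcases h1 with h1 | h1
  · exact h1.false ⟨y, ⟨rfl, rfl⟩, rfl⟩
  · exact (not_finite_iff_infinite.2 h1) inferInstance

variable {F D : Type} [Field F] [Finite F] [AddCommGroup D] [Module F D] [FiniteDimensional F D]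

/-- Base change of points of `M(d)`. -/
def QPt.baseChange (L : Type) [Field L] [Algebra F L] (x : QPt F D) : QPt L (L ⊗[F] D) where
  W := x.W.baseChange L
  t := x.t.baseChange L
  range_le := by
    rw [range_baseChange']
    exact Submodule.baseChange_mono L x.range_le
  le_ker := by
    rw [ker_baseChange']
    exact Submodule.baseChange_mono L x.le_ker

/-- The set in question is the union of the strata whose third label is `n`, which is the predicate
needed in `stratSum_eq`; outside it the indicator makes the function vanish. -/
theorem TY_apply_aux {f : TPt F D d → Cq} (hf : ∀ x y, x.lab = y.lab → f x = f y)
    (hD : finrank F D = ∑ i, d i) (n : Fin k → ℕ) (x : QPt F D) (v : Cq)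
    (hv : ∀ y : TPt F D d, y.W = x.W → y.t = x.t → alpha y.flag (LinearMap.ker y.t) = n → f y = v)
    (Q : Polynomial ℕ)
    (hQ : ∀ L : FinExt F, Nat.card {y : TPt L.carrier (L.carrier ⊗[F] D) d //
      (y.W = x.W.baseChange L.carrier ∧ y.t = x.t.baseChange L.carrier) ∧
        alpha y.flag (LinearMap.ker y.t) = n} = Q.eval (Nat.card L.carrier)) :
    TY {y : TPt F D d | alpha y.flag (LinearMap.ker y.t) = n} f x = v * evq Q := by
  classical
  have := finite_TPt F D d
  have (L : FinExt F) := finite_TPt L.carrier (L.carrier ⊗[F] D) d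
  choose P hP using fun s => exists_stratum_fibre_count d s (finrank F (LinearMap.range x.t))
    (finrank F x.W) (finrank F (LinearMap.ker x.t))
  have hmem : ∀ y : TPt F D d, y ∈ {y : TPt F D d | alpha y.flag (LinearMap.ker y.t) = n} ↔
    y.lab.2.2 = n := fun y => Iff.rfl
  refine stratSum_eq ?_ (fun y => y.W = x.W ∧ y.t = x.t) (fun s => s.2.2 = n) v ?_ ?_
    (Y := fun L => TPt L.carrier (L.carrier ⊗[F] D) d) (fun L y => y.lab)
    (fun L y => y.W = x.W.baseChange L.carrier ∧ y.t = x.t.baseChange L.carrier)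
    (fun s L => card_eq_of_iff fun y => and_assoc.symm) P (fun s L => ?_) (fun s => ?_) Q hQ
  · intro y z h
    rw [Set.indicator_apply, Set.indicator_apply, hf y z h]
    simp only [hmem, h]
  · intro y hy h
    rw [Set.indicator_of_mem ((hmem y).2 h), hv y hy.1 hy.2 h]
  · intro y hy h
    rw [Set.indicator_of_notMem (mt (hmem y).1 h)]
  · refine hP s L.carrier _ (x.baseChange L.carrier) ?_ ?_ ?_ ?_
    · rw [Module.finrank_baseChange, hD]
    · exact finrank_range_baseChange L.carrier x.t
    · exact finrank_baseChange_submodule _ _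
    · exact finrank_ker_baseChange L.carrier x.t
  · exact hP s F D x hD rfl rfl rfl

theorem TY_apply {f : TPt F D d → Cq} (hf : ∀ x y, x.lab = y.lab → f x = f y)
    (hD : finrank F D = ∑ i, d i) (n : Fin k → ℕ) (x : QPt F D)
    (hn : finrank F (LinearMap.ker x.t) = ∑ i, n i) (v : Cq)
    (hv : ∀ y : TPt F D d, y.W = x.W → y.t = x.t → alpha y.flag (LinearMap.ker y.t) = n →
      f y = v) :
    TY {y : TPt F D d | alpha y.flag (LinearMap.ker y.t) = n} f x = v * evq (flagPoly d n) := by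
  refine TY_apply_aux hf hD n x v hv _ fun L => ?_
  refine card_flagPoly n (x.baseChange L.carrier) ?_ ?_
  · rw [Module.finrank_baseChange, hD]
  · exact (finrank_ker_baseChange L.carrier x.t).trans hn

theorem TY_apply_of_ne {f : TPt F D d → Cq} (hf : ∀ x y, x.lab = y.lab → f x = f y)
    (hD : finrank F D = ∑ i, d i) (n : Fin k → ℕ) (x : QPt F D)
    (hn : finrank F (LinearMap.ker x.t) ≠ ∑ i, n i) :
    TY {y : TPt F D d | alpha y.flag (LinearMap.ker y.t) = n} f x = 0 := by
  rw [TY_apply_aux hf hD n x 0 ?_ 0 ?_, evq_zero, mul_zero]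
  · rintro y h1 h2 rfl
    rw [sum_alpha, h2] at hn
    exact absurd rfl hn
  · intro L
    rw [Polynomial.eval_zero]
    refine card_eq_zero_of_forall ?_
    rintro y ⟨⟨h1, h2⟩, rfl⟩
    rw [sum_alpha, h2, ker_baseChange', finrank_baseChange_submodule] at hn
    exact hn rfl

end

end

noncomputable section

/-! ### Combinatorics of lower crossingless matches -/

section

variable {k : ℕ} {d : Fin k → ℕ}

theorem Vtx.lt_of_box_lt {u v : Vtx d} (h : u.box < v.box) : u < v :=
  Sigma.Lex.lt_def.2 (Or.inl h)

theorem Vtx.box_le_of_lt {u v : Vtx d} (h : u < v) : u.box ≤ v.box := by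
  rcases Sigma.Lex.lt_def.1 h with h | ⟨h, -⟩
  · exact h.le
  · exact h.le

theorem Vtx.mk_lt_mk {i : Fin k} {j j' : Fin (d i)} :
    (toLex ⟨i, j⟩ : Vtx d) < toLex ⟨i, j'⟩ ↔ j < j' := by
  rw [Sigma.Lex.lt_def]
  constructor
  · rintro (h | ⟨h, h'⟩)
    · exact absurd h (lt_irrefl _)
    · exact h'
  · exact fun h => Or.inr ⟨rfl, h⟩

theorem Vtx.exists_mk (v : Vtx d) : ∃ j : Fin (d v.box), v = toLex ⟨v.box, j⟩ := ⟨(ofLex v).2, rfl⟩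

theorem Vtx.card_filter (P : Vtx d → Prop) [DecidablePred P] :
    (Finset.univ.filter P).card = ∑ i, Nat.card {j : Fin (d i) // P (toLex ⟨i, j⟩)} := by
  classical
  rw [Finset.card_filter, ← Equiv.sum_comp (toLex : (Σ i, Fin (d i)) ≃ _), Fintype.sum_sigma]
  refine Finset.sum_congr rfl fun i _ => ?_
  rw [Nat.card_eq_fintype_card, Fintype.card_subtype, Finset.card_filter]

theorem Vtx.card_eq : Fintype.card (Vtx d) = ∑ i, d i := by
  have h := Vtx.card_filter (d := d) (fun _ => True)
  rw [Finset.filter_true, Finset.card_univ] at h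
  simp [h]

theorem Fin.mem_lower_iff {m : ℕ} (S : Finset (Fin m)) (hS : ∀ i ∈ S, ∀ j, j < i → j ∈ S)
    (j : Fin m) : j ∈ S ↔ (j : ℕ) < S.card := by
  constructor
  · intro h
    have : Finset.Iic j ⊆ S := by
      intro x hx
      rcases (Finset.mem_Iic.1 hx).lt_or_eq with h' | rfl
      · exact hS j h x h'
      · exact h
    have := Finset.card_le_card this
    rw [Fin.card_Iic] at this
    omega
  · intro h
    by_contra hj
    have : S ⊆ Finset.Iio j := by
      intro x hx
      rw [Finset.mem_Iio]
      by_contra hx'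
      rcases (not_lt.1 hx').lt_or_eq with h' | h'
      · exact hj (hS x hx j h')
      · exact hj (h' ▸ hx)
    have := Finset.card_le_card this
    rw [Fin.card_Iio] at this
    omega

/-- Repeatedly take the largest element that is left. Applied to the unmatched vertices, this
orients the rightmost `m` of them down. -/
theorem exists_upper_subset {α : Type*} [LinearOrder α] (U : Finset α) (m : ℕ) (hm : m ≤ U.card) :
    ∃ T ⊆ U, T.card = m ∧ ∀ u ∈ T, ∀ v ∈ U, v ∉ T → v < u := by
  induction m with
  | zero => exact ⟨∅, Finset.empty_subset _, rfl, by simp⟩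
  | succ m ih =>
    obtain ⟨T, hTU, hT, h⟩ := ih (by omega)
    have hne : (U \ T).Nonempty := by
      rw [← Finset.card_pos, Finset.card_sdiff_of_subset hTU]
      omega
    have hmem := Finset.max'_mem _ hne
    rw [Finset.mem_sdiff] at hmem
    refine ⟨insert ((U \ T).max' hne) T, Finset.insert_subset hmem.1 hTU, ?_, ?_⟩
    · rw [Finset.card_insert_of_notMem hmem.2, hT]
    · intro u hu v hv hvT
      rw [Finset.mem_insert, not_or] at hvT
      rcases Finset.mem_insert.1 hu with rfl | hu
      · exact lt_of_le_of_ne (Finset.le_max' _ _ (Finset.mem_sdiff.2 ⟨hv, hvT.2⟩)) hvT.1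
      · exact h u hu v hv hvT.2

namespace LCM

/-- The right endpoints of the curves. -/
def rights (b : LCM d) : Finset (Vtx d) := b.arcs.image Prod.snd

/-- The left endpoints of the curves. -/
def lefts (b : LCM d) : Finset (Vtx d) := b.arcs.image Prod.fst

theorem mem_rights {b : LCM d} {v : Vtx d} : v ∈ b.rights ↔ ∃ p ∈ b.arcs, p.2 = v := by
  simp [rights]

theorem mem_lefts {b : LCM d} {v : Vtx d} : v ∈ b.lefts ↔ ∃ p ∈ b.arcs, p.1 = v := by
  simp [lefts]

theorem disjoint_lefts_rights (b : LCM d) : Disjoint b.lefts b.rights := by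
  rw [Finset.disjoint_left]
  intro v hl hr
  obtain ⟨p, hp, rfl⟩ := mem_lefts.1 hl
  obtain ⟨p', hp', h⟩ := mem_rights.1 hr
  have := b.disjoint p hp p' hp' (Or.inr (Or.inl h.symm))
  subst this
  exact (b.box_lt p hp).ne (congrArg Vtx.box h.symm)

theorem fst_injOn (b : LCM d) : Set.InjOn Prod.fst (b.arcs : Set (Vtx d × Vtx d)) :=
  fun p hp p' hp' h => b.disjoint p hp p' hp' (Or.inl h)

theorem snd_injOn (b : LCM d) : Set.InjOn Prod.snd (b.arcs : Set (Vtx d × Vtx d)) :=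
  fun p hp p' hp' h => b.disjoint p hp p' hp' (Or.inr (Or.inr (Or.inr h)))

theorem card_rights (b : LCM d) : b.rights.card = b.r := Finset.card_image_of_injOn b.snd_injOn

theorem card_lefts (b : LCM d) : b.lefts.card = b.r := Finset.card_image_of_injOn b.fst_injOn

theorem unmatched_iff {b : LCM d} {v : Vtx d} : b.Unmatched v ↔ v ∉ b.lefts ∧ v ∉ b.rights := by
  rw [mem_lefts, mem_rights, Unmatched]
  constructor
  · exact fun h => ⟨fun ⟨p, hp, h'⟩ => (h p hp).1 h'.symm, fun ⟨p, hp, h'⟩ => (h p hp).2 h'.symm⟩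
  · exact fun h p hp => ⟨fun h' => h.1 ⟨p, hp, h'.symm⟩, fun h' => h.2 ⟨p, hp, h'.symm⟩⟩

theorem mu_eq_card (b : LCM d) : b.mu = (Finset.univ \ (b.lefts ∪ b.rights)).card := by
  classical
  rw [mu, Nat.card_eq_fintype_card, Fintype.card_subtype]
  congr 1
  ext v
  simp [unmatched_iff]

theorem mu_add_two_mul_r (b : LCM d) : b.mu + 2 * b.r = ∑ i, d i := by
  rw [mu_eq_card, Finset.card_sdiff_of_subset (Finset.subset_univ _), Finset.card_univ, Vtx.card_eq]
  have h1 := Finset.card_union_of_disjoint b.disjoint_lefts_rights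
  have h2 := Finset.card_le_univ (b.lefts ∪ b.rights)
  rw [Vtx.card_eq] at h2
  rw [card_lefts, card_rights] at h1
  omega

theorem n_eq (b : LCM d) (i : Fin k) :
    b.n i = Nat.card {j : Fin (d i) // toLex ⟨i, j⟩ ∉ b.rights} := by
  rw [n]
  refine Nat.card_congr (Equiv.subtypeEquivRight fun j => ?_)
  rw [mem_rights]
  push Not
  rfl

theorem sum_n (b : LCM d) : ∑ i, b.n i = b.mu + b.r := by
  classical
  have h := Vtx.card_filter (d := d) (fun v => v ∉ b.rights)
  simp only [n_eq]
  rw [← h, ← Finset.sdiff_eq_filter, Finset.card_sdiff_of_subset (Finset.subset_univ _),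
    Finset.card_univ, Vtx.card_eq, card_rights, ← mu_add_two_mul_r b]
  omega

/-- The curve that ends at `v` starts in an earlier box, so it passes over `u` and `u` is matched.
If `u` were a left endpoint, its curve would end in a later box and cross the one that ends at `v`.
Hence right endpoints fill an initial segment of each box. -/
theorem rights_lower (b : LCM d) {u v : Vtx d} (hv : v ∈ b.rights) (huv : u < v)
    (hbox : u.box = v.box) : u ∈ b.rights := by
  obtain ⟨p, hp, rfl⟩ := mem_rights.1 hv
  have h1 : p.1 < u := Vtx.lt_of_box_lt (hbox ▸ b.box_lt p hp)
  obtain ⟨p', hp', h | h⟩ := b.covered p hp u h1 huv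
  · exfalso
    refine b.noncrossing p hp p' hp' ⟨h ▸ h1, h ▸ huv, Vtx.lt_of_box_lt ?_⟩
    rw [← hbox, h]
    exact b.box_lt p' hp'
  · exact mem_rights.2 ⟨p', hp', h.symm⟩

theorem mem_rights_mk (b : LCM d) (i : Fin k) (j : Fin (d i)) :
    (toLex ⟨i, j⟩ : Vtx d) ∈ b.rights ↔ (j : ℕ) < d i - b.n i := by
  classical
  have h := Fin.mem_lower_iff (Finset.univ.filter fun j : Fin (d i) => toLex ⟨i, j⟩ ∈ b.rights)
    (fun j hj j' hj' => by
      simp only [Finset.mem_filter, Finset.mem_univ, true_and] at hj ⊢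
      exact b.rights_lower hj (Vtx.mk_lt_mk.2 hj') rfl) j
  have h2 := Finset.card_filter_add_card_filter_not (s := (Finset.univ : Finset (Fin (d i))))
    (fun j : Fin (d i) => (toLex ⟨i, j⟩ : Vtx d) ∈ b.rights)
  have h3 : b.n i = (Finset.univ.filter fun j : Fin (d i) => toLex ⟨i, j⟩ ∉ b.rights).card := by
    rw [n_eq, Nat.card_eq_fintype_card, Fintype.card_subtype]
  rw [Finset.card_univ, Fintype.card_fin] at h2
  simp only [Finset.mem_filter, Finset.mem_univ, true_and] at h
  rw [h]
  omega

/-- If `p` started further left, then `p'.1` would lie below `p` and be matched in `b`. It is no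
right endpoint, since `b` and `b'` have the same ones. So it starts a curve of `b` that by
non-crossing ends before `p.2`, or is `p` itself. A shorter curve also belongs to `b'` and would
share its left endpoint with `p'`. -/
theorem not_fst_lt_fst {b b' : LCM d} (hR : b.rights = b'.rights) {p p' : Vtx d × Vtx d}
    (hp : p ∈ b.arcs) (hp' : p' ∈ b'.arcs) (hpp' : p.2 = p'.2)
    (ih : ∀ p'' ∈ b.arcs, p''.2 < p.2 → p'' ∈ b'.arcs) : ¬ p.1 < p'.1 := by
  intro hlt
  have h1 : p'.1 < p.2 := by
    rw [hpp']
    exact Vtx.lt_of_box_lt (b'.box_lt p' hp')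
  obtain ⟨p'', hp'', h | h⟩ := b.covered p hp p'.1 hlt h1
  · have h2 : ¬ p.2 < p''.2 := fun h3 => b.noncrossing p hp p'' hp'' ⟨h ▸ hlt, h ▸ h1, h3⟩
    rcases (not_lt.1 h2).lt_or_eq with h3 | h3
    · have h4 := ih p'' hp'' h3
      have h5 := b'.disjoint p'' h4 p' hp' (Or.inl h.symm)
      rw [h5, hpp'] at h3
      exact lt_irrefl _ h3
    · have h4 := b.disjoint p'' hp'' p hp (Or.inr (Or.inr (Or.inr h3)))
      rw [h, h4] at hlt
      exact lt_irrefl _ hlt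
  · have h2 : p'.1 ∈ b'.rights := by
      rw [← hR]
      exact mem_rights.2 ⟨p'', hp'', h.symm⟩
    exact Finset.disjoint_left.1 b'.disjoint_lefts_rights (mem_lefts.2 ⟨p', hp', rfl⟩) h2

/-- Strong induction on the right endpoint, with `not_fst_lt_fst` used in both directions. -/
theorem arcs_iff_of_rights_eq {b b' : LCM d} (hR : b.rights = b'.rights) (v : Vtx d) :
    ∀ p : Vtx d × Vtx d, p.2 = v → (p ∈ b.arcs ↔ p ∈ b'.arcs) := by
  induction v using WellFoundedLT.induction with
  | ind v ih =>
    have key : ∀ c c' : LCM d, c.rights = c'.rights →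
        (∀ p : Vtx d × Vtx d, p.2 < v → (p ∈ c.arcs ↔ p ∈ c'.arcs)) →
        ∀ p : Vtx d × Vtx d, p.2 = v → p ∈ c.arcs → p ∈ c'.arcs := by
      rintro c c' hc hcc p rfl hp
      obtain ⟨p', hp', h⟩ := mem_rights.1 (hc ▸ mem_rights.2 ⟨p, hp, rfl⟩ : p.2 ∈ c'.rights)
      have h1 := not_fst_lt_fst hc hp hp' h.symm fun q hq hlt => (hcc q hlt).1 hq
      have h2 := not_fst_lt_fst hc.symm hp' hp h fun q hq hlt => (hcc q (h ▸ hlt)).2 hq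
      have h3 : p = p' := Prod.ext (le_antisymm (not_lt.1 h2) (not_lt.1 h1)) h.symm
      rwa [h3]
    intro p hp
    exact ⟨key b b' hR (fun q hq => ih q.2 hq q rfl) p hp,
      key b' b hR.symm (fun q hq => (ih q.2 hq q rfl).symm) p hp⟩

theorem rights_injective : Function.Injective (rights : LCM d → Finset (Vtx d)) := by
  intro b b' h
  ext p
  exact arcs_iff_of_rights_eq h p.2 p rfl

theorem n_injective : Function.Injective (n : LCM d → Fin k → ℕ) := by
  intro b b' h
  apply rights_injective
  ext v
  obtain ⟨j, hj⟩ := v.exists_mk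
  rw [hj, mem_rights_mk, mem_rights_mk, h]

instance : Finite (LCM d) := Finite.of_injective _ rights_injective

/-- Induction on the size of `R`: match all right endpoints except the last one, `v`, and join `v`
to the rightmost vertex `u` of an earlier box that is still free. The choice of the rightmost `u`
gives the covering condition; non-crossing holds because no older curve can pass over the free
vertex `u`. -/
theorem exists_rights_eq (R : Finset (Vtx d))
    (h1 : ∀ v ∈ R, ∀ u : Vtx d, u.box = v.box → u < v → u ∈ R)
    (h2 : ∀ v ∈ R, (R.filter (· ≤ v)).card ≤
      (Finset.univ.filter fun u : Vtx d => u ∉ R ∧ u.box < v.box).card) :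
    ∃ b : LCM d, b.rights = R := by
  classical
  induction hc : R.card generalizing R with
  | zero =>
    rw [Finset.card_eq_zero] at hc
    subst hc
    exact ⟨⟨∅, by simp, by simp, by simp, by simp⟩, by simp [rights]⟩
  | succ c ih =>
    have hne : R.Nonempty := by rw [← Finset.card_pos]; omega
    obtain ⟨v, hvR, hmax⟩ : ∃ v ∈ R, ∀ x ∈ R, x ≤ v :=
      ⟨R.max' hne, R.max'_mem hne, fun x hx => R.le_max' x hx⟩
    have hcard : (R.erase v).card = c := by rw [Finset.card_erase_of_mem hvR, hc]; omega
    have hex : ∃ b : LCM d, b.rights = R.erase v := by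
      refine ih (R.erase v) ?_ ?_ hcard
      · intro x hx u hu hux
        rw [Finset.mem_erase] at hx ⊢
        exact ⟨(hux.trans_le (hmax x hx.2)).ne, h1 x hx.2 u hu hux⟩
      · intro x hx
        refine (Finset.card_le_card ?_).trans ((h2 x (Finset.mem_of_mem_erase hx)).trans
          (Finset.card_le_card ?_))
        · exact Finset.filter_subset_filter _ (Finset.erase_subset _ _)
        · intro u hu
          simp only [Finset.mem_filter, Finset.mem_univ, true_and, Finset.mem_erase] at hu ⊢
          exact ⟨fun h => hu.1 h.2, hu.2⟩
    obtain ⟨b, hb⟩ := hex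
    have hRb : ∀ x, x ∈ b.rights ↔ x ≠ v ∧ x ∈ R := fun x => by rw [hb, Finset.mem_erase]
    have hv_right : v ∉ b.rights := fun h => ((hRb v).1 h).1 rfl
    have hv_left : v ∉ b.lefts := by
      intro h
      obtain ⟨p, hp, rfl⟩ := mem_lefts.1 h
      have h3 := hmax p.2 ((hRb _).1 (mem_rights.2 ⟨p, hp, rfl⟩)).2
      exact absurd (Vtx.lt_of_box_lt (b.box_lt p hp)) (not_lt.2 h3)
    -- A free vertex exists: at least `c + 1` vertices outside `R` lie in boxes before that of `v`,
    -- and only `c` of them can be left endpoints.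
    obtain ⟨u, ⟨hur, hul, huv⟩, humax⟩ : ∃ u, (u ∉ R ∧ u ∉ b.lefts ∧ u.box < v.box) ∧
        ∀ x : Vtx d, x ∉ R → x ∉ b.lefts → x.box < v.box → x ≤ u := by
      have hne' : (Finset.univ.filter fun u : Vtx d =>
          u ∉ R ∧ u ∉ b.lefts ∧ u.box < v.box).Nonempty := by
        by_contra hempty
        rw [Finset.not_nonempty_iff_eq_empty, Finset.filter_eq_empty_iff] at hempty
        have h3 : (Finset.univ.filter fun u : Vtx d => u ∉ R ∧ u.box < v.box) ⊆ b.lefts := by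
          intro x hx
          simp only [Finset.mem_filter, Finset.mem_univ, true_and] at hx
          by_contra hx'
          exact hempty (Finset.mem_univ x) ⟨hx.1, hx', hx.2⟩
        have h4 := Finset.card_le_card h3
        have h5 := h2 v hvR
        rw [Finset.filter_true_of_mem hmax, hc] at h5
        rw [card_lefts, ← card_rights, hb, hcard] at h4
        omega
      refine ⟨_, by simpa using Finset.max'_mem _ hne', fun x hx1 hx2 hx3 => ?_⟩
      exact Finset.le_max' _ _ (by simp [hx1, hx2, hx3])
    have hu_right : u ∉ b.rights := fun h => hur ((hRb u).1 h).2
    have huv' : u < v := Vtx.lt_of_box_lt huv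
    have hlv : ∀ p ∈ b.arcs, p.2 < v := fun p hp => by
      have h3 := (hRb p.2).1 (mem_rights.2 ⟨p, hp, rfl⟩)
      exact lt_of_le_of_ne (hmax _ h3.2) h3.1
    have hum := unmatched_iff.2 ⟨hul, hu_right⟩
    have hvm := unmatched_iff.2 ⟨hv_left, hv_right⟩
    have hold : ∀ p ∈ b.arcs, ¬ (u = p.1 ∨ u = p.2 ∨ v = p.1 ∨ v = p.2) := by
      rintro p hp (h | h | h | h)
      · exact (hum p hp).1 h
      · exact (hum p hp).2 h
      · exact (hvm p hp).1 h
      · exact (hvm p hp).2 h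
    refine ⟨⟨insert (u, v) b.arcs, ?_, ?_, ?_, ?_⟩, ?_⟩
    · intro p hp
      rcases Finset.mem_insert.1 hp with rfl | hp
      · exact huv
      · exact b.box_lt p hp
    · intro p hp p' hp' h
      rcases Finset.mem_insert.1 hp with rfl | hp <;> rcases Finset.mem_insert.1 hp' with rfl | hp'
      · rfl
      · exact absurd (by tauto) (hold p' hp')
      · exact absurd (by simp only [eq_comm] at h ⊢; tauto) (hold p hp)
      · exact b.disjoint p hp p' hp' h
    · rintro p hp p' hp' ⟨g1, g2, g3⟩
      rcases Finset.mem_insert.1 hp with rfl | hp <;> rcases Finset.mem_insert.1 hp' with rfl | hp'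
      · exact lt_irrefl _ g1
      · exact absurd g3 (hlv p' hp').le.not_gt
      -- An old curve that crosses the new one passes over `u`, which is unmatched in `b`.
      · obtain ⟨q, hq, h | h⟩ := b.covered p hp u g1 g2
        · exact (hum q hq).1 h
        · exact (hum q hq).2 h
      · exact b.noncrossing p hp p' hp' ⟨g1, g2, g3⟩
    · intro p hp x g1 g2
      rcases Finset.mem_insert.1 hp with rfl | hp
      · have hx : ¬ b.Unmatched x := by
          rw [unmatched_iff]
          rintro ⟨hx1, hx2⟩
          rw [hRb] at hx2
          have hxR : x ∉ R := fun h => hx2 ⟨g2.ne, h⟩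
          -- An unmatched `x` below the new curve contradicts the choice of `u` if its box is
          -- earlier than that of `v`; in the box of `v` it would belong to the initial segment `R`.
          rcases (Vtx.box_le_of_lt g2).lt_or_eq with h | h
          · exact absurd g1 (humax x hxR hx1 h).not_gt
          · exact hxR (h1 v hvR x h g2)
        rw [Unmatched] at hx
        push Not at hx
        obtain ⟨q, hq, hq'⟩ := hx
        refine ⟨q, Finset.mem_insert_of_mem hq, ?_⟩
        by_cases h : x = q.1
        · exact Or.inl h
        · exact Or.inr (hq' h)
      · obtain ⟨q, hq, h⟩ := b.covered p hp x g1 g2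
        exact ⟨q, Finset.mem_insert_of_mem hq, h⟩
    · have : (insert (u, v) b.arcs).image Prod.snd = insert v b.rights := by
        rw [Finset.image_insert]; rfl
      rw [rights, this, hb, Finset.insert_erase hvR]

/-- Every ballot sequence comes from a lower crossingless match. -/
theorem exists_n_eq (α : Fin k → ℕ) (hα : ∀ i, α i ≤ d i)
    (h : ∀ i : Fin k, psum (fun j => d j - α j) i.succ ≤ psum α i.castSucc) :
    ∃ b : LCM d, b.n = α := by
  classical
  -- By `rights_lower`, the right endpoints have to be the first `d i - α i` vertices of each box.
  let R : Finset (Vtx d) :=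
    Finset.univ.filter fun v => ((ofLex v).2 : ℕ) < d (ofLex v).1 - α (ofLex v).1
  have hR : ∀ (i : Fin k) (j : Fin (d i)),
      (toLex ⟨i, j⟩ : Vtx d) ∈ R ↔ (j : ℕ) < d i - α i := by
    intro i j
    simp [R]
  have hcount : ∀ i, Nat.card {j : Fin (d i) // (j : ℕ) < d i - α i} = d i - α i := by
    intro i
    rw [Nat.card_eq_fintype_card, Fintype.card_subtype]
    have : (Finset.univ.filter fun j : Fin (d i) => (j : ℕ) < d i - α i) =
        (Finset.univ.filter fun j : Fin (d i) => j.1 < d i - α i) := rfl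
    rw [Fin.card_filter_val_lt]
    omega
  have hcount' : ∀ i, Nat.card {j : Fin (d i) // ¬ (j : ℕ) < d i - α i} = α i := by
    intro i
    have h2 := Finset.card_filter_add_card_filter_not (s := (Finset.univ : Finset (Fin (d i))))
      (fun j : Fin (d i) => (j : ℕ) < d i - α i)
    have h3 := hcount i
    rw [Nat.card_eq_fintype_card, Fintype.card_subtype] at h3 ⊢
    rw [Finset.card_univ, Fintype.card_fin] at h2
    have := hα i
    omega
  have hex : ∃ b : LCM d, b.rights = R := by
    refine exists_rights_eq R ?_ ?_
    · intro v hv u hu huv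
      obtain ⟨i, j, rfl⟩ : ∃ i j, v = toLex ⟨i, j⟩ := ⟨v.box, v.exists_mk⟩
      obtain ⟨i', j', rfl⟩ : ∃ i j, u = toLex ⟨i, j⟩ := ⟨u.box, u.exists_mk⟩
      obtain rfl : i' = i := hu
      rw [hR] at hv ⊢
      rw [Vtx.mk_lt_mk] at huv
      exact lt_trans huv hv
    · intro v hv
      have h3 : (R.filter (· ≤ v)).card ≤ psum (fun j => d j - α j) v.box.succ := by
        refine (Finset.card_le_card (t := Finset.univ.filter fun u : Vtx d =>
          u ∈ R ∧ u.box ≤ v.box) ?_).trans ?_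
        · intro u hu
          simp only [Finset.mem_filter, Finset.mem_univ, true_and] at hu ⊢
          refine ⟨hu.1, ?_⟩
          rcases hu.2.lt_or_eq with h' | rfl
          · exact Vtx.box_le_of_lt h'
          · exact le_rfl
        · rw [Vtx.card_filter, psum, Finset.sum_filter]
          refine Finset.sum_le_sum fun i _ => ?_
          split_ifs with hi
          · rw [← hcount i]
            refine Nat.card_mono (Set.toFinite _) fun j hj => (hR i j).1 hj.1
          · rw [card_eq_zero_of_forall]
            rintro j ⟨-, hj⟩
            refine hi ?_
            rw [Fin.lt_def]
            have : i.val ≤ v.box.val := hj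
            simp only [Fin.val_castSucc, Fin.val_succ]
            omega
      have h4 : psum α v.box.castSucc ≤
          (Finset.univ.filter fun u : Vtx d => u ∉ R ∧ u.box < v.box).card := by
        rw [Vtx.card_filter, psum, Finset.sum_filter]
        refine Finset.sum_le_sum fun i _ => ?_
        split_ifs with hi
        · rw [← hcount' i]
          refine Nat.card_mono (Set.toFinite _) fun j hj => ⟨mt (hR i j).1 hj, ?_⟩
          exact Fin.castSucc_lt_castSucc_iff.1 hi
        · exact Nat.zero_le _
      exact h3.trans ((h _).trans h4)
  obtain ⟨b, hb⟩ := hex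
  refine ⟨b, funext fun i => ?_⟩
  rw [n_eq, hb, ← hcount' i]
  exact card_eq_of_iff fun j => by rw [hR]

end LCM

namespace OLCM

theorem lefts_subset (a : OLCM d) : a.lefts ⊆ a.down := by
  intro v hv
  obtain ⟨p, hp, rfl⟩ := LCM.mem_lefts.1 hv
  exact a.left_down p hp

theorem not_mem_rights (a : OLCM d) {v : Vtx d} (hv : v ∈ a.down) : v ∉ a.rights := by
  intro h
  obtain ⟨p, hp, rfl⟩ := LCM.mem_rights.1 h
  exact a.right_up p hp hv

theorem r_le_card_down (a : OLCM d) : a.r ≤ a.down.card := by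
  rw [← LCM.card_lefts]
  exact Finset.card_le_card a.lefts_subset

theorem card_down_le (a : OLCM d) : a.down.card ≤ a.r + a.mu := by
  have h1 : a.down ⊆ Finset.univ \ a.rights := fun v hv => by
    simpa using a.not_mem_rights hv
  have h2 := Finset.card_le_card h1
  rw [Finset.card_sdiff_of_subset (Finset.subset_univ _), Finset.card_univ, Vtx.card_eq,
    LCM.card_rights, ← LCM.mu_add_two_mul_r a.toLCM] at h2
  omega

/-- Otherwise, by cardinality, each of the two matches has a down arrow that is up in the other one.
Both vertices are unmatched, and the two order conditions contradict each other. -/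
theorem down_subset {a a' : OLCM d} (h : a.toLCM = a'.toLCM) (hc : a.down.card = a'.down.card) :
    a.down ⊆ a'.down := by
  intro u hu
  by_contra hu'
  obtain ⟨v, hv', hv⟩ : ∃ v ∈ a'.down, v ∉ a.down := by
    by_contra! hcon
    have := Finset.eq_of_subset_of_card_le hcon hc.le
    exact hu' (this ▸ hu)
  have hu1 : a.Unmatched u := LCM.unmatched_iff.2
    ⟨fun h' => hu' (a'.lefts_subset (h ▸ h')), a.not_mem_rights hu⟩
  have hv1 : a'.Unmatched v := LCM.unmatched_iff.2
    ⟨fun h' => hv (a.lefts_subset (h ▸ h')), a'.not_mem_rights hv'⟩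
  have h1 := a.unmatched_order u v hu1 (h ▸ hv1) hu hv
  have h2 := a'.unmatched_order v u hv1 (h ▸ hu1) hv' hu'
  exact lt_asymm h1 h2

theorem eq_of {a a' : OLCM d} (h : a.toLCM = a'.toLCM) (hc : a.down.card = a'.down.card) :
    a = a' := by
  have hd : a.down = a'.down := (down_subset h hc).antisymm (down_subset h.symm hc.symm)
  exact OLCM.ext (congrArg LCM.arcs h) hd

theorem exists_of (b : LCM d) (m : ℕ) (hm : m ≤ b.mu) :
    ∃ a : OLCM d, a.toLCM = b ∧ a.down.card = b.r + m := by
  rw [LCM.mu_eq_card] at hm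
  obtain ⟨T, hTU, hT, h⟩ := exists_upper_subset _ m hm
  have hT' : ∀ v ∈ T, v ∉ b.lefts ∧ v ∉ b.rights := fun v hv => by
    have := hTU hv
    simpa using this
  have hdown : ∀ v, b.Unmatched v → (v ∈ b.lefts ∪ T ↔ v ∈ T) := fun v hv => by
    rw [Finset.mem_union]
    exact or_iff_right (LCM.unmatched_iff.1 hv).1
  refine ⟨⟨b, b.lefts ∪ T, ?_, ?_, ?_⟩, rfl, ?_⟩
  · exact fun p hp => Finset.mem_union_left _ (LCM.mem_lefts.2 ⟨p, hp, rfl⟩)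
  · intro p hp h'
    have hr : p.2 ∈ b.rights := LCM.mem_rights.2 ⟨p, hp, rfl⟩
    rcases Finset.mem_union.1 h' with h' | h'
    · exact Finset.disjoint_left.1 b.disjoint_lefts_rights h' hr
    · exact (hT' _ h').2 hr
  · intro u v hu hv hud hvd
    rw [hdown u hu] at hud
    rw [hdown v hv] at hvd
    refine h u hud v ?_ hvd
    have := LCM.unmatched_iff.1 hv
    simpa using this
  · rw [Finset.card_union_of_disjoint, LCM.card_lefts, hT]
    exact Finset.disjoint_left.2 fun v hv hv' => (hT' v hv').1 hv

/-- An oriented lower crossingless match is given by its underlying match `b` and the number, from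
`0` to `μ`, of its unmatched down arrows. -/
def equivSigma : OLCM d ≃ Σ b : LCM d, Fin (b.mu + 1) :=
  Equiv.ofBijective
    (fun a => ⟨a.toLCM, ⟨a.down.card - a.r, by have := a.card_down_le; omega⟩⟩) <| by
    constructor
    · intro a a' h
      rw [Sigma.mk.injEq] at h
      obtain ⟨h1, h2⟩ := h
      refine eq_of h1 ?_
      have h3 := a.r_le_card_down
      have h4 := a'.r_le_card_down
      have h5 : a.down.card - a.r = a'.down.card - a'.r := by
        have := (Fin.heq_ext_iff (by rw [h1])).1 h2
        exact this
      rw [h1] at h5 h3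
      omega
    · rintro ⟨b, j⟩
      obtain ⟨a, rfl, ha⟩ := exists_of b j (by omega)
      refine ⟨a, Sigma.ext rfl (heq_of_eq (Fin.ext ?_))⟩
      simp [ha]

end OLCM

end

end

noncomputable section

open Module

/-! ### Points of `T(𝐝)` that belong to oriented matches -/

section Coordinate

variable {F D ι : Type} [Field F] [AddCommGroup D] [Module F D] (β : Basis ι F D)

/-- The span of a part of a basis. -/
def coordSpan (A : Set ι) : Submodule F D := Submodule.span F (β '' A)

theorem coordSpan_mono {A B : Set ι} (h : A ⊆ B) : coordSpan β A ≤ coordSpan β B :=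
  Submodule.span_mono (Set.image_mono h)

theorem coordSpan_inf (A B : Set ι) : coordSpan β A ⊓ coordSpan β B = coordSpan β (A ∩ B) := by
  ext x
  simp only [coordSpan, Submodule.mem_inf, Basis.mem_span_image, Set.subset_inter_iff]

theorem finrank_coordSpan [Finite ι] (A : Set ι) : finrank F (coordSpan β A) = Nat.card A := by
  classical
  have := Fintype.ofFinite A
  have h : LinearIndependent F (fun a : A => β a) := β.linearIndependent.comp _ Subtype.val_injective
  have h2 := finrank_span_eq_card h
  rw [Nat.card_eq_fintype_card, ← h2, coordSpan, Set.image_eq_range]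

theorem coordSpan_le_iff {A : Set ι} {p : Submodule F D} :
    coordSpan β A ≤ p ↔ ∀ a ∈ A, β a ∈ p := by
  rw [coordSpan, Submodule.span_le, Set.image_subset_iff]
  rfl

theorem mem_coordSpan {A : Set ι} {a : ι} (ha : a ∈ A) : β a ∈ coordSpan β A :=
  Submodule.subset_span ⟨a, ha, rfl⟩

end Coordinate

section

variable {F D : Type} [Field F] [AddCommGroup D] [Module F D] {k : ℕ} {d : Fin k → ℕ}

namespace LCM

/-- The endomorphism that sends the right endpoint of each curve to its left endpoint. -/
def endo (b : LCM d) (β : Basis (Vtx d) F D) : D →ₗ[F] D :=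
  β.constr F fun v => ∑ p ∈ b.arcs with p.2 = v, β p.1

variable (b : LCM d) (β : Basis (Vtx d) F D)

theorem endo_apply_of_mem {p : Vtx d × Vtx d} (hp : p ∈ b.arcs) : b.endo β (β p.2) = β p.1 := by
  rw [endo, Basis.constr_basis, Finset.sum_eq_single p]
  · intro p' hp' hne
    rw [Finset.mem_filter] at hp'
    exact absurd (b.snd_injOn hp'.1 hp hp'.2) hne
  · intro h
    exact (h (Finset.mem_filter.2 ⟨hp, rfl⟩)).elim

theorem endo_apply_of_not_mem {v : Vtx d} (hv : v ∉ b.rights) : b.endo β (β v) = 0 := by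
  rw [endo, Basis.constr_basis, Finset.sum_eq_zero]
  intro p hp
  rw [Finset.mem_filter] at hp
  exact absurd (mem_rights.2 ⟨p, hp⟩) hv

theorem range_endo : LinearMap.range (b.endo β) = coordSpan β {v | v ∈ b.lefts} := by
  apply le_antisymm
  · rw [LinearMap.range_eq_map, ← β.span_eq, Submodule.map_span, Submodule.span_le]
    rintro _ ⟨_, ⟨v, rfl⟩, rfl⟩
    by_cases hv : v ∈ b.rights
    · obtain ⟨p, hp, rfl⟩ := mem_rights.1 hv
      rw [endo_apply_of_mem b β hp]
      exact mem_coordSpan β (mem_lefts.2 ⟨p, hp, rfl⟩)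
    · rw [endo_apply_of_not_mem b β hv]
      exact Submodule.zero_mem _
  · rw [coordSpan_le_iff]
    intro v hv
    obtain ⟨p, hp, rfl⟩ := mem_lefts.1 hv
    exact ⟨β p.2, endo_apply_of_mem b β hp⟩

theorem ker_endo [FiniteDimensional F D] :
    LinearMap.ker (b.endo β) = coordSpan β {v | v ∉ b.rights} := by
  symm
  apply Submodule.eq_of_le_of_finrank_eq
  · rw [coordSpan_le_iff]
    exact fun v hv => endo_apply_of_not_mem b β hv
  · have h1 := LinearMap.finrank_range_add_finrank_ker (b.endo β)
    have h2 : Nat.card {v // v ∈ b.rights} + Nat.card {v // v ∉ b.rights} = finrank F D := by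
      classical
      rw [finrank_eq_card_basis β, Nat.card_eq_fintype_card, Nat.card_eq_fintype_card,
        Fintype.card_subtype_compl, Nat.add_sub_cancel']
      exact Fintype.card_subtype_le _
    have h3 : Nat.card {v // v ∈ b.rights} = b.r := by simp [card_rights]
    have h4 : Nat.card {v // v ∈ b.lefts} = b.r := by simp [card_lefts]
    rw [range_endo, finrank_coordSpan] at h1
    rw [finrank_coordSpan]
    change Nat.card {v // v ∈ b.lefts} + _ = _ at h1
    change Nat.card {v // v ∉ b.rights} = _
    omega

end LCM

theorem card_box_lt (P : Vtx d → Prop) (i : Fin (k + 1)) :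
    Nat.card {v : Vtx d // P v ∧ v.box.castSucc < i} =
      psum (fun i => Nat.card {j : Fin (d i) // P (toLex ⟨i, j⟩)}) i := by
  classical
  rw [Nat.card_eq_fintype_card, Fintype.card_subtype, Vtx.card_filter, psum, Finset.sum_filter]
  refine Finset.sum_congr rfl fun i' _ => ?_
  split_ifs with h
  · exact card_eq_of_iff fun j => and_iff_left h
  · exact card_eq_zero_of_forall fun j hj => h hj.2

/-- The point of `T(𝐝)` that is given by an oriented match and a basis of `D`. -/
def OLCM.point [FiniteDimensional F D] (a : OLCM d) (β : Basis (Vtx d) F D) : TPt F D d where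
  W := coordSpan β {v | v ∈ a.down}
  t := a.endo β
  range_le := by
    rw [LCM.range_endo]
    exact coordSpan_mono β fun v hv => a.lefts_subset hv
  le_ker := by
    rw [LCM.ker_endo]
    exact coordSpan_mono β fun v hv => a.not_mem_rights hv
  flag i := coordSpan β {v | v.box.castSucc < i}
  flag_zero := by
    have : {v : Vtx d | v.box.castSucc < 0} = ∅ := by
      ext v
      simp
    rw [this, coordSpan, Set.image_empty, Submodule.span_empty]
  flag_last := by
    have : {v : Vtx d | v.box.castSucc < Fin.last k} = Set.univ := by
      ext v
      simp [Fin.castSucc_lt_last]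
    rw [this, coordSpan, Set.image_univ, β.span_eq]
  flag_le i := coordSpan_mono β fun v (hv : _ < _) => hv.trans i.castSucc_lt_succ
  flag_dim i := by
    have h : ∀ i : Fin (k + 1), Nat.card {v : Vtx d // v.box.castSucc < i} = psum d i := by
      intro i
      have := card_box_lt (d := d) (fun _ => True) i
      simpa using this
    rw [finrank_coordSpan, finrank_coordSpan]
    exact (h _).trans ((psum_succ d i).trans (congrArg (· + d i) (h _).symm))
  stable i := by
    rw [Submodule.map_le_iff_le_comap, coordSpan_le_iff]
    intro v hv
    rw [Submodule.mem_comap]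
    by_cases hr : v ∈ a.rights
    · obtain ⟨p, hp, rfl⟩ := LCM.mem_rights.1 hr
      rw [LCM.endo_apply_of_mem _ β hp]
      refine mem_coordSpan β ?_
      have h1 := a.box_lt p hp
      have h2 : p.2.box.castSucc < i.succ := hv
      rw [Fin.lt_def] at h1 h2
      simp only [Fin.val_castSucc, Fin.val_succ] at h2
      show p.1.box.castSucc < i.castSucc
      rw [Fin.lt_def]
      simp only [Fin.val_castSucc]
      omega
    · rw [LCM.endo_apply_of_not_mem _ β hr]
      exact Submodule.zero_mem _

theorem OLCM.point_finrank [FiniteDimensional F D] (a : OLCM d) (β : Basis (Vtx d) F D) :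
    finrank F (a.point β).W = a.down.card := by
  refine (finrank_coordSpan β _).trans ?_
  change Nat.card {v // v ∈ a.down} = _
  simp

theorem OLCM.point_alpha [FiniteDimensional F D] (a : OLCM d) (β : Basis (Vtx d) F D) :
    alpha (a.point β).flag (LinearMap.ker (a.point β).t) = a.n := by
  rw [alpha_eq_iff (a.point β).flag_zero (a.point β).flag_le]
  intro i
  have h1 : LinearMap.ker (a.point β).t ⊓ (a.point β).flag i =
      coordSpan β {v | v ∉ a.rights ∧ v.box.castSucc < i} := by
    rw [show LinearMap.ker (a.point β).t = _ from LCM.ker_endo _ β]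
    exact coordSpan_inf β _ _
  rw [h1, finrank_coordSpan]
  refine (card_box_lt (fun v => v ∉ a.rights) i).trans ?_
  congr 1
  funext i
  rw [LCM.n_eq]

/-- A basis of `D`, indexed by the vertices. -/
def vtxBasis [FiniteDimensional F D] (hD : finrank F D = ∑ i, d i) : Basis (Vtx d) F D :=
  (Module.finBasisOfFinrankEq F D (hD.trans Vtx.card_eq.symm)).reindex (Fintype.equivFin _).symm

/-! ### The match of a point of `T(𝐝)` -/

section

variable [FiniteDimensional F D]

theorem TPt.alpha_ker_le (x : TPt F D d) (i : Fin k) :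
    alpha x.flag (LinearMap.ker x.t) i ≤ d i := by
  have h1 := Submodule.finrank_sup_add_finrank_inf_eq
    (LinearMap.ker x.t ⊓ x.flag i.succ) (x.flag i.castSucc)
  have h2 : (LinearMap.ker x.t ⊓ x.flag i.succ) ⊓ x.flag i.castSucc =
      LinearMap.ker x.t ⊓ x.flag i.castSucc := by
    rw [inf_assoc, inf_eq_right.2 (x.flag_le i)]
  have h3 : finrank F ((LinearMap.ker x.t ⊓ x.flag i.succ) ⊔ x.flag i.castSucc :
      Submodule F D) ≤ finrank F (x.flag i.succ) :=
    Submodule.finrank_mono (sup_le inf_le_right (x.flag_le i))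
  rw [x.flag_dim] at h3
  rw [h2] at h1
  rw [alpha]
  omega

/-- The image of `𝐃_i` under `t` lies in `ker t ∩ 𝐃_{i-1}`, and by rank-nullity its dimension is
that of `𝐃_i` minus that of `ker t ∩ 𝐃_i`. -/
theorem TPt.ballot (x : TPt F D d) (i : Fin k) :
    psum (fun j => d j - alpha x.flag (LinearMap.ker x.t) j) i.succ ≤
      psum (alpha x.flag (LinearMap.ker x.t)) i.castSucc := by
  have h1 : psum (fun j => d j - alpha x.flag (LinearMap.ker x.t) j) i.succ +
      psum (alpha x.flag (LinearMap.ker x.t)) i.succ = psum d i.succ := by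
    rw [psum, psum, psum, ← Finset.sum_add_distrib]
    exact Finset.sum_congr rfl fun j _ => Nat.sub_add_cancel (x.alpha_ker_le j)
  have h2 := finrank_map_add x.t (x.flag i.succ)
  have h3 : finrank F ((x.flag i.succ).map x.t) ≤
      finrank F (LinearMap.ker x.t ⊓ x.flag i.castSucc : Submodule F D) :=
    Submodule.finrank_mono (le_inf (LinearMap.map_le_range.trans (x.range_le.trans x.le_ker))
      (x.stable i))
  rw [finrank_inf_flag, finrank_flag] at h2
  rw [finrank_inf_flag] at h3
  omega

theorem TPt.exists_match (x : TPt F D d) :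
    ∃ b : LCM d, b.n = alpha x.flag (LinearMap.ker x.t) :=
  LCM.exists_n_eq _ x.alpha_ker_le x.ballot

/-- The lower crossingless match `b` such that `x` lies in `Y_b`. -/
def TPt.toLCM (x : TPt F D d) : LCM d := x.exists_match.choose

theorem TPt.toLCM_n (x : TPt F D d) : x.toLCM.n = alpha x.flag (LinearMap.ker x.t) :=
  x.exists_match.choose_spec

theorem TPt.toLCM_eq_iff {x : TPt F D d} {b : LCM d} :
    x.toLCM = b ↔ alpha x.flag (LinearMap.ker x.t) = b.n := by
  rw [← x.toLCM_n, LCM.n_injective.eq_iff]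

theorem TPt.finrank_ker (x : TPt F D d) :
    finrank F (LinearMap.ker x.t) = x.toLCM.mu + x.toLCM.r := by
  rw [← sum_alpha x, ← x.toLCM_n, LCM.sum_n]

theorem TPt.finrank_range (x : TPt F D d) : finrank F (LinearMap.range x.t) = x.toLCM.r := by
  have h1 := LinearMap.finrank_range_add_finrank_ker x.t
  rw [x.finrank_ker, finrank_eq_sum x, ← x.toLCM.mu_add_two_mul_r] at h1
  omega

theorem TPt.r_le (x : TPt F D d) : x.toLCM.r ≤ finrank F x.W := by
  rw [← x.finrank_range]
  exact Submodule.finrank_mono x.range_le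

theorem TPt.le_mu_add_r (x : TPt F D d) : finrank F x.W ≤ x.toLCM.mu + x.toLCM.r := by
  rw [← x.finrank_ker]
  exact Submodule.finrank_mono x.le_ker

end

end

/-! ### Coordinates -/

/-- The coordinates of a vector, extended by zero. -/
def vext {μ : ℕ} (v : Fin (μ + 1) → Cq) (m : ℕ) : Cq := if h : m < μ + 1 then v ⟨m, h⟩ else 0

theorem vext_val {μ : ℕ} (v : Fin (μ + 1) → Cq) (j : Fin (μ + 1)) : vext v j = v j := by
  rw [vext, dif_pos j.2]

/-- The shifts `s = 1`, `-1` and `0` serve `E`, `F` and `K^{±1}`. -/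
theorem constr_vvec_apply {μ : ℕ} (c : ℕ → Cq) (s : ℤ) (v : Fin (μ + 1) → Cq) (j : Fin (μ + 1)) :
    ((Pi.basisFun Cq (Fin (μ + 1))).constr Cq fun i =>
      c (i : ℕ) • vvec μ (μ - 2 * (i : ℕ) + 2 * s)) v j =
      ∑ i : Fin (μ + 1), if ((j : ℕ) : ℤ) + s = (i : ℕ) then v i * c i else 0 := by
  rw [Basis.constr_apply_fintype, Finset.sum_apply]
  refine Finset.sum_congr rfl fun i _ => ?_
  simp only [Pi.basisFun_equivFun, LinearEquiv.refl_apply, Pi.smul_apply, smul_eq_mul, vvec]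
  have : ((μ : ℤ) - 2 * (j : ℕ) = μ - 2 * (i : ℕ) + 2 * s) ↔ ((j : ℕ) : ℤ) + s = (i : ℕ) := by
    omega
  simp only [this]
  split_ifs <;> simp

theorem irrGen_E_apply {μ : ℕ} (v : Fin (μ + 1) → Cq) (j : Fin (μ + 1)) :
    irrGen μ .E v j = qint (μ - (j : ℕ)) * vext v (j + 1) := by
  have h := constr_vvec_apply (fun i => qint (μ - (i : ℕ) + 1)) 1 v j
  rw [irrGen]
  refine h.trans ?_
  by_cases hj : (j : ℕ) + 1 < μ + 1
  · rw [Finset.sum_eq_single ⟨j + 1, hj⟩, if_pos (by push_cast; rfl), vext, dif_pos hj, mul_comm]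
    · congr 2
      push_cast
      ring
    · intro i _ hi
      rw [if_neg]
      intro h'
      exact hi (Fin.ext (by simp only; omega))
    · simp
  · rw [vext, dif_neg hj, mul_zero, Finset.sum_eq_zero]
    intro i _
    rw [if_neg]
    omega

theorem irrGen_F_apply {μ : ℕ} (v : Fin (μ + 1) → Cq) (j : Fin (μ + 1)) :
    irrGen μ .F v j = qint ((j : ℕ) : ℤ) * vext v (j - 1) := by
  have h := constr_vvec_apply (fun i => qint ((i : ℕ) + 1)) (-1) v j
  rw [irrGen]
  refine h.trans ?_
  -- At `j = 0` the truncated index `j - 1` is wrong, but its coefficient is `[0] = 0`.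
  by_cases hj : (j : ℕ) = 0
  · rw [hj, Nat.cast_zero, qint_zero, zero_mul, Finset.sum_eq_zero]
    intro i _
    rw [if_neg]
    omega
  · rw [Finset.sum_eq_single ⟨j - 1, by omega⟩, if_pos (by push_cast; omega), vext,
      dif_pos (by omega), mul_comm]
    · congr 2
      simp only
      omega
    · intro i _ hi
      rw [if_neg]
      intro h'
      exact hi (Fin.ext (by simp only; omega))
    · simp

theorem irrGen_K_apply {μ : ℕ} (v : Fin (μ + 1) → Cq) (j : Fin (μ + 1)) :
    irrGen μ .K v j = qq ^ ((μ : ℤ) - 2 * (j : ℕ)) * v j := by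
  have h := constr_vvec_apply (fun i => qq ^ ((μ : ℤ) - 2 * (i : ℕ))) 0 v j
  rw [irrGen]
  simp only [mul_zero, add_zero, Nat.cast_inj] at h
  refine h.trans ?_
  simp [Fin.val_inj, mul_comm]

theorem irrGen_Ki_apply {μ : ℕ} (v : Fin (μ + 1) → Cq) (j : Fin (μ + 1)) :
    irrGen μ .Ki v j = qq ^ (-((μ : ℤ) - 2 * (j : ℕ))) * v j := by
  have h := constr_vvec_apply (fun i => qq ^ (-((μ : ℤ) - 2 * (i : ℕ)))) 0 v j
  rw [irrGen]
  simp only [mul_zero, add_zero, Nat.cast_inj] at h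
  refine h.trans ?_
  simp [Fin.val_inj, mul_comm]

end

noncomputable section

open Module

/-! ### Functions on `T(𝐝)` in coordinates -/

section

variable {k : ℕ} {d : Fin k → ℕ}

/-- Families of vectors of the modules `V_μ`, one for each lower crossingless match. -/
abbrev Coord {k : ℕ} (d : Fin k → ℕ) : Type := ∀ b : LCM d, Fin (b.mu + 1) → Cq

theorem LCM.sigma_ext {b b' : LCM d} {j : Fin (b.mu + 1)} {j' : Fin (b'.mu + 1)} (h : b = b')
    (hj : (j : ℕ) = j') : (⟨b, j⟩ : Σ b : LCM d, Fin (b.mu + 1)) = ⟨b', j'⟩ := by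
  subst h
  rw [Fin.ext hj]

/-- The diagonal action of a generator. -/
def Coord.act (s : UqGen) (g : Coord d) : Coord d := fun b => irrGen b.mu s (g b)

/-- The value of `g` at `b` and `w = dim W`. -/
def Coord.val (g : Coord d) (b : LCM d) (w : ℕ) : Cq := vext (g b) (w - b.r)

variable {F D : Type} [Field F] [AddCommGroup D] [Module F D] [FiniteDimensional F D]

theorem TPt.toLCM_eq_of {x y : TPt F D d} (ht : y.t = x.t) (hf : ∀ i, y.flag i = x.flag i) :
    y.toLCM = x.toLCM := by
  rw [TPt.toLCM_eq_iff, x.toLCM_n, ht, funext hf]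

theorem TPt.sub_lt (x : TPt F D d) : finrank F x.W - x.toLCM.r < x.toLCM.mu + 1 := by
  have := x.le_mu_add_r
  have := x.r_le
  omega

variable (F D) in
/-- The function on `T(𝐝)` with given coordinates. -/
def liftT : Coord d →ₗ[Cq] (TPt F D d → Cq) where
  toFun g x := g.val x.toLCM (finrank F x.W)
  map_add' g h := by
    funext x
    simp only [Coord.val, vext, Pi.add_apply, dif_pos x.sub_lt]
  map_smul' c g := by
    funext x
    simp only [Coord.val, vext, Pi.smul_apply, dif_pos x.sub_lt, RingHom.id_apply]

theorem liftT_apply (g : Coord d) (x : TPt F D d) :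
    liftT F D g x = g.val x.toLCM (finrank F x.W) := rfl

theorem TPt.finrank_W_eq (x : TPt F D d) : finrank F x.W = ∑ i, x.lab.1 i := by
  rw [TPt.lab, sum_alpha]

theorem liftT_mem_Ts (g : Coord d) : liftT F D g ∈ Ts F D d := by
  have h : ∀ x y : TPt F D d, finrank F x.W = finrank F y.W →
      alpha x.flag (LinearMap.ker x.t) = alpha y.flag (LinearMap.ker y.t) →
      liftT F D g x = liftT F D g y := by
    intro x y h1 h2
    rw [liftT_apply, liftT_apply, h1, show x.toLCM = y.toLCM by rw [TPt.toLCM_eq_iff, h2, y.toLCM_n]]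
  refine ⟨fun x y hxy => h x y ?_ (congrArg (fun s => s.2.2) hxy), h⟩
  rw [x.finrank_W_eq, y.finrank_W_eq, hxy]

theorem liftT_lab (g : Coord d) (x y : TPt F D d) (h : x.lab = y.lab) :
    liftT F D g x = liftT F D g y := (liftT_mem_Ts g).1 x y h

theorem OLCM.point_toLCM (a : OLCM d) (β : Basis (Vtx d) F D) : (a.point β).toLCM = a.toLCM := by
  rw [TPt.toLCM_eq_iff, a.point_alpha]

theorem exists_TPt (hD : finrank F D = ∑ i, d i) (b : LCM d) (m : ℕ) (hm : m ≤ b.mu) :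
    ∃ x : TPt F D d, x.toLCM = b ∧ finrank F x.W = b.r + m := by
  obtain ⟨a, rfl, h⟩ := OLCM.exists_of b m hm
  exact ⟨a.point (vtxBasis hD), a.point_toLCM _, (a.point_finrank _).trans h⟩

/-- Every coordinate `(b, j)` is seen at some point of `T(𝐝)`, built from an oriented match and a
basis of `D`. -/
theorem liftT_injective (hD : finrank F D = ∑ i, d i) :
    Function.Injective (liftT F D : Coord d →ₗ[Cq] _) := by
  intro g h hgh
  funext b j
  obtain ⟨x, rfl, hx⟩ := exists_TPt hD b j (by omega)
  have h1 := congrFun hgh x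
  simp only [liftT_apply, hx, Coord.val, Nat.add_sub_cancel_left, vext_val] at h1
  exact h1

theorem exists_liftT_eq (hD : finrank F D = ∑ i, d i) {f : TPt F D d → Cq} (hf : f ∈ Ts F D d) :
    ∃ g : Coord d, liftT F D g = f := by
  choose x hx1 hx2 using fun (b : LCM d) (j : Fin (b.mu + 1)) =>
    exists_TPt (F := F) hD b j (by omega)
  refine ⟨fun b j => f (x b j), funext fun y => ?_⟩
  rw [liftT_apply, Coord.val, vext, dif_pos y.sub_lt]
  refine hf.2 _ _ ?_ ?_
  · rw [hx2]
    have := y.r_le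
    simp only
    omega
  · rw [← TPt.toLCM_n, ← TPt.toLCM_n, hx1]

/-- The space `𝓣_s(𝐝)` in coordinates. -/
def equivTs (hD : finrank F D = ∑ i, d i) : Coord d ≃ₗ[Cq] Ts F D d :=
  LinearEquiv.ofBijective ((liftT F D).codRestrict (Ts F D d) liftT_mem_Ts)
    ⟨fun g h hgh => liftT_injective hD (congrArg Subtype.val hgh), fun f => by
      obtain ⟨g, hg⟩ := exists_liftT_eq hD f.2
      exact ⟨g, Subtype.ext hg⟩⟩

@[simp] theorem coe_equivTs (hD : finrank F D = ∑ i, d i) (g : Coord d) :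
    (equivTs hD g : TPt F D d → Cq) = liftT F D g := rfl

theorem mem_Ya_iff {a : OLCM d} {x : TPt F D d} :
    x ∈ Ya F D a ↔ x.toLCM = a.toLCM ∧ finrank F x.W = a.down.card := by
  rw [TPt.toLCM_eq_iff]
  rfl

/-- The basis of `𝓣_s(𝐝)` that consists of the functions `1_{Y_a}`. -/
def basisTs (hD : finrank F D = ∑ i, d i) : Basis (OLCM d) Cq (Ts F D d) :=
  letI := Fintype.ofFinite (Σ b : LCM d, Fin (b.mu + 1))
  ((Pi.basisFun Cq (Σ b : LCM d, Fin (b.mu + 1))).reindex OLCM.equivSigma.symm).map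
    ((LinearEquiv.piCurry Cq fun (b : LCM d) (_ : Fin (b.mu + 1)) => Cq).trans (equivTs hD))

theorem basisTs_apply (hD : finrank F D = ∑ i, d i) (a : OLCM d) :
    (basisTs hD a : TPt F D d → Cq) = (Ya F D a).indicator 1 := by
  classical
  funext x
  rw [basisTs, Basis.map_apply, Basis.reindex_apply, Equiv.symm_symm, LinearEquiv.trans_apply,
    coe_equivTs, liftT_apply, Coord.val, vext, dif_pos x.sub_lt, LinearEquiv.piCurry_apply,
    Sigma.curry, Pi.basisFun_apply, Pi.single_apply, Set.indicator_apply, Pi.one_apply]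
  have h1 := x.r_le
  have h2 := a.r_le_card_down
  refine if_congr ?_ rfl rfl
  rw [mem_Ya_iff]
  obtain ⟨a', ha', hc⟩ := OLCM.exists_of x.toLCM (finrank F x.W - x.toLCM.r)
    (Nat.lt_succ_iff.1 x.sub_lt)
  have h3 : (⟨x.toLCM, ⟨finrank F x.W - x.toLCM.r, x.sub_lt⟩⟩ : Σ b : LCM d, Fin (b.mu + 1)) =
      OLCM.equivSigma a' := by
    refine LCM.sigma_ext ha'.symm ?_
    show _ = a'.down.card - a'.r
    rw [hc, ha']
    simp
  rw [h3, OLCM.equivSigma.injective.eq_iff, ← ha']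
  constructor
  · rintro rfl
    exact ⟨rfl, by omega⟩
  · rintro ⟨g1, g2⟩
    exact OLCM.eq_of g1 (by omega)

/-! ### Functions on `M(d)` -/

variable (F D) in
/-- The map `irrToM`, on vectors of coordinates. -/
def toM (μ r : ℕ) : (Fin (μ + 1) → Cq) →ₗ[Cq] (QPt F D → Cq) :=
  (Pi.basisFun Cq (Fin (μ + 1))).constr Cq fun j => indM F D r (r + j)

theorem toM_apply (μ r : ℕ) (v : Fin (μ + 1) → Cq) (x : QPt F D) :
    toM F D μ r v x =
      if finrank F (LinearMap.range x.t) = r then vext v (finrank F x.W - r) else 0 := by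
  have h0 := Submodule.finrank_mono x.range_le
  have h1 : toM F D μ r v x = ∑ j : Fin (μ + 1), v j * indM F D r (r + j) x := by
    rw [toM, Basis.constr_apply_fintype, Finset.sum_apply]
    rfl
  rw [h1]
  simp only [indM, Set.indicator_apply, Set.mem_ofPred_eq, Pi.one_apply]
  split_ifs with h
  · simp only [h, and_true]
    rw [vext]
    split_ifs with h2
    · rw [Finset.sum_eq_single ⟨finrank F x.W - r, h2⟩]
      · rw [if_pos (by simp only; omega), mul_one]
      · intro j _ hj
        rw [if_neg, mul_zero]
        intro h'
        exact hj (Fin.ext (by simp only; omega))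
      · simp
    · refine Finset.sum_eq_zero fun j _ => ?_
      rw [if_neg, mul_zero]
      omega
  · simp [h]

theorem toM_lab (μ r : ℕ) (v : Fin (μ + 1) → Cq) (x y : QPt F D) (h : x.lab = y.lab) :
    toM F D μ r v x = toM F D μ r v y := by
  rw [QPt.lab, QPt.lab, Prod.mk.injEq] at h
  rw [toM_apply, toM_apply, h.1, h.2]

theorem toM_injective (hD : finrank F D = ∑ i, d i) (b : LCM d) :
    Function.Injective (toM F D b.mu b.r) := by
  intro v w hvw
  funext j
  obtain ⟨x, rfl, hx⟩ := exists_TPt (F := F) hD b j (by omega)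
  have h1 := congrFun hvw x.toQPt
  rw [toM_apply, toM_apply, if_pos x.finrank_range, if_pos x.finrank_range, hx,
    Nat.add_sub_cancel_left, vext_val, vext_val] at h1
  exact h1

theorem QPt.finrank_W_le (hD : finrank F D = ∑ i, d i) (b : LCM d) (x : QPt F D)
    (hx : finrank F (LinearMap.range x.t) = b.r) :
    finrank F (LinearMap.ker x.t) = b.mu + b.r ∧ b.r ≤ finrank F x.W ∧
      finrank F x.W ≤ b.mu + b.r := by
  have h1 := LinearMap.finrank_range_add_finrank_ker x.t
  have h2 := Submodule.finrank_mono x.range_le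
  have h3 := Submodule.finrank_mono x.le_ker
  have h4 := b.mu_add_two_mul_r
  omega

theorem range_toM (hD : finrank F D = ∑ i, d i) (b : LCM d) :
    LinearMap.range (toM F D b.mu b.r) = Mr F D b.r := by
  have h1 : LinearMap.range (toM F D b.mu b.r) =
      Submodule.span Cq (Set.range fun j : Fin (b.mu + 1) => indM F D b.r (b.r + j)) :=
    Basis.constr_range _ _
  rw [h1, Mr]
  apply le_antisymm
  · refine Submodule.span_mono ?_
    rintro _ ⟨j, rfl⟩
    exact ⟨_, rfl⟩
  · rw [Submodule.span_le]
    rintro _ ⟨w, rfl⟩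
    by_cases hw : b.r ≤ w ∧ w ≤ b.mu + b.r
    · refine Submodule.subset_span ⟨⟨w - b.r, by omega⟩, ?_⟩
      simp only [Nat.add_sub_cancel' hw.1]
    -- Outside the range `r ≤ w ≤ r + μ` the variety `M^r(w, d)` is empty.
    · have : indM F D b.r w = 0 := by
        funext x
        refine Set.indicator_of_notMem ?_ _
        rintro ⟨g1, g2⟩
        have := x.finrank_W_le hD b g2
        omega
      rw [this]
      exact Submodule.zero_mem _

/-! ### The action of `U_q` in coordinates -/

theorem Coord.act_val (s : UqGen) (g : Coord d) (b : LCM d) (w : ℕ) (hr : b.r ≤ w)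
    (hw : w ≤ b.mu + b.r) : (g.act s).val b w = irrGen b.mu s (g b) ⟨w - b.r, by omega⟩ := by
  rw [Coord.val, vext, dif_pos (by omega)]
  rfl

variable [Finite F]

/-- The match `b` depends only on `t` and the flag, which stay fixed. With `j = dim W - r` and `dim
ker t = μ + r`, the factors are `[dim ker t - dim W] = [μ - j]` for `E` and `[dim W - r] = [j]` for
`F`, as in `V_μ`; for `K` one has `d - 2 dim W = μ - 2j`. -/
theorem actT_liftT (s : UqGen) (g : Coord d) :
    actT s (liftT F D g) = liftT F D (g.act s) := by
  funext x
  have h1 := x.r_le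
  have h2 := x.le_mu_add_r
  have h3 := x.toLCM.mu_add_two_mul_r
  have hval : vext (g x.toLCM) (finrank F x.W - x.toLCM.r) =
      g x.toLCM ⟨finrank F x.W - x.toLCM.r, x.sub_lt⟩ := by
    rw [vext, dif_pos]
  rw [liftT_apply, Coord.act_val s g _ _ h1 h2]
  cases s with
  | E =>
    rw [irrGen_E_apply, actT_E_apply (liftT_lab g) x (g.val x.toLCM (finrank F x.W + 1)),
      x.finrank_ker, Coord.val]
    · simp only
      congr 2
      · push_cast [h1]
        ring
      · omega
    · intro y ht hf hy
      rw [liftT_apply, TPt.toLCM_eq_of ht hf, hy]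
  | F =>
    rw [irrGen_F_apply, actT_F_apply (liftT_lab g) x (g.val x.toLCM (finrank F x.W - 1)),
      x.finrank_range, Coord.val]
    · simp only
      congr 2
      · push_cast [h1]
        ring
      · omega
    · intro y ht hf hy
      rw [liftT_apply, TPt.toLCM_eq_of ht hf, ← hy, Nat.add_sub_cancel]
  | K =>
    rw [irrGen_K_apply, actT, liftT_apply, Coord.val, hval, finrank_eq_sum x, ← h3]
    congr 2
    push_cast [h1]
    ring
  | Ki =>
    rw [irrGen_Ki_apply, actT, liftT_apply, Coord.val, hval, finrank_eq_sum x, ← h3]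
    congr 2
    push_cast [h1]
    ring

theorem irr_ρ_gen (μ : ℕ) (s : UqGen) : (irr μ).ρ (Uq.gen s) = irrGen μ s := by
  unfold irr
  dsimp only
  rw [Uq.lift_gen]

theorem actM_toM (hD : finrank F D = ∑ i, d i) (b : LCM d) (s : UqGen)
    (v : Fin (b.mu + 1) → Cq) :
    toM F D b.mu b.r (irrGen b.mu s v) = actM s (toM F D b.mu b.r v) := by
  funext x
  have hrk : ∀ y : QPt F D, y.t = x.t →
      finrank F (LinearMap.range y.t) = finrank F (LinearMap.range x.t) := fun y h => by rw [h]
  by_cases hx : finrank F (LinearMap.range x.t) = b.r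
  · obtain ⟨h1, h2, h3⟩ := x.finrank_W_le hD b hx
    have hlt : finrank F x.W - b.r < b.mu + 1 := by omega
    have h4 := b.mu_add_two_mul_r
    rw [toM_apply, if_pos hx, vext, dif_pos hlt]
    cases s with
    | E =>
      rw [irrGen_E_apply, actM_E_apply (toM_lab _ _ v) x
        (vext v (finrank F x.W + 1 - b.r)), h1]
      · simp only
        congr 2
        · push_cast [h2]
          ring
        · omega
      · intro y ht hy
        rw [toM_apply, hrk y ht, if_pos hx, hy]
    | F =>
      rw [irrGen_F_apply, actM_F_apply (toM_lab _ _ v) x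
        (vext v (finrank F x.W - 1 - b.r)), hx]
      · simp only
        congr 2
        · push_cast [h2]
          ring
        · omega
      · intro y ht hy
        rw [toM_apply, hrk y ht, if_pos hx, ← hy, Nat.add_sub_cancel]
    | K =>
      rw [irrGen_K_apply, actM, toM_apply, if_pos hx, vext, dif_pos hlt, hD, ← h4]
      congr 2
      push_cast [h2]
      ring
    | Ki =>
      rw [irrGen_Ki_apply, actM, toM_apply, if_pos hx, vext, dif_pos hlt, hD, ← h4]
      congr 2
      push_cast [h2]
      ring
  -- No generator changes `t`, so both sides vanish where the rank is not `r`.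
  · rw [toM_apply, if_neg hx]
    symm
    cases s with
    | E =>
      rw [actM_E_apply (toM_lab _ _ v) x 0, mul_zero]
      intro y ht hy
      rw [toM_apply, hrk y ht, if_neg hx]
    | F =>
      rw [actM_F_apply (toM_lab _ _ v) x 0, mul_zero]
      intro y ht hy
      rw [toM_apply, hrk y ht, if_neg hx]
    | K => rw [actM, toM_apply, if_neg hx, mul_zero]
    | Ki => rw [actM, toM_apply, if_neg hx, mul_zero]

/-! ### The operators `T_Y` in coordinates -/

/-- The constant by which `T_{Y_b}` scales the coordinates at `b`: the value at `q ^ 2` of the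
polynomial that counts the flags `𝐃` with `α(ker t, 𝐃) = n^b`. -/
def LCM.const (b : LCM d) : Cq := evq (flagPoly d b.n)

/-- The counting polynomial is the same for all fields, so a point of `Y_b` over the field with two
elements is enough. -/
theorem LCM.const_ne_zero (b : LCM d) : b.const ≠ 0 := by
  refine evq_ne_zero ?_
  have : Fact (Nat.Prime 2) := ⟨Nat.prime_two⟩
  obtain ⟨x, rfl, -⟩ := exists_TPt (F := ZMod 2) (D := Fin (∑ i, d i) → ZMod 2) (by simp) b 0
    (Nat.zero_le _)
  rw [x.toLCM_n]
  exact flagPoly_ne_zero x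

/-- On the part of the fibre over `(W, t)` that lies in `Y_b` the function has the constant value
`g.val b (dim W)`, so the operator multiplies it by the number of flags. If the rank of `t` is not
`r`, the kernel has the wrong dimension and that part is empty. -/
theorem TY_liftT (hD : finrank F D = ∑ i, d i) (b : LCM d) (g : Coord d) :
    TY (Yb F D b) (liftT F D g) = toM F D b.mu b.r (b.const • g b) := by
  funext x
  rw [map_smul, Pi.smul_apply, toM_apply, smul_eq_mul]
  have h1 := LinearMap.finrank_range_add_finrank_ker x.t
  have h4 := b.mu_add_two_mul_r
  split_ifs with hx
  · rw [mul_comm]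
    refine TY_apply (liftT_lab g) hD b.n x ?_ _ ?_
    · rw [b.sum_n]
      omega
    · intro y hW ht hy
      rw [liftT_apply, TPt.toLCM_eq_iff.2 hy, hW, Coord.val]
  · rw [mul_zero]
    refine TY_apply_of_ne (liftT_lab g) hD b.n x ?_
    rw [b.sum_n]
    omega

end

end

noncomputable section

/-! ### Characters -/

open LaurentPolynomial in
/-- The character of `V_μ`. -/
def ch (μ : ℕ) : LaurentPolynomial ℤ := ∑ j ∈ Finset.range (μ + 1), T ((μ : ℤ) - 2 * j)

open LaurentPolynomial in
-- The product telescopes; this is the Weyl character formula.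
theorem ch_mul_T_sub (μ : ℕ) :
    ch μ * (T 1 - T (-1)) = T ((μ : ℤ) + 1) - T (-((μ : ℤ) + 1)) := by
  have h : ∀ j ∈ Finset.range (μ + 1), T ((μ : ℤ) - 2 * j) * (T 1 - T (-1) : LaurentPolynomial ℤ) =
      T ((μ : ℤ) + 1 - 2 * j) - T ((μ : ℤ) + 1 - 2 * ((j + 1 : ℕ) : ℤ)) := by
    intro j _
    rw [mul_sub, ← T_add, ← T_add]
    congr 2
    · ring
    · push_cast
      ring
  rw [ch, Finset.sum_mul, Finset.sum_congr rfl h, Finset.sum_range_sub'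
    (fun j : ℕ => (T ((μ : ℤ) + 1 - 2 * j) : LaurentPolynomial ℤ))]
  congr 2
  push_cast
  ring

open LaurentPolynomial in
-- It is enough to compare after multiplication by the nonzero `T 1 - T (-1)`. On the left this
-- replaces `ch h` by two monomials, and the right hand side is regrouped into the same two
-- multiples of `ch d`.
theorem ch_mul_ch_of_le {h d : ℕ} (hd : d ≤ h) :
    ch h * ch d = ∑ a ∈ Finset.range (d + 1), ch (h + d - 2 * a) := by
  have hne : (T 1 - T (-1) : LaurentPolynomial ℤ) ≠ 0 := by
    intro h0
    have := congrArg (fun p => p.coeff 1) h0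
    simp [T_apply] at this
  apply mul_right_cancel₀ hne
  rw [mul_right_comm, ch_mul_T_sub, Finset.sum_mul]
  -- The exponent with `d + 1 - 1 - a` has the form that `Finset.sum_range_reflect` expects. The
  -- natural subtraction `h + d - 2 * a` is exact, as `a ≤ d ≤ h`.
  have h1 : ∀ a ∈ Finset.range (d + 1), ch (h + d - 2 * a) * (T 1 - T (-1)) =
      T ((h : ℤ) + 1) * T ((d : ℤ) - 2 * a) -
        T (-((h : ℤ) + 1)) * T ((d : ℤ) - 2 * ((d + 1 - 1 - a : ℕ) : ℤ)) := by
    intro a ha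
    rw [Finset.mem_range] at ha
    rw [ch_mul_T_sub, ← T_add, ← T_add]
    congr 2
    · omega
    · omega
  rw [Finset.sum_congr rfl h1, Finset.sum_sub_distrib, ← Finset.mul_sum, ← Finset.mul_sum,
    Finset.sum_range_reflect (fun j : ℕ => (T ((d : ℤ) - 2 * j) : LaurentPolynomial ℤ)) (d + 1),
    ← sub_mul, ch]

/-- The character of the tensor product of two irreducible modules. -/
theorem ch_mul_ch (h d : ℕ) :
    ch h * ch d = ∑ a ∈ Finset.range (min h d + 1), ch (h + d - 2 * a) := by
  rcases le_total d h with hd | hd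
  · rw [min_eq_right hd, ch_mul_ch_of_le hd]
  · rw [min_eq_left hd, mul_comm, ch_mul_ch_of_le hd, add_comm d h]

/-! ### Ballot sequences -/

/-- The sequences `ρ ≤ d` all of whose partial sums satisfy the ballot condition, starting from
height `h`. -/
def ballots : ∀ k : ℕ, ℕ → (Fin k → ℕ) → Finset (Fin k → ℕ)
  | 0, _, _ => Finset.univ
  | k + 1, h, d => (Finset.range (min h (d 0) + 1)).biUnion fun a =>
      (ballots k (h + d 0 - 2 * a) (Fin.tail d)).image (Fin.cons a)

theorem sum_ballots_succ {M : Type*} [AddCommMonoid M] {k h : ℕ} (d : Fin (k + 1) → ℕ)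
    (f : (Fin (k + 1) → ℕ) → M) :
    ∑ ρ ∈ ballots (k + 1) h d, f ρ = ∑ a ∈ Finset.range (min h (d 0) + 1),
      ∑ ρ ∈ ballots k (h + d 0 - 2 * a) (Fin.tail d), f (Fin.cons a ρ) := by
  rw [ballots, Finset.sum_biUnion]
  · refine Finset.sum_congr rfl fun a _ => ?_
    rw [Finset.sum_image]
    intro ρ _ ρ' _ h
    exact (Fin.cons_inj.1 h).2
  · intro a _ b _ hab
    rw [Function.onFun, Finset.disjoint_left]
    intro ρ h1 h2
    obtain ⟨ρ', -, rfl⟩ := Finset.mem_image.1 h1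
    obtain ⟨ρ'', -, h3⟩ := Finset.mem_image.1 h2
    exact hab (Fin.cons_inj.1 h3).1.symm

theorem psum_succ_eq {k : ℕ} (n : Fin (k + 1) → ℕ) (i : Fin (k + 1)) :
    psum n i.succ = n 0 + psum (Fin.tail n) i := by
  induction i using Fin.induction with
  | zero => rw [psum_succ, Fin.castSucc_zero, psum_zero, psum_zero, add_comm]
  | succ i ih =>
    rw [psum_succ, Fin.castSucc_succ, ih, psum_succ, add_assoc]
    rfl

theorem mem_ballots {k h : ℕ} {d ρ : Fin k → ℕ} : ρ ∈ ballots k h d ↔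
    (∀ i, ρ i ≤ d i) ∧ ∀ i : Fin k, psum ρ i.succ ≤ h + psum (fun j => d j - ρ j) i.castSucc := by
  induction k generalizing h with
  | zero => simp only [ballots, Finset.mem_univ, IsEmpty.forall_iff, and_self]
  | succ k ih =>
    have key : ρ ∈ ballots (k + 1) h d ↔ ρ 0 ≤ min h (d 0) ∧
        Fin.tail ρ ∈ ballots k (h + d 0 - 2 * ρ 0) (Fin.tail d) := by
      simp only [ballots, Finset.mem_biUnion, Finset.mem_image, Finset.mem_range]
      constructor
      · rintro ⟨a, ha, ρ', hρ', rfl⟩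
        exact ⟨Nat.lt_succ_iff.1 ha, hρ'⟩
      · rintro ⟨h1, h2⟩
        exact ⟨ρ 0, Nat.lt_succ_iff.2 h1, _, h2, Fin.cons_self_tail ρ⟩
    rw [key, ih, Fin.forall_fin_succ (P := fun i => ρ i ≤ d i), Fin.forall_fin_succ
      (P := fun i => psum ρ i.succ ≤ h + psum (fun j => d j - ρ j) i.castSucc), le_min_iff]
    have e1 : psum ρ (Fin.succ 0) = ρ 0 := by
      rw [psum_succ, Fin.castSucc_zero, psum_zero, zero_add]
    have e2 : psum (fun j => d j - ρ j) (Fin.castSucc 0) = 0 := by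
      rw [Fin.castSucc_zero, psum_zero]
    have e3 : ∀ i : Fin k, psum (fun j => d j - ρ j) i.succ.castSucc =
        (d 0 - ρ 0) + psum (fun j => Fin.tail d j - Fin.tail ρ j) i.castSucc := by
      intro i
      rw [Fin.castSucc_succ, psum_succ_eq]
      rfl
    have e4 : ∀ i : Fin k, psum ρ i.succ.succ = ρ 0 + psum (Fin.tail ρ) i.succ := fun i =>
      psum_succ_eq _ _
    simp only [e1, e2, e3, e4, Fin.tail]
    constructor
    · rintro ⟨⟨h1, h2⟩, h3, h4⟩
      refine ⟨⟨h2, h3⟩, h1, fun i => ?_⟩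
      have := h4 i
      omega
    · rintro ⟨⟨h2, h3⟩, h1, h4⟩
      refine ⟨⟨h1, h2⟩, h3, fun i => ?_⟩
      have := h4 i
      omega

/-- In Clebsch-Gordan, the summand `V_{h + d 0 - 2a}` of `V_h ⊗ V_{d 0}` corresponds to `a` right
endpoints in the first box, after which `h + d 0 - 2a` vertices are free. Generalising over the
height `h` lets the induction go through. -/
theorem sum_ballots_ch (k h : ℕ) (d : Fin k → ℕ) :
    ∑ ρ ∈ ballots k h d, ch (h + ∑ i, (d i - ρ i) - ∑ i, ρ i) = ch h * ∏ i, ch (d i) := by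
  induction k generalizing h with
  | zero => simp [ballots]
  | succ k ih =>
    rw [sum_ballots_succ, Fin.prod_univ_succ, ← mul_assoc, ch_mul_ch, Finset.sum_mul]
    refine Finset.sum_congr rfl fun a ha => ?_
    rw [Finset.mem_range, Nat.lt_succ_iff, le_min_iff] at ha
    refine Eq.trans ?_ (ih (h + d 0 - 2 * a) (Fin.tail d))
    refine Finset.sum_congr rfl fun ρ _ => ?_
    rw [Fin.sum_univ_succ, Fin.sum_univ_succ]
    simp only [Fin.cons_zero, Fin.cons_succ, Fin.tail]
    congr 1
    omega

/-! ### The character of the space `𝓣_s(𝐝)` -/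

section

variable {k : ℕ} {d : Fin k → ℕ}

theorem LCM.n_le (b : LCM d) (i : Fin k) : b.n i ≤ d i := by
  rw [n_eq]
  refine (Nat.card_mono (Set.toFinite Set.univ) (Set.subset_univ _)).trans ?_
  simp

/-- Derived from geometry: `b` is the match of a point over the field with two elements, and
`TPt.ballot` applies to it. -/
theorem LCM.ballot (b : LCM d) (i : Fin k) :
    psum (fun j => d j - b.n j) i.succ ≤ psum b.n i.castSucc := by
  have : Fact (Nat.Prime 2) := ⟨Nat.prime_two⟩
  obtain ⟨x, rfl, -⟩ := exists_TPt (F := ZMod 2) (D := Fin (∑ i, d i) → ZMod 2) (by simp) b 0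
    (Nat.zero_le _)
  rw [x.toLCM_n]
  exact x.ballot i

/-- The map `b ↦ d - n^b`, which counts the right endpoints in each box, is a bijection onto the
ballot sequences from height 0, and `μ` is the final height. -/
theorem sum_ch_mu [Fintype (LCM d)] : ∑ b : LCM d, ch b.mu = ∏ i, ch (d i) := by
  have h0 : ch 0 = 1 := by simp [ch]
  have h := sum_ballots_ch k 0 d
  rw [h0, one_mul] at h
  rw [← h]
  have hsub : ∀ b : LCM d, (fun j => d j - (d j - b.n j)) = b.n := fun b =>
    funext fun j => Nat.sub_sub_self (b.n_le j)
  refine Finset.sum_bij (fun b _ i => d i - b.n i) ?_ ?_ ?_ ?_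
  · intro b _
    refine mem_ballots.2 ⟨fun i => Nat.sub_le _ _, fun i => ?_⟩
    rw [hsub, zero_add]
    exact b.ballot i
  · intro b _ b' _ hbb
    apply LCM.n_injective
    rw [← hsub b, ← hsub b']
    funext j
    rw [congrFun hbb j]
  · intro ρ hρ
    obtain ⟨h1, h2⟩ := mem_ballots.1 hρ
    have h3 : (fun j => d j - (d j - ρ j)) = ρ := funext fun j => Nat.sub_sub_self (h1 j)
    obtain ⟨b, hb⟩ := LCM.exists_n_eq (fun i => d i - ρ i) (fun i => Nat.sub_le _ _) (fun i => by
      rw [h3]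
      simpa using h2 i)
    refine ⟨b, Finset.mem_univ _, ?_⟩
    rw [hb, h3]
  · intro b _
    simp only [fun j => Nat.sub_sub_self (b.n_le j)]
    have h1 : ∑ i, (d i - b.n i) + ∑ i, b.n i = ∑ i, d i := by
      rw [← Finset.sum_add_distrib]
      exact Finset.sum_congr rfl fun j _ => Nat.sub_add_cancel (b.n_le j)
    have h2 := b.mu_add_two_mul_r
    have h3 := b.sum_n
    congr 1
    omega

end

/-! ### Multiplicities read off from characters. -/

open LaurentPolynomial in
theorem sum_T_coeff {ι : Type*} [Fintype ι] (wt : ι → ℤ) (m : ℤ) :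
    (∑ i, (T (wt i) : LaurentPolynomial ℤ)).coeff m = Nat.card {i // wt i = m} := by
  classical
  rw [AddMonoidAlgebra.coeff_sum, Finsupp.finsetSum_apply, Nat.card_eq_fintype_card,
    Fintype.card_subtype]
  simp only [T_apply]
  rw [Finset.sum_boole]

open LaurentPolynomial in
theorem ch_coeff (μ : ℕ) (m : ℤ) : (ch μ).coeff m =
    if ∃ j : ℕ, j ≤ μ ∧ (μ : ℤ) - 2 * j = m then 1 else 0 := by
  have h : ch μ = ∑ j : Fin (μ + 1), T ((μ : ℤ) - 2 * (j : ℕ)) :=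
    (Fin.sum_univ_eq_sum_range (fun j : ℕ => (T ((μ : ℤ) - 2 * j) : LaurentPolynomial ℤ)) _).symm
  rw [h, sum_T_coeff]
  split_ifs with hj
  · obtain ⟨j, hj, hm⟩ := hj
    rw [card_eq_one_of_iff (⟨j, by omega⟩ : Fin (μ + 1)), Nat.cast_one]
    intro i
    rw [Fin.ext_iff]
    simp only
    omega
  · rw [card_eq_zero_of_forall, Nat.cast_zero]
    exact fun i hi => hj ⟨i, by omega, hi⟩

/-- In `V_ν` the dimensions in weights `μ` and `μ + 2` differ only at the top, so the difference
detects the highest weight. -/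
theorem ch_coeff_sub (ν μ : ℕ) : (ch ν).coeff (μ : ℤ) - (ch ν).coeff ((μ : ℤ) + 2) =
    if ν = μ then 1 else 0 := by
  rw [ch_coeff, ch_coeff]
  by_cases h1 : ν = μ
  · subst h1
    rw [if_pos ⟨0, by omega, by simp⟩, if_neg (by rintro ⟨j, _, h⟩; omega)]
    simp
  · rw [if_neg h1]
    by_cases h2 : ∃ j : ℕ, j ≤ ν ∧ (ν : ℤ) - 2 * j = μ
    · obtain ⟨j, hj, hm⟩ := h2
      rw [if_pos ⟨j, hj, hm⟩, if_pos ⟨j - 1, by omega, by omega⟩, sub_self]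
    · rw [if_neg h2, if_neg, sub_self]
      rintro ⟨j, hj, hm⟩
      exact h2 ⟨j + 1, by omega, by push_cast; omega⟩

open LaurentPolynomial in
theorem card_of_sum_T_eq {ι B : Type*} [Fintype ι] [Fintype B] (wt : ι → ℤ) (μ : B → ℕ)
    (h : ∑ i, (T (wt i) : LaurentPolynomial ℤ) = ∑ b, ch (μ b)) :
    (∀ m : ℕ, Nat.card {b // μ b = m} + Nat.card {i // wt i = (m : ℤ) + 2} =
      Nat.card {i // wt i = m}) ∧ Fintype.card ι = ∑ b, (μ b + 1) := by
  classical
  constructor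
  · intro m
    have h1 := sum_T_coeff wt m
    have h2 := sum_T_coeff wt ((m : ℤ) + 2)
    rw [h, AddMonoidAlgebra.coeff_sum, Finsupp.finsetSum_apply] at h1 h2
    have h3 : ∑ b, (ch (μ b)).coeff (m : ℤ) - ∑ b, (ch (μ b)).coeff ((m : ℤ) + 2) =
        Nat.card {b // μ b = m} := by
      rw [← Finset.sum_sub_distrib]
      simp only [ch_coeff_sub]
      rw [Finset.sum_boole, Nat.card_eq_fintype_card, Fintype.card_subtype]
    rw [h1, h2] at h3
    omega
  -- Evaluation of the characters at 1 compares dimensions.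
  · have h1 := congrArg (eval₂ (RingHom.id ℤ) (1 : ℤˣ)) h
    simp only [map_sum, ch, eval₂_T, one_zpow, Units.val_one, Finset.sum_const, Finset.card_univ,
      Finset.card_range, nsmul_eq_mul, mul_one] at h1
    exact_mod_cast h1

end

noncomputable section

open Module

/-! ### Weight bases -/

/-- A basis of eigenvectors of `K`, with eigenvalues `q ^ wt i`. -/
def IsWeightBasis (M : URep) {ι : Type} (β : Basis ι Cq M.V) (wt : ι → ℤ) : Prop :=
  ∀ i, M.ρ (Uq.gen .K) (β i) = qq ^ wt i • β i

open LaurentPolynomial in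
/-- The character of `M` is `p`. -/
def HasChar (M : URep) (p : LaurentPolynomial ℤ) : Prop :=
  ∃ (ι : Type) (_ : Fintype ι) (β : Basis ι Cq M.V) (wt : ι → ℤ), IsWeightBasis M β wt ∧
    ∑ i, (T (wt i) : LaurentPolynomial ℤ) = p

theorem trivial_hasChar : HasChar URep.trivial 1 := by
  refine ⟨Unit, inferInstance, Basis.singleton Unit Cq, fun _ => 0, fun i => ?_, ?_⟩
  · change (Algebra.lmul Cq Cq) (Uq.counit (Uq.gen .K)) _ = _
    have : Uq.counit (Uq.gen .K) = 1 := by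
      unfold Uq.counit
      rw [Uq.lift_gen]
    rw [this, map_one, zpow_zero, one_smul]
    rfl
  · simp

open LaurentPolynomial in
theorem irr_hasChar (μ : ℕ) : HasChar (irr μ) (ch μ) := by
  refine ⟨Fin (μ + 1), inferInstance, Pi.basisFun Cq (Fin (μ + 1)),
    fun j => (μ : ℤ) - 2 * (j : ℕ), fun j => ?_, ?_⟩
  · rw [irr_ρ_gen]
    exact (congrArg (irrGen μ .K) (basisFun_eq_vvec μ j)).trans
      ((irrGen_K_vvec μ _).trans (congrArg _ (basisFun_eq_vvec μ j).symm))
  · exact Fin.sum_univ_eq_sum_range (fun j : ℕ => (T ((μ : ℤ) - 2 * j) : LaurentPolynomial ℤ)) _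

theorem tensor_K_tmul (M N : URep) (v : M.V) (w : N.V) :
    (M.tensor N).ρ (Uq.gen .K) (v ⊗ₜ[Cq] w) =
      (M.ρ (Uq.gen .K) v) ⊗ₜ[Cq] (N.ρ (Uq.gen .K) w) := by
  have h : Uq.comul (Uq.gen .K) = Uq.gen .K ⊗ₜ[Cq] Uq.gen .K := by
    unfold Uq.comul
    rw [Uq.lift_gen]
    rfl
  change Module.endTensorEndAlgHom (R := Cq) (S := Cq) (A := Cq)
    (Algebra.TensorProduct.map M.ρ N.ρ (Uq.comul (Uq.gen .K))) (v ⊗ₜ[Cq] w) = _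
  rw [h, Algebra.TensorProduct.map_tmul, Module.endTensorEndAlgHom_apply]
  rfl

theorem tensor_hasChar {M N : URep} {p p' : LaurentPolynomial ℤ} (hM : HasChar M p)
    (hN : HasChar N p') : HasChar (M.tensor N) (p * p') := by
  obtain ⟨ι, _, β, wt, hβ, rfl⟩ := hM
  obtain ⟨κ, _, γ, wt', hγ, rfl⟩ := hN
  refine ⟨ι × κ, inferInstance, β.tensorProduct γ, fun i => wt i.1 + wt' i.2, fun i => ?_, ?_⟩
  · have h : (β.tensorProduct γ) i = β i.1 ⊗ₜ[Cq] γ i.2 := Basis.tensorProduct_apply' _ _ _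
    refine (congrArg ((M.tensor N).ρ (Uq.gen .K)) h).trans ((tensor_K_tmul M N _ _).trans ?_)
    have h1 : (M.ρ (Uq.gen .K) (β i.1)) ⊗ₜ[Cq] (N.ρ (Uq.gen .K) (γ i.2)) =
        qq ^ (wt i.1 + wt' i.2) • (β i.1 ⊗ₜ[Cq] γ i.2) := by
      rw [hβ, hγ, TensorProduct.smul_tmul_smul, zpow_add₀ qq_ne_zero]
    exact h1.trans (congrArg _ h.symm)
  · rw [Finset.sum_mul_sum, Fintype.sum_prod_type]
    simp only [LaurentPolynomial.T_add]

theorem tens_hasChar : ∀ l : List ℕ, HasChar (tens l) (l.map ch).prod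
  | [] => trivial_hasChar
  | [m] => by simpa [tens] using irr_hasChar m
  | m :: n :: l => by
    rw [List.map_cons, List.prod_cons]
    exact tensor_hasChar (irr_hasChar m) (tens_hasChar (n :: l))

/-! ### Highest weight vectors -/

theorem qint_one : qint 1 = 1 := by
  rw [qint, zpow_one, zpow_neg, zpow_one, div_self qq_sub_inv_ne_zero]

section

variable (M : URep)

/-- The divided powers of `F`, applied to `x`. -/
def URep.lower (x : M.V) : ℕ → M.V
  | 0 => x
  | j + 1 => (qint (j + 1))⁻¹ • M.ρ (Uq.gen .F) (URep.lower x j)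

variable {M}

theorem URep.K_E (v : M.V) : M.ρ (Uq.gen .K) (M.ρ (Uq.gen .E) v) =
    qq ^ (2 : ℤ) • M.ρ (Uq.gen .E) (M.ρ (Uq.gen .K) v) := by
  have h := congrArg (fun u => M.ρ u v) Uq.K_mul_E
  rw [zpow_ofNat]
  simpa only [map_mul, map_smul, Module.End.mul_apply, LinearMap.smul_apply] using h

theorem URep.K_F (v : M.V) : M.ρ (Uq.gen .K) (M.ρ (Uq.gen .F) v) =
    qq ^ (-2 : ℤ) • M.ρ (Uq.gen .F) (M.ρ (Uq.gen .K) v) := by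
  have h := congrArg (fun u => M.ρ u v) Uq.K_mul_F
  rw [zpow_neg, zpow_ofNat]
  simpa only [map_mul, map_smul, Module.End.mul_apply, LinearMap.smul_apply] using h

theorem URep.Ki_K (v : M.V) : M.ρ (Uq.gen .Ki) (M.ρ (Uq.gen .K) v) = v := by
  have h := congrArg (fun u => M.ρ u v) Uq.Ki_mul_K
  simpa only [map_mul, map_one, Module.End.mul_apply, Module.End.one_apply] using h

theorem URep.E_F (v : M.V) : M.ρ (Uq.gen .E) (M.ρ (Uq.gen .F) v) =
    M.ρ (Uq.gen .F) (M.ρ (Uq.gen .E) v) +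
      (qq - qq⁻¹)⁻¹ • (M.ρ (Uq.gen .K) v - M.ρ (Uq.gen .Ki) v) := by
  have h := congrArg (fun u => M.ρ u v) Uq.E_mul_F_sub
  simp only [map_mul, map_sub, map_smul, Module.End.mul_apply, LinearMap.smul_apply,
    LinearMap.sub_apply] at h
  rw [← h]
  abel

theorem URep.Ki_of_K {v : M.V} {m : ℤ} (h : M.ρ (Uq.gen .K) v = qq ^ m • v) :
    M.ρ (Uq.gen .Ki) v = qq ^ (-m) • v := by
  have h1 := URep.Ki_K v
  rw [h, map_smul] at h1
  rw [← h1, smul_smul, ← zpow_add₀ qq_ne_zero, neg_add_cancel, zpow_zero, one_smul, h1]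

variable {x : M.V}

theorem URep.lower_succ (j : ℕ) :
    M.lower x (j + 1) = (qint (j + 1))⁻¹ • M.ρ (Uq.gen .F) (M.lower x j) := rfl

theorem URep.F_lower (j : ℕ) :
    M.ρ (Uq.gen .F) (M.lower x j) = qint (j + 1) • M.lower x (j + 1) := by
  rw [URep.lower, smul_smul, mul_inv_cancel₀ (qint_ne_zero (by omega)), one_smul]

variable {μ : ℤ}

theorem URep.K_lower (hK : M.ρ (Uq.gen .K) x = qq ^ μ • x) (j : ℕ) :
    M.ρ (Uq.gen .K) (M.lower x j) = qq ^ (μ - 2 * j) • M.lower x j := by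
  induction j with
  | zero => simpa [URep.lower] using hK
  | succ j ih =>
    rw [URep.lower_succ, map_smul, URep.K_F, ih, map_smul, smul_smul (qq ^ (-2 : ℤ)),
      ← zpow_add₀ qq_ne_zero, smul_comm]
    congr 2
    push_cast
    ring

/-- Induction with the commutator of `E` and `F`; `qint_identity` makes the quantum integers
collapse. -/
theorem URep.E_lower_succ (hK : M.ρ (Uq.gen .K) x = qq ^ μ • x)
    (hE : M.ρ (Uq.gen .E) x = 0) (j : ℕ) :
    M.ρ (Uq.gen .E) (M.lower x (j + 1)) = qint (μ - j) • M.lower x j := by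
  have hdiff : ∀ j : ℕ, (qq - qq⁻¹)⁻¹ •
      (M.ρ (Uq.gen .K) (M.lower x j) - M.ρ (Uq.gen .Ki) (M.lower x j)) =
      (qint (j + 1) * qint (μ - j) - qint (μ - j + 1) * qint j) • M.lower x j := by
    intro j
    rw [URep.Ki_of_K (URep.K_lower hK j), URep.K_lower hK j, ← sub_smul, smul_smul,
      qint_identity (μ - j) j, show μ - (j : ℤ) - j = μ - 2 * j by ring]
  have hne : ∀ j : ℕ, qint ((j : ℤ) + 1) ≠ 0 := fun j => qint_ne_zero (by omega)
  induction j with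
  | zero =>
    rw [URep.lower_succ, map_smul, URep.E_F, hdiff, show M.lower x 0 = x from rfl, hE, map_zero, zero_add, smul_smul]
    congr 1
    simp [qint_one]
  | succ j ih =>
    rw [URep.lower_succ (j + 1), map_smul, URep.E_F, hdiff, ih, map_smul, URep.F_lower, smul_smul, ← add_smul,
      smul_smul]
    congr 1
    have h1 : qint (μ - (j : ℤ)) * qint ((j : ℤ) + 1) +
        (qint (((j + 1 : ℕ) : ℤ) + 1) * qint (μ - ((j + 1 : ℕ) : ℤ)) -
          qint (μ - ((j + 1 : ℕ) : ℤ) + 1) * qint ((j + 1 : ℕ) : ℤ)) =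
        qint (((j + 1 : ℕ) : ℤ) + 1) * qint (μ - ((j + 1 : ℕ) : ℤ)) := by
      rw [show μ - ((j + 1 : ℕ) : ℤ) + 1 = μ - j by push_cast; ring,
        show ((j + 1 : ℕ) : ℤ) = (j : ℤ) + 1 by push_cast; ring]
      ring
    rw [h1, ← mul_assoc, inv_mul_cancel₀ (hne _), one_mul]

variable {ι : Type} {β : Basis ι Cq M.V} {wt : ι → ℤ}

theorem IsWeightBasis.repr_K (hβ : IsWeightBasis M β wt) (v : M.V) (i : ι) :
    β.repr (M.ρ (Uq.gen .K) v) i = qq ^ wt i * β.repr v i := by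
  have h : (Finsupp.lapply i ∘ₗ β.repr.toLinearMap) ∘ₗ M.ρ (Uq.gen .K) =
      qq ^ wt i • (Finsupp.lapply i ∘ₗ β.repr.toLinearMap) := by
    refine β.ext fun j => ?_
    simp only [LinearMap.comp_apply, hβ j, map_smul, LinearMap.smul_apply, LinearEquiv.coe_coe,
      Basis.repr_self, Finsupp.lapply_apply, smul_eq_mul]
    by_cases hij : j = i
    · rw [hij]
    · rw [Finsupp.single_eq_of_ne (Ne.symm hij), mul_zero, mul_zero]
  exact congrArg (fun f => f v) h

/-- Different weights have different eigenvalues, so the eigenspaces of `K` are spanned by parts of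
the basis. -/
theorem IsWeightBasis.K_eq_iff (hβ : IsWeightBasis M β wt) (v : M.V) (m : ℤ) :
    M.ρ (Uq.gen .K) v = qq ^ m • v ↔ ∀ i, wt i ≠ m → β.repr v i = 0 := by
  constructor
  · intro h i hi
    have h1 := hβ.repr_K v i
    rw [h, map_smul, Finsupp.smul_apply, smul_eq_mul] at h1
    have h2 : (qq ^ m - qq ^ wt i) * β.repr v i = 0 := by rw [sub_mul, h1, sub_self]
    rcases mul_eq_zero.1 h2 with h3 | h3
    · exact absurd (qq_zpow_injective (sub_eq_zero.1 h3)).symm hi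
    · exact h3
  · intro h
    apply β.repr.injective
    ext i
    rw [hβ.repr_K, map_smul, Finsupp.smul_apply, smul_eq_mul]
    by_cases hi : wt i = m
    · rw [hi]
    · rw [h i hi, mul_zero, mul_zero]

/-- Only finitely many weights occur, so `lower x j` vanishes for large `j`. For `j > μ`, `E` maps
`lower x (j + 1)` to the nonzero multiple `[μ - j]` of `lower x j`, and the vanishing descends to `j
= μ + 1`. -/
theorem IsWeightBasis.lower_eq_zero [Finite ι] (hβ : IsWeightBasis M β wt) {μ : ℕ}
    (hK : M.ρ (Uq.gen .K) x = qq ^ (μ : ℤ) • x) (hE : M.ρ (Uq.gen .E) x = 0) :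
    M.lower x (μ + 1) = 0 := by
  obtain ⟨N, hN⟩ : ∃ N : ℕ, ∀ j : ℕ, N ≤ j → ∀ i, wt i ≠ (μ : ℤ) - 2 * j := by
    obtain ⟨B, hB⟩ := (Set.finite_range fun i => (μ : ℤ) - wt i).bddAbove
    refine ⟨B.toNat + 1, fun j hj i hi => ?_⟩
    have := hB ⟨i, rfl⟩
    simp only at this
    omega
  have hlarge : ∀ j, N ≤ j → M.lower x j = 0 := by
    intro j hj
    apply β.repr.injective
    ext i
    rw [map_zero, Finsupp.zero_apply]
    exact (hβ.K_eq_iff _ _).1 (URep.K_lower hK j) i (hN j hj i)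
  have hstep : ∀ j, μ + 1 ≤ j → M.lower x (j + 1) = 0 → M.lower x j = 0 := by
    intro j hj h
    have h1 := URep.E_lower_succ hK hE j
    rw [h, map_zero] at h1
    exact (smul_eq_zero.1 h1.symm).resolve_left (qint_ne_zero (by omega))
  have hall : ∀ n : ℕ, M.lower x (μ + 1 + (N - n)) = 0 := by
    intro n
    induction n with
    | zero => exact hlarge _ (by omega)
    | succ n ih =>
      by_cases hn : n < N
      · refine hstep _ (by omega) ?_
        rw [← ih]
        congr 1
        omega
      · rw [← ih]
        congr 1
        omega
  simpa using hall N

end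

/-- The map `V_μ → M` that sends the highest weight vector to `x`. -/
def URep.fromIrr (M : URep) (μ : ℕ) (x : M.V) : (Fin (μ + 1) → Cq) →ₗ[Cq] M.V where
  toFun v := ∑ j ∈ Finset.range (μ + 1), vext v j • M.lower x j
  map_add' v w := by
    rw [← Finset.sum_add_distrib]
    refine Finset.sum_congr rfl fun j hj => ?_
    rw [Finset.mem_range] at hj
    simp only [vext, dif_pos hj, Pi.add_apply, add_smul]
  map_smul' c v := by
    rw [Finset.smul_sum]
    refine Finset.sum_congr rfl fun j hj => ?_
    rw [Finset.mem_range] at hj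
    simp only [vext, dif_pos hj, Pi.smul_apply, smul_smul, RingHom.id_apply, smul_eq_mul]

theorem URep.fromIrr_apply (M : URep) (μ : ℕ) (x : M.V) (v : Fin (μ + 1) → Cq) :
    M.fromIrr μ x v = ∑ j ∈ Finset.range (μ + 1), vext v j • M.lower x j := rfl

theorem vext_of_lt {μ : ℕ} (v : Fin (μ + 1) → Cq) {j : ℕ} (hj : j < μ + 1) :
    vext v j = v ⟨j, hj⟩ := dif_pos hj

/-- Both sums have the same terms up to a shift of the index. The end terms drop out because `E x =
0`, `lower x (μ + 1) = 0` and `[0] = 0`. -/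
theorem URep.fromIrr_gen {M : URep} {μ : ℕ} {x : M.V}
    (hK : M.ρ (Uq.gen .K) x = qq ^ (μ : ℤ) • x) (hE : M.ρ (Uq.gen .E) x = 0)
    (hF : M.lower x (μ + 1) = 0) (s : UqGen) (v : Fin (μ + 1) → Cq) :
    M.fromIrr μ x (irrGen μ s v) = M.ρ (Uq.gen s) (M.fromIrr μ x v) := by
  rw [fromIrr_apply, fromIrr_apply, map_sum]
  simp only [map_smul]
  cases s with
  | E =>
    have h1 : ∀ j ∈ Finset.range (μ + 1), vext (irrGen μ .E v) j • M.lower x j =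
        (qint ((μ : ℤ) - j) * vext v (j + 1)) • M.lower x j := fun j hj => by
      rw [vext_of_lt _ (Finset.mem_range.1 hj), irrGen_E_apply]
    rw [Finset.sum_congr rfl h1, Finset.sum_range_succ, Finset.sum_range_succ' _ μ, sub_self,
      qint_zero, zero_mul, zero_smul, add_zero]
    rw [show M.lower x 0 = x from rfl, hE, smul_zero, add_zero]
    refine Finset.sum_congr rfl fun j _ => ?_
    rw [E_lower_succ hK hE, smul_smul, mul_comm]
  | F =>
    have h1 : ∀ j ∈ Finset.range (μ + 1), vext (irrGen μ .F v) j • M.lower x j =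
        (qint ((j : ℕ) : ℤ) * vext v (j - 1)) • M.lower x j := fun j hj => by
      rw [vext_of_lt _ (Finset.mem_range.1 hj), irrGen_F_apply]
    rw [Finset.sum_congr rfl h1, Finset.sum_range_succ' _ μ, Finset.sum_range_succ, F_lower, hF,
      smul_zero, smul_zero, Nat.cast_zero, qint_zero, zero_mul, zero_smul]
    refine congrArg (· + _) (Finset.sum_congr rfl fun j _ => ?_)
    rw [F_lower, smul_smul, mul_comm, Nat.add_sub_cancel]
    push_cast
    rfl
  | K =>
    refine Finset.sum_congr rfl fun j hj => ?_
    have hj := Finset.mem_range.1 hj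
    rw [vext_of_lt _ hj, vext_of_lt _ hj, irrGen_K_apply, K_lower hK, smul_smul, mul_comm]
  | Ki =>
    refine Finset.sum_congr rfl fun j hj => ?_
    have hj := Finset.mem_range.1 hj
    rw [vext_of_lt _ hj, vext_of_lt _ hj, irrGen_Ki_apply, Ki_of_K (K_lower hK j), smul_smul,
      mul_comm]

/-- A linearly independent family of highest weight vectors of weights `μ b` embeds the direct sum
of the `V_{μ b}`. -/
theorem URep.eq_zero_of_sum_lower_eq_zero {M : URep} {B : Type*} [Fintype B] {μ : B → ℕ}
    {x : B → M.V} (hx : LinearIndependent Cq x)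
    (hK : ∀ b, M.ρ (Uq.gen .K) (x b) = qq ^ (μ b : ℤ) • x b)
    (hE : ∀ b, M.ρ (Uq.gen .E) (x b) = 0) (J : ℕ) (g : B → ℕ → Cq)
    (hg : ∀ b j, μ b < j → g b j = 0)
    (h : ∑ b, ∑ j ∈ Finset.range J, g b j • M.lower (x b) j = 0) :
    ∀ b, ∀ j < J, g b j = 0 := by
  induction J with
  | zero => intro b j hj; omega
  | succ J ih =>
    have hlow : ∀ b, ∀ n j, j < n → ((M.ρ (Uq.gen .E)) ^ n) (M.lower (x b) j) = 0 := by
      intro b n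
      induction n with
      | zero => intro j hj; omega
      | succ n ihn =>
        intro j hj
        rw [pow_succ, Module.End.mul_apply]
        cases j with
        | zero => rw [show M.lower (x b) 0 = x b from rfl, hE, map_zero]
        | succ j => rw [E_lower_succ (hK b) (hE b), map_smul, ihn j (by omega), smul_zero]
    have htop : ∀ b, ∀ n ≤ μ b, ∃ c : Cq, c ≠ 0 ∧
        ((M.ρ (Uq.gen .E)) ^ n) (M.lower (x b) n) = c • x b := by
      intro b n
      induction n with
      | zero => exact fun _ => ⟨1, one_ne_zero, by simp [lower]⟩
      | succ n ihn =>
        intro hn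
        obtain ⟨c, hc, h1⟩ := ihn (by omega)
        refine ⟨qint (μ b - n) * c, mul_ne_zero (qint_ne_zero (by omega)) hc, ?_⟩
        rw [pow_succ, Module.End.mul_apply, E_lower_succ (hK b) (hE b), map_smul, h1, smul_smul]
    have htop' : ∀ b, ∃ c : Cq, c ≠ 0 ∧
        g b J • ((M.ρ (Uq.gen .E)) ^ J) (M.lower (x b) J) = (g b J * c) • x b := by
      intro b
      by_cases hJ : J ≤ μ b
      · obtain ⟨c, hc, h1⟩ := htop b J hJ
        exact ⟨c, hc, by rw [h1, smul_smul]⟩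
      · exact ⟨1, one_ne_zero, by rw [hg b J (by omega), zero_smul, zero_mul, zero_smul]⟩
    choose c hc hc' using htop'
    -- `E ^ J` kills all terms with `j < J` and sends each surviving top term to a nonzero multiple
    -- of `x b`, so independence of the `x b` gives `g b J = 0`.
    have h1 := congrArg ((M.ρ (Uq.gen .E)) ^ J) h
    rw [map_zero, map_sum] at h1
    have h2 : ∀ b, ((M.ρ (Uq.gen .E)) ^ J)
        (∑ j ∈ Finset.range (J + 1), g b j • M.lower (x b) j) = (g b J * c b) • x b := by
      intro b
      rw [map_sum, Finset.sum_range_succ, map_smul, hc', Finset.sum_eq_zero, zero_add]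
      intro j hj
      rw [map_smul, hlow b J j (Finset.mem_range.1 hj), smul_zero]
    simp only [h2] at h1
    have h3 := Fintype.linearIndependent_iff.1 hx _ h1
    have h4 : ∀ b, g b J = 0 := fun b => (mul_eq_zero.1 (h3 b)).resolve_right (hc b)
    have h5 := ih (by
      rw [← h]
      refine Finset.sum_congr rfl fun b _ => ?_
      rw [Finset.sum_range_succ, h4, zero_smul, add_zero])
    intro b j hj
    rcases Nat.lt_succ_iff_lt_or_eq.1 hj with hj | rfl
    · exact h5 b j hj
    · exact h4 b

/-- `E` maps weight `m` to weight `m + 2`, so its kernel in weight `m` has at least the dimension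
prescribed by `hB`. Vectors are chosen independently in each weight. -/
theorem exists_highest_weight_family {M : URep} {ι : Type} [Finite ι] {β : Basis ι Cq M.V}
    {wt : ι → ℤ} (hβ : IsWeightBasis M β wt) {B : Type} [Fintype B] (μ : B → ℕ)
    (hB : ∀ m : ℕ, Nat.card {b // μ b = m} + Nat.card {i // wt i = (m : ℤ) + 2} =
      Nat.card {i // wt i = m}) :
    ∃ x : B → M.V, LinearIndependent Cq x ∧
      (∀ b, M.ρ (Uq.gen .K) (x b) = qq ^ (μ b : ℤ) • x b) ∧
      ∀ b, M.ρ (Uq.gen .E) (x b) = 0 := by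
  classical
  have hfd : FiniteDimensional Cq M.V := β.finiteDimensional_of_finite
  have hmem : ∀ (m : ℤ) (v : M.V), v ∈ coordSpan β {i | wt i = m} ↔
      M.ρ (Uq.gen .K) v = qq ^ m • v := by
    intro m v
    rw [hβ.K_eq_iff, coordSpan, Basis.mem_span_image]
    constructor
    · intro h i hi
      by_contra h'
      exact hi (h (Finsupp.mem_support_iff.2 h'))
    · intro h i hi
      by_contra h'
      exact Finsupp.mem_support_iff.1 hi (h i h')
  have hS : ∀ m : ℕ, Nat.card {b // μ b = m} ≤
      finrank Cq (LinearMap.ker (M.ρ (Uq.gen .E)) ⊓ coordSpan β {i | wt i = (m : ℤ)} :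
        Submodule Cq M.V) := by
    intro m
    have h1 := finrank_map_add (M.ρ (Uq.gen .E)) (coordSpan β {i | wt i = (m : ℤ)})
    have h2 : finrank Cq ((coordSpan β {i | wt i = (m : ℤ)}).map (M.ρ (Uq.gen .E))) ≤
        finrank Cq (coordSpan β {i | wt i = (m : ℤ) + 2}) := by
      refine Submodule.finrank_mono ?_
      rintro _ ⟨v, hv, rfl⟩
      rw [hmem, URep.K_E, (hmem _ _).1 hv, map_smul, smul_smul, ← zpow_add₀ qq_ne_zero, add_comm]
    rw [finrank_coordSpan] at h1 h2
    have h3 := hB m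
    change _ ≤ Nat.card {i // wt i = (m : ℤ) + 2} at h2
    change _ = Nat.card {i // wt i = (m : ℤ)} at h1
    omega
  have hy : ∀ m : ℕ, ∃ y : {b // μ b = m} → M.V, LinearIndependent Cq y ∧
      ∀ b, M.ρ (Uq.gen .E) (y b) = 0 ∧ M.ρ (Uq.gen .K) (y b) = qq ^ (m : ℤ) • y b := by
    intro m
    let S : Submodule Cq M.V :=
      LinearMap.ker (M.ρ (Uq.gen .E)) ⊓ coordSpan β {i | wt i = (m : ℤ)}
    have hcard : Fintype.card {b // μ b = m} ≤ Fintype.card (Fin (finrank Cq S)) := by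
      rw [Fintype.card_fin, ← Nat.card_eq_fintype_card]
      exact hS m
    obtain ⟨e⟩ := Function.Embedding.nonempty_of_card_le hcard
    refine ⟨fun b => (finBasis Cq S (e b) : M.V), ?_, fun b => ?_⟩
    · exact ((finBasis Cq S).linearIndependent.comp e e.injective).map' S.subtype S.ker_subtype
    · have h := (finBasis Cq S (e b)).2
      exact ⟨h.1, (hmem _ _).1 h.2⟩
  choose y hy1 hy2 using hy
  have hKx : ∀ b, M.ρ (Uq.gen .K) (y (μ b) ⟨b, rfl⟩) =
      qq ^ (μ b : ℤ) • y (μ b) ⟨b, rfl⟩ := fun b => (hy2 _ _).2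
  refine ⟨fun b => y (μ b) ⟨b, rfl⟩, ?_, hKx, fun b => (hy2 _ _).1⟩
  rw [Fintype.linearIndependent_iff]
  intro c hc
  -- Vectors of different weights involve disjoint parts of the basis, so a relation splits into one
  -- for each weight.
  have hz : ∀ m : ℕ, ∑ b : {b // μ b = m}, c b • y m b = 0 := by
    intro m
    have h1 : ∀ b : {b // μ b = m}, y m b = y (μ b.1) ⟨b.1, rfl⟩ := by
      rintro ⟨b, rfl⟩
      rfl
    apply β.repr.injective
    ext i
    rw [map_zero, Finsupp.zero_apply, map_sum, Finsupp.finsetSum_apply]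
    by_cases hi : wt i = (m : ℤ)
    · have h2 := congrArg (fun v => β.repr v i) hc
      simp only [map_sum, Finsupp.finsetSum_apply, map_zero, Finsupp.zero_apply] at h2
      have h3 : ∀ b ∈ Finset.univ, b ∉ Finset.univ.filter (fun b => μ b = m) →
          β.repr (c b • y (μ b) ⟨b, rfl⟩) i = 0 := by
        intro b _ hb
        have hb : wt i ≠ (μ b : ℤ) := fun h => hb (Finset.mem_filter.2
          ⟨Finset.mem_univ _, by exact_mod_cast (h.symm.trans hi)⟩)
        rw [map_smul, Finsupp.smul_apply, (hβ.K_eq_iff _ _).1 (hKx b) i hb, smul_zero]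
      rw [← h2, ← Finset.sum_subset (Finset.subset_univ _) h3,
        Finset.sum_subtype (p := fun b => μ b = m) _ (by simp)]
      refine Finset.sum_congr rfl fun b _ => ?_
      rw [h1]
    · refine Finset.sum_eq_zero fun b _ => ?_
      rw [map_smul, Finsupp.smul_apply, (hβ.K_eq_iff _ _).1 (hy2 m b).2 i hi, smul_zero]
  intro b
  exact Fintype.linearIndependent_iff.1 (hy1 (μ b)) _ (hz (μ b)) ⟨b, rfl⟩

end

noncomputable section

open Module

/-! ### The decomposition of `V_{d_1} ⊗ ⋯ ⊗ V_{d_k}` -/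

section

variable {k : ℕ}

/-- Equality of characters provides as many highest weight vectors of weight `m` as there are `b`
with `b.mu = m`. The induced map from the sum of the `V_{μ(b)}` is injective, hence bijective by
dimension. -/
theorem exists_equiv_tens (d : Fin k → ℕ) : ∃ Ψ : Coord d ≃ₗ[Cq] (tens (List.ofFn d)).V,
    ∀ (s : UqGen) (g : Coord d),
      Ψ (g.act s) = (tens (List.ofFn d)).ρ (Uq.gen s) (Ψ g) := by
  classical
  have : Fintype (LCM d) := Fintype.ofFinite _
  obtain ⟨ι, _, β, wt, hβ, hwt⟩ := tens_hasChar (List.ofFn d)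
  generalize tens (List.ofFn d) = M at *
  rw [List.map_ofFn, List.prod_ofFn] at hwt
  obtain ⟨h1, h2⟩ := card_of_sum_T_eq wt (fun b : LCM d => b.mu) (hwt.trans sum_ch_mu.symm)
  obtain ⟨x, hx, hK, hE⟩ := exists_highest_weight_family hβ (fun b : LCM d => b.mu) h1
  have hF : ∀ b, M.lower (x b) (b.mu + 1) = 0 := fun b => hβ.lower_eq_zero (hK b) (hE b)
  let f : Coord d →ₗ[Cq] M.V := ∑ b : LCM d, M.fromIrr b.mu (x b) ∘ₗ LinearMap.proj b
  have hf : ∀ g, f g = ∑ b : LCM d, M.fromIrr b.mu (x b) (g b) := fun g => by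
    simp [f, LinearMap.sum_apply]
  have hinj : Function.Injective f := by
    rw [← LinearMap.ker_eq_bot, LinearMap.ker_eq_bot']
    intro g hg
    -- The total dimension serves as a common length for the sums over all `b`.
    have hJ : ∀ b : LCM d, b.mu + 1 ≤ ∑ b : LCM d, (b.mu + 1) := fun b =>
      Finset.single_le_sum (f := fun b : LCM d => b.mu + 1) (fun _ _ => Nat.zero_le _)
        (Finset.mem_univ b)
    have h0 : ∀ b j, b.mu < j → vext (g b) j = 0 := fun b j hj => dif_neg (by omega)
    have h3 := URep.eq_zero_of_sum_lower_eq_zero hx hK hE (∑ b : LCM d, (b.mu + 1))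
      (fun b j => vext (g b) j) h0 (by
        rw [← hg, hf]
        refine Finset.sum_congr rfl fun b _ => ?_
        rw [URep.fromIrr_apply]
        symm
        refine Finset.sum_subset (Finset.range_mono (hJ b)) fun j _ hj => ?_
        rw [h0 b j (by rw [Finset.mem_range] at hj; omega), zero_smul])
    funext b j
    have h4 := h3 b j (by have := hJ b; omega)
    rwa [vext_val] at h4
  have hdim : finrank Cq (Coord d) = finrank Cq M.V := by
    rw [finrank_eq_card_basis β, h2, Module.finrank_pi_fintype]
    refine Finset.sum_congr rfl fun b _ => ?_
    rw [Module.finrank_fin_fun]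
  have : FiniteDimensional Cq M.V := β.finiteDimensional_of_finite
  refine ⟨LinearEquiv.ofInjectiveOfFinrankEq f hinj hdim, fun s g => ?_⟩
  change f (g.act s) = M.ρ (Uq.gen s) (f g)
  rw [hf, hf, map_sum]
  exact Finset.sum_congr rfl fun b _ => URep.fromIrr_gen (hK b) (hE b) (hF b) s (g b)

end

/-! ### Intertwiners -/

theorem Uq.induction {P : Uq → Prop} (h0 : ∀ c : Cq, P (algebraMap Cq Uq c))
    (hg : ∀ s, P (Uq.gen s)) (hadd : ∀ u v, P u → P v → P (u + v))
    (hmul : ∀ u v, P u → P v → P (u * v)) (u : Uq) : P u := by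
  obtain ⟨a, rfl⟩ := RingQuot.mkAlgHom_surjective Cq UqRel u
  induction a using FreeAlgebra.induction with
  | grade0 c => rw [AlgHom.commutes]; exact h0 c
  | grade1 s => exact hg s
  | mul a b ha hb => rw [map_mul]; exact hmul _ _ ha hb
  | add a b ha hb => rw [map_add]; exact hadd _ _ ha hb

theorem URep.mem_Hom_of_gen {M N : URep} (f : M.V →ₗ[Cq] N.V)
    (h : ∀ s v, f (M.ρ (Uq.gen s) v) = N.ρ (Uq.gen s) (f v)) : f ∈ URep.Hom M N := by
  intro u
  induction u using Uq.induction with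
  | h0 c => intro v; simp [Module.algebraMap_end_apply]
  | hg s => exact h s
  | hadd u v hu hv => intro x; simp only [map_add, LinearMap.add_apply, hu, hv]
  | hmul u v hu hv => intro x; simp only [map_mul, Module.End.mul_apply, hu, hv]

/-- The highest weight vector generates `V_ν` under `F`, as the coefficients `[j + 1]` are nonzero.
-/
theorem irrGen_hom_ext {ν : ℕ} {W : Type*} [AddCommGroup W] [Module Cq W] {T : W →ₗ[Cq] W}
    {f g : (Fin (ν + 1) → Cq) →ₗ[Cq] W} (hf : ∀ v, f (irrGen ν .F v) = T (f v))
    (hg : ∀ v, g (irrGen ν .F v) = T (g v)) (h : f (vvec ν ν) = g (vvec ν ν)) : f = g := by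
  have hall : ∀ j : ℕ, j ≤ ν → f (vvec ν (ν - 2 * j)) = g (vvec ν (ν - 2 * j)) := by
    intro j
    induction j with
    | zero => simpa using h
    | succ j ih =>
      intro hj
      have h1 := irrGen_F_vvec (μ := ν) (j := j) (by omega)
      have h2 : f (irrGen ν .F (vvec ν (ν - 2 * j))) = g (irrGen ν .F (vvec ν (ν - 2 * j))) := by
        rw [hf, hg, ih (by omega)]
      rw [h1, map_smul, map_smul] at h2
      have h3 := smul_right_injective W (qint_ne_zero (n := (j : ℤ) + 1) (by omega)) h2
      rwa [show (ν : ℤ) - 2 * (j + 1 : ℕ) = ν - 2 * j - 2 by push_cast; ring]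
  refine (Pi.basisFun Cq (Fin (ν + 1))).ext fun j => ?_
  rw [basisFun_eq_vvec]
  exact hall j (by omega)

/-- The image of the highest weight vector has weight `ν` and is killed by `E`. In `V_μ` only
multiples of `v_μ` are killed by `E`, because `[μ - j] ≠ 0` for `j < μ`. -/
theorem irrGen_hom_apply_vvec {ν μ : ℕ} {f : (Fin (ν + 1) → Cq) →ₗ[Cq] (Fin (μ + 1) → Cq)}
    (hf : ∀ s v, f (irrGen ν s v) = irrGen μ s (f v)) (j : Fin (μ + 1))
    (hj : f (vvec ν ν) j ≠ 0) : (j : ℕ) = 0 ∧ ν = μ := by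
  have hE : irrGen ν .E (vvec ν ν) = 0 := by
    have h := irrGen_E_vvec (Nat.zero_le ν)
    rw [Nat.cast_zero, mul_zero, sub_zero] at h
    rw [h, vvec_eq_zero (fun i hi => by omega), smul_zero]
  have h1 := hf .E (vvec ν ν)
  have h2 := congrFun (hf .K (vvec ν ν)) j
  rw [hE, map_zero] at h1
  rw [irrGen_K_vvec, map_smul, irrGen_K_apply, Pi.smul_apply, smul_eq_mul] at h2
  have h3 := qq_zpow_injective (mul_right_cancel₀ hj h2)
  have h4 : (j : ℕ) = 0 := by
    by_contra hj0
    have h5 := congrFun h1 ⟨j - 1, by omega⟩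
    rw [irrGen_E_apply, Pi.zero_apply] at h5
    simp only [Nat.sub_add_cancel (Nat.pos_of_ne_zero hj0), vext_val] at h5
    exact hj ((mul_eq_zero.1 h5.symm).resolve_left (qint_ne_zero (by omega)))
  exact ⟨h4, by omega⟩

/-- Schur's lemma for two different modules `V_ν` and `V_μ`. -/
theorem irrGen_hom_eq_zero {ν μ : ℕ} (h : ν ≠ μ)
    {f : (Fin (ν + 1) → Cq) →ₗ[Cq] (Fin (μ + 1) → Cq)}
    (hf : ∀ s v, f (irrGen ν s v) = irrGen μ s (f v)) : f = 0 := by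
  refine irrGen_hom_ext (hf .F) (fun v => (map_zero _).symm) (funext fun j => ?_)
  by_contra hj
  exact h (irrGen_hom_apply_vvec hf j hj).2

/-- Schur's lemma for an endomorphism of `V_μ`. -/
theorem irrGen_hom_eq_smul {μ : ℕ} {f : (Fin (μ + 1) → Cq) →ₗ[Cq] (Fin (μ + 1) → Cq)}
    (hf : ∀ s v, f (irrGen μ s v) = irrGen μ s (f v)) : ∃ c : Cq, f = c • LinearMap.id := by
  refine ⟨f (vvec μ μ) 0, irrGen_hom_ext (hf .F) (fun v => ?_) (funext fun j => ?_)⟩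
  · exact (map_smul (irrGen μ .F) _ _).symm
  · rw [LinearMap.smul_apply, LinearMap.id_apply, Pi.smul_apply, smul_eq_mul]
    by_cases hj : (j : ℕ) = 0
    · obtain rfl : j = 0 := Fin.ext hj
      simp [vvec]
    · have h1 : f (vvec μ μ) j = 0 := by
        by_contra h
        exact hj (irrGen_hom_apply_vvec hf j h).1
      rw [h1, vvec, if_neg (by omega), mul_zero]

section

variable {k : ℕ} {d : Fin k → ℕ}

/-- The intertwiners of `M` that come from an isomorphism of `M` with a direct sum of `V_μ`. -/
def Coord.hom {M : URep} (Θ : M.V ≃ₗ[Cq] Coord d)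
    (hΘ : ∀ s v, Θ (M.ρ (Uq.gen s) v) = (Θ v).act s) (b : LCM d) : URep.Hom M (irr b.mu) :=
  ⟨(LinearMap.proj b).comp ((b.const • Θ.toLinearMap)), URep.mem_Hom_of_gen _ fun s v => by
    rw [irr_ρ_gen]
    refine (congrArg (fun g : Coord d => b.const • g b) (hΘ s v)).trans ?_
    exact (map_smul (irrGen b.mu s) b.const (Θ v b)).symm⟩

theorem Coord.act_single [DecidableEq (LCM d)] (s : UqGen) (b : LCM d) (v : Fin (b.mu + 1) → Cq) :
    Coord.act s (Pi.single b v) = Pi.single b (irrGen b.mu s v) := by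
  funext b'
  by_cases h : b' = b
  · subst h
    rw [Coord.act, Pi.single_eq_same, Pi.single_eq_same]
  · rw [Coord.act, Pi.single_eq_of_ne h, Pi.single_eq_of_ne h, map_zero]

/-- An intertwiner to `V_μ`, read in coordinates, is the sum of its restrictions `ψb` to the factors
`V_{μ(b)}`. By Schur's lemma these are scalars if `b.mu = μ` and zero otherwise. -/
theorem Coord.span_hom {M : URep} (Θ : M.V ≃ₗ[Cq] Coord d)
    (hΘ : ∀ s v, Θ (M.ρ (Uq.gen s) v) = (Θ v).act s) :
    Submodule.span Cq (Set.range fun b : LCM d =>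
      DirectSum.lof Cq ℕ (fun μ => URep.Hom M (irr μ)) b.mu (Coord.hom Θ hΘ b)) = ⊤ := by
  classical
  have : Fintype (LCM d) := Fintype.ofFinite _
  set S := Submodule.span Cq (Set.range fun b : LCM d =>
      DirectSum.lof Cq ℕ (fun μ => URep.Hom M (irr μ)) b.mu (Coord.hom Θ hΘ b)) with hS
  have key : ∀ (μ : ℕ) (φ : URep.Hom M (irr μ)),
      DirectSum.lof Cq ℕ (fun μ => URep.Hom M (irr μ)) μ φ ∈ S := by
    intro μ φ
    let ψ : Coord d →ₗ[Cq] (Fin (μ + 1) → Cq) := φ.1.comp Θ.symm.toLinearMap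
    have hψ : ∀ s g, ψ (g.act s) = irrGen μ s (ψ g) := by
      intro s g
      obtain ⟨v, rfl⟩ := Θ.surjective g
      rw [← hΘ, ← irr_ρ_gen]
      change φ.1 (Θ.symm (Θ _)) = (irr μ).ρ (Uq.gen s) (φ.1 (Θ.symm (Θ v)))
      rw [LinearEquiv.symm_apply_apply, LinearEquiv.symm_apply_apply]
      exact φ.2 _ _
    let ψb : ∀ b : LCM d, (Fin (b.mu + 1) → Cq) →ₗ[Cq] (Fin (μ + 1) → Cq) := fun b =>
      ψ.comp (LinearMap.single Cq (fun b : LCM d => Fin (b.mu + 1) → Cq) b)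
    have hψb : ∀ b s v, ψb b (irrGen b.mu s v) = irrGen μ s (ψb b v) := by
      intro b s v
      have h1 := hψ s (Pi.single b v)
      rwa [Coord.act_single] at h1
    have hsum : ∀ g, ψ g = ∑ b, ψb b (g b) := by
      intro g
      conv_lhs => rw [← Finset.univ_sum_single g, map_sum]
      rfl
    let T : LCM d → URep.Hom M (irr μ) := fun b =>
      ⟨(ψb b).comp ((LinearMap.proj b).comp Θ.toLinearMap), URep.mem_Hom_of_gen _ fun s v => by
        rw [irr_ρ_gen]
        exact (congrArg (fun g : Coord d => ψb b (g b)) (hΘ s v)).trans (hψb b s (Θ v b))⟩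
    have hφ : φ = ∑ b, T b := by
      refine Subtype.ext (LinearMap.ext fun v => ?_)
      rw [AddSubmonoidClass.coe_finsetSum, LinearMap.sum_apply]
      refine Eq.trans ?_ (hsum (Θ v))
      exact (congrArg φ.1 (Θ.symm_apply_apply v)).symm
    rw [hφ, map_sum]
    refine Submodule.sum_mem _ fun b _ => ?_
    by_cases hb : b.mu = μ
    · subst hb
      obtain ⟨c, hc⟩ := irrGen_hom_eq_smul (hψb b)
      -- `Coord.hom` carries the factor `b.const`, which is invertible and is divided out here.
      have hT : T b = (c * b.const⁻¹) • Coord.hom Θ hΘ b := by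
        refine Subtype.ext (LinearMap.ext fun v => ?_)
        refine (congrArg (fun f => f (Θ v b)) hc).trans ?_
        change c • Θ v b = (c * b.const⁻¹) • b.const • Θ v b
        rw [smul_smul, inv_mul_cancel_right₀ b.const_ne_zero]
      rw [hT, map_smul]
      exact Submodule.smul_mem _ _ (Submodule.subset_span ⟨b, rfl⟩)
    · have hT : T b = 0 := by
        refine Subtype.ext (LinearMap.ext fun v => ?_)
        exact congrArg (fun f => f (Θ v b)) (irrGen_hom_eq_zero hb (hψb b))
      rw [hT, map_zero]
      exact zero_mem _
  rw [eq_top_iff]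
  rintro x -
  induction x using DirectSum.induction_on with
  | zero => exact zero_mem _
  | of μ φ => exact key μ φ
  | add x y hx hy => exact add_mem hx hy

end

end

/-! ### Coordinates of the functions `1_{Y_a}`, and the theorem. -/

noncomputable section

open Module

section

variable {k : ℕ} {d : Fin k → ℕ} {F D : Type} [Field F] [AddCommGroup D] [Module F D]
  [FiniteDimensional F D]

theorem equivTs_symm_basisTs [DecidableEq (Σ b : LCM d, Fin (b.mu + 1))]
    (hD : finrank F D = ∑ i, d i) (a : OLCM d) (b : LCM d) (j : Fin (b.mu + 1)) :
    (equivTs hD).symm (basisTs (F := F) hD a) b j =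
      if (⟨b, j⟩ : Σ b : LCM d, Fin (b.mu + 1)) = OLCM.equivSigma a then 1 else 0 := by
  rw [basisTs, Basis.map_apply, Basis.reindex_apply, Equiv.symm_symm, LinearEquiv.trans_apply,
    LinearEquiv.symm_apply_apply, LinearEquiv.piCurry_apply, Sigma.curry, Pi.basisFun_apply,
    Pi.single_apply]

theorem equivTs_symm_basisTs_same (hD : finrank F D = ∑ i, d i) (a : OLCM d) :
    (equivTs hD).symm (basisTs (F := F) hD a) a.toLCM =
      Pi.basisFun Cq (Fin (a.mu + 1))
        ⟨a.down.card - a.r, Nat.lt_succ_of_le (Nat.sub_le_iff_le_add'.2 a.card_down_le)⟩ := by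
  classical
  funext j
  rw [equivTs_symm_basisTs, Pi.basisFun_apply, Pi.single_apply]
  refine if_congr ?_ rfl rfl
  exact (sigma_mk_injective (β := fun b : LCM d => Fin (b.mu + 1)) (i := a.toLCM)).eq_iff

theorem equivTs_symm_basisTs_of_ne (hD : finrank F D = ∑ i, d i) {a : OLCM d} {b : LCM d}
    (hb : b ≠ a.toLCM) : (equivTs hD).symm (basisTs (F := F) hD a) b = 0 := by
  classical
  funext j
  rw [equivTs_symm_basisTs, if_neg fun h => hb (congrArg Sigma.fst h), Pi.zero_apply]

end

end

theorem mainTheorem7 {k : ℕ} (d : Fin k → ℕ) :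
    -- the constants `c_b`
    ∃ c : LCM d → Cq, (∀ b, c b ≠ 0) ∧
    ∀ (F D : Type) [Field F] [Finite F] [AddCommGroup D] [Module F D] [FiniteDimensional F D],
      Module.finrank F D = ∑ i, d i →
      -- the functions `1_{Y_a}` form a basis of `𝓣_s(𝐝)`
      (LinearIndependent Cq (fun a : OLCM d => (Ya F D a).indicator (1 : TPt F D d → Cq)) ∧
        Submodule.span Cq (Set.range fun a : OLCM d =>
          (Ya F D a).indicator (1 : TPt F D d → Cq)) = Ts F D d) ∧
      -- `V_μ` is isomorphic to `𝓜^r(d)` as a `U_q`-module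
      (∀ b : LCM d, b.mu + 2 * b.r = ∑ i, d i ∧
        Function.Injective (irrToM F D b.mu b.r) ∧
        LinearMap.range (irrToM F D b.mu b.r) = Mr F D b.r ∧
        ∀ (g : UqGen) (v : (irr b.mu).V),
          irrToM F D b.mu b.r ((irr b.mu).ρ (Uq.gen g) v) =
            actM g (irrToM F D b.mu b.r v)) ∧
      -- `V_{d_1} ⊗ ⋯ ⊗ V_{d_k}` is isomorphic to `𝓣_s(𝐝)` as a `U_q`-module
      (∃ Φ : (tens (List.ofFn d)).V ≃ₗ[Cq] Ts F D d, ∀ (g : UqGen) (v : (tens (List.ofFn d)).V),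
        (Φ ((tens (List.ofFn d)).ρ (Uq.gen g) v) : TPt F D d → Cq) = actT g (Φ v)) ∧
      -- under any such isomorphism, the `T_{Y_b}` are intertwiners and span `⨁_μ H_μ`
      (∀ Φ : (tens (List.ofFn d)).V ≃ₗ[Cq] Ts F D d,
        (∀ (g : UqGen) (v : (tens (List.ofFn d)).V),
          (Φ ((tens (List.ofFn d)).ρ (Uq.gen g) v) : TPt F D d → Cq) = actT g (Φ v)) →
        ∃ γ : ∀ b : LCM d, URep.Hom (tens (List.ofFn d)) (irr b.mu),
          (∀ (b : LCM d) (v : (tens (List.ofFn d)).V),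
            irrToM F D b.mu b.r ((γ b : (tens (List.ofFn d)).V →ₗ[Cq] (irr b.mu).V) v) =
              TY (Yb F D b) (Φ v)) ∧
          Submodule.span Cq (Set.range fun b : LCM d =>
            DirectSum.lof Cq ℕ (fun μ => URep.Hom (tens (List.ofFn d)) (irr μ)) b.mu (γ b)) = ⊤) ∧
      -- the action of the `T_{Y_b}` on the basis
      (∀ (a : OLCM d) (b : LCM d),
        (a.toLCM = b → TY (Yb F D b) ((Ya F D a).indicator 1) = c b • indM F D b.r a.down.card) ∧
        (a.toLCM ≠ b → TY (Yb F D b) ((Ya F D a).indicator 1) = 0)) := by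
  refine ⟨LCM.const, LCM.const_ne_zero, fun F D _ _ _ _ _ hD => ⟨⟨?_, ?_⟩, fun b =>
    ⟨b.mu_add_two_mul_r, toM_injective hD b, range_toM hD b, fun s v => ?_⟩, ?_, fun Φ hΦ => ?_,
    fun a b => ?_⟩⟩
  · have h := (basisTs (F := F) hD).linearIndependent.map' (Ts F D d).subtype (Ts F D d).ker_subtype
    rwa [show (Ts F D d).subtype ∘ basisTs hD = fun a : OLCM d => (Ya F D a).indicator 1 from
      funext (basisTs_apply hD)] at h
  · have h := congrArg (Submodule.map (Ts F D d).subtype) (basisTs (F := F) hD).span_eq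
    rwa [Submodule.map_span, ← Set.range_comp, Submodule.map_top, Submodule.range_subtype,
      show (Ts F D d).subtype ∘ basisTs hD = fun a : OLCM d => (Ya F D a).indicator 1 from
        funext (basisTs_apply hD)] at h
  · rw [irr_ρ_gen]
    exact actM_toM hD b s v
  · obtain ⟨Ψ, hΨ⟩ := exists_equiv_tens d
    refine ⟨Ψ.symm.trans (equivTs hD), fun s v => ?_⟩
    obtain ⟨g, rfl⟩ := Ψ.surjective v
    rw [← hΨ]
    simp only [LinearEquiv.trans_apply, LinearEquiv.symm_apply_apply, coe_equivTs, actT_liftT]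
  -- Any isomorphism `Φ`, followed by the passage to coordinates, identifies the tensor product with
  -- the sum of the `V_{μ(b)}`, so the spanning argument does not depend on the choice of `Φ`.
  · have hΘ : ∀ s v, (Φ.trans (equivTs hD).symm) ((tens (List.ofFn d)).ρ (Uq.gen s) v) =
        Coord.act s ((Φ.trans (equivTs hD).symm) v) := by
      intro s v
      rw [LinearEquiv.trans_apply, LinearEquiv.symm_apply_eq]
      refine Subtype.ext ?_
      rw [hΦ, coe_equivTs, ← actT_liftT, ← coe_equivTs hD, LinearEquiv.trans_apply,
        LinearEquiv.apply_symm_apply]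
    refine ⟨Coord.hom _ hΘ, fun b v => ?_, Coord.span_hom _ hΘ⟩
    have h := TY_liftT hD b ((equivTs hD).symm (Φ v))
    rw [← coe_equivTs hD, LinearEquiv.apply_symm_apply] at h
    exact h.symm
  -- In coordinates `1_{Y_a}` is a basis vector of the factor of its own match, and `T_{Y_b}` sees
  -- only the factor `b`.
  · have h := TY_liftT hD b ((equivTs hD).symm (basisTs (F := F) hD a))
    rw [← coe_equivTs hD, LinearEquiv.apply_symm_apply, basisTs_apply] at h
    rw [h]
    constructor
    · rintro rfl
      rw [equivTs_symm_basisTs_same, map_smul, toM, Module.Basis.constr_basis,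
        Nat.add_sub_cancel' a.r_le_card_down]
    · intro hab
      rw [equivTs_symm_basisTs_of_ne hD (Ne.symm hab), smul_zero, map_zero]
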